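/- Consider a dynamic graph $G$ on the vertex set $\{0,\dots,n-1\}$ that is initially empty and undergoes a sequence of $T$ updates, each of which inserts a missing edge or deletes an existing edge. A graph has arboricity at most $\alpha$ if $\lceil |E(G[S])|/(|S|-1)\rceil\le\alpha$ for every vertex set $S$ with $|S|\ge 2$. A $\lambda$-edge coloring assigns to every edge a color in $\{1,\dots,\lfloor\lambda\rfloor\}$ such that edges sharing an endpoint have different colors. The recourse of an update is the number of edges whose color changes, where gaining a color (insertion) or losing it (deletion) counts as a change. Running time is measured on a deterministic word RAM with zero-initialized memory, unit-cost word operations and words of $w\ge c\log_2(n+\alpha+\lceil 1/\varepsilon\rceil)$ bits, $c$ an absolute constant. Theorem. There are absolute constants $c, C$ and a deterministic dynamic algorithm with the following property. Let $0<\varepsilon<1$, let $n$ and $\alpha$ be natural numbers, and let a sequence of $T$ updates as above be given such that the arboricity of $G$ never exceeds $\alpha$. Let $\Delta$ be the maximum degree of $G$ throughout the entire sequence of updates. The algorithm, which is given $n$, $\alpha$ and $\lceil 1/\varepsilon\rceil$ in advance (but not $\Delta$) and receives the updates one at a time, explicitly maintains a $(\Delta+(4+\varepsilon)\alpha)$-edge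 coloring of $G$, i.e. has one stored in memory at the start and after every update. Every single update has recourse at most $C\,\frac{\log n}{\varepsilon}$, and the total time for handling all $T$ updates is at most $T\cdot C\,\frac{\log^2 n\,\log(\Delta+1)}{\varepsilon^2}$. -/

import Mathlib

/-! ## A deterministic word RAM with a step count

A machine word holds a number below `W = 2 ^ w`.  The memory consists of registers and of arrays
of words; registers and arrays are named by the program text (so a program uses only finitely many
of them), array cells are addressed by words computed at run time.  Every operation on words,
every memory access and every test costs one unit of time. -/

namespace WordRAM

/-- The contents of the memory. -/
structure Store where
  reg : ℕ → ℕ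
  arr : ℕ → ℕ → ℕ

/-- The unit-cost binary operations on words. -/
inductive Op where
  | add | sub | mul | div | mod | lt | eq

/-- Addition and multiplication are modulo the word bound `W`, subtraction is truncated at `0`,
comparisons return `1` or `0`. -/
def Op.eval (W : ℕ) : Op → ℕ → ℕ → ℕ
  | .add, x, y => (x + y) % W
  | .sub, x, y => x - y
  | .mul, x, y => (x * y) % W
  | .div, x, y => x / y
  | .mod, x, y => x % y
  | .lt, x, y => if x < y then 1 else 0
  | .eq, x, y => if x = y then 1 else 0

/-- Expressions: literals, registers, array cells, and operations. -/
inductive Expr where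
  | lit (k : ℕ)
  | reg (i : ℕ)
  | cell (a : ℕ) (index : Expr)
  | op (o : Op) (e₁ e₂ : Expr)

/-- The value of an expression. -/
def Expr.eval (W : ℕ) (s : Store) : Expr → ℕ
  | .lit k => k % W
  | .reg i => s.reg i
  | .cell a e => s.arr a (e.eval W s)
  | .op o e₁ e₂ => o.eval W (e₁.eval W s) (e₂.eval W s)

/-- The time for evaluating an expression: one unit for each of its nodes. -/
def Expr.cost : Expr → ℕ
  | .lit _ => 1
  | .reg _ => 1
  | .cell _ e => e.cost + 1
  | .op _ e₁ e₂ => e₁.cost + e₂.cost + 1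

/-- Programs. -/
inductive Cmd where
  | skip
  | setReg (i : ℕ) (e : Expr)
  | setCell (a : ℕ) (index e : Expr)
  | seq (c₁ c₂ : Cmd)
  | cond (test : Expr) (c₁ c₂ : Cmd)
  | loop (test : Expr) (body : Cmd)

/-- Writing `x` into register `i`. -/
def Store.writeReg (s : Store) (i x : ℕ) : Store :=
  { s with reg := Function.update s.reg i x }

/-- Writing `x` into cell `j` of array `a`. -/
def Store.writeCell (s : Store) (a j x : ℕ) : Store :=
  { s with arr := Function.update s.arr a (Function.update (s.arr a) j x) }

/-- `Exec W c s t s'`: with word bound `W`, the program `c` started in `s` halts after exactly `t`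
units of time in `s'`.  A test succeeds if its value is not `0`. -/
inductive Exec (W : ℕ) : Cmd → Store → ℕ → Store → Prop
  | skip (s : Store) : Exec W .skip s 1 s
  | setReg (s : Store) (i : ℕ) (e : Expr) :
      Exec W (.setReg i e) s (e.cost + 1) (s.writeReg i (e.eval W s))
  | setCell (s : Store) (a : ℕ) (d e : Expr) :
      Exec W (.setCell a d e) s (d.cost + e.cost + 1)
        (s.writeCell a (d.eval W s) (e.eval W s))
  | seq {s s₁ s₂ : Store} {c₁ c₂ : Cmd} {t₁ t₂ : ℕ} :
      Exec W c₁ s t₁ s₁ → Exec W c₂ s₁ t₂ s₂ → Exec W (.seq c₁ c₂) s (t₁ + t₂) s₂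
  | condTrue {s s' : Store} {e : Expr} {c₁ c₂ : Cmd} {t : ℕ} :
      e.eval W s ≠ 0 → Exec W c₁ s t s' → Exec W (.cond e c₁ c₂) s (e.cost + 1 + t) s'
  | condFalse {s s' : Store} {e : Expr} {c₁ c₂ : Cmd} {t : ℕ} :
      e.eval W s = 0 → Exec W c₂ s t s' → Exec W (.cond e c₁ c₂) s (e.cost + 1 + t) s'
  | loopTrue {s s₁ s₂ : Store} {e : Expr} {c : Cmd} {t₁ t₂ : ℕ} :
      e.eval W s ≠ 0 → Exec W c s t₁ s₁ → Exec W (.loop e c) s₁ t₂ s₂ →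
        Exec W (.loop e c) s (e.cost + 1 + t₁ + t₂) s₂
  | loopFalse {s : Store} {e : Expr} {c : Cmd} :
      e.eval W s = 0 → Exec W (.loop e c) s (e.cost + 1) s

/-- The machine is deterministic: running time and final memory are determined by the program and
the initial memory. -/
theorem Exec.deterministic {W : ℕ} {c : Cmd} {s s₁ s₂ : Store} {t₁ t₂ : ℕ}
    (h₁ : Exec W c s t₁ s₁) (h₂ : Exec W c s t₂ s₂) : t₁ = t₂ ∧ s₁ = s₂ := by
  induction h₁ generalizing t₂ s₂ with
  | skip => cases h₂; exact ⟨rfl, rfl⟩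
  | setReg => cases h₂; exact ⟨rfl, rfl⟩
  | setCell => cases h₂; exact ⟨rfl, rfl⟩
  | seq _ _ ih ih' =>
    cases h₂ with
    | seq k k' =>
      obtain ⟨rfl, rfl⟩ := ih k
      obtain ⟨rfl, rfl⟩ := ih' k'
      exact ⟨rfl, rfl⟩
  | condTrue h _ ih =>
    cases h₂ with
    | condTrue _ k => obtain ⟨rfl, rfl⟩ := ih k; exact ⟨rfl, rfl⟩
    | condFalse k _ => exact absurd k h
  | condFalse h _ ih =>
    cases h₂ with
    | condTrue k _ => exact absurd h k
    | condFalse _ k => obtain ⟨rfl, rfl⟩ := ih k; exact ⟨rfl, rfl⟩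
  | loopTrue h _ _ ih ih' =>
    cases h₂ with
    | loopTrue _ k k' =>
      obtain ⟨rfl, rfl⟩ := ih k
      obtain ⟨rfl, rfl⟩ := ih' k'
      exact ⟨rfl, rfl⟩
    | loopFalse k => exact absurd k h
  | loopFalse h =>
    cases h₂ with
    | loopTrue k _ _ => exact absurd h k
    | loopFalse _ => exact ⟨rfl, rfl⟩

end WordRAM

/-! ## Dynamic graphs -/

namespace DynGraph

/-- An update of a graph on the vertices `0, …, n - 1`. -/
inductive Update (n : ℕ) where
  | insert (u v : Fin n)
  | delete (u v : Fin n)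

/-- The graph after an update. -/
def Update.apply {n : ℕ} (G : SimpleGraph (Fin n)) : Update n → SimpleGraph (Fin n)
  | .insert u v => G ⊔ SimpleGraph.edge u v
  | .delete u v => G.deleteEdges {s(u, v)}

/-- An update is legal if it inserts a missing edge or deletes an existing one. -/
def Update.Legal {n : ℕ} (G : SimpleGraph (Fin n)) : Update n → Prop
  | .insert u v => u ≠ v ∧ ¬ G.Adj u v
  | .delete u v => G.Adj u v

/-- The graph after the first `t` updates of a sequence, starting from the empty graph. -/
def graphAt {n : ℕ} (us : List (Update n)) (t : ℕ) : SimpleGraph (Fin n) :=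
  (us.take t).foldl Update.apply ⊥

/-- Every update of the sequence is legal at its time. -/
def LegalSeq {n : ℕ} (us : List (Update n)) : Prop :=
  ∀ t : Fin us.length, (us.get t).Legal (graphAt us t)

/-- The maximum degree over all the graphs of the sequence. -/
noncomputable def maxDegreeOver {n : ℕ} (us : List (Update n)) : ℕ :=
  open Classical in
  (Finset.range (us.length + 1)).sup fun t => (graphAt us t).maxDegree

/-- `G` has arboricity at most `α`: `⌈|E(G[S])| / (|S| - 1)⌉ ≤ α` for all vertex sets `S` of size
at least two. -/
def ArboricityLE {V : Type*} (G : SimpleGraph V) (α : ℕ) : Prop :=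
  ∀ S : Finset V, 2 ≤ S.card →
    ⌈((G.induce (S : Set V)).edgeSet.ncard : ℝ) / ((S.card : ℝ) - 1)⌉₊ ≤ α

/-- The table `χ` is a proper edge coloring of `G` with the colors `1, …, ⌊lam⌋`: every edge has
such a color, in both of its entries, adjacent edges have different colors, and the entry of a pair
that is not an edge is `0`, which stands for "no color". -/
structure IsEdgeColoring {n : ℕ} (G : SimpleGraph (Fin n)) (lam : ℝ) (χ : Fin n → Fin n → ℕ) :
    Prop where
  symm : ∀ u v, χ u v = χ v u
  eq_zero_iff : ∀ u v, χ u v = 0 ↔ ¬ G.Adj u v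
  le : ∀ u v, G.Adj u v → (χ u v : ℝ) ≤ lam
  proper : ∀ u v v', G.Adj u v → G.Adj u v' → v ≠ v' → χ u v ≠ χ u v'

/-- The number of unordered pairs of vertices whose color changes from `χ` to `χ'` (getting or
losing a color is a change). -/
def recourse {n : ℕ} (χ χ' : Fin n → Fin n → ℕ) : ℕ :=
  (Finset.univ.filter fun p : Fin n × Fin n => p.1 < p.2 ∧ χ p.1 p.2 ≠ χ' p.1 p.2).card

/-! ## Dynamic edge coloring algorithms on the word RAM -/

open WordRAM

/-- A dynamic algorithm: a program for insertions and a program for deletions. -/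
structure DynAlg where
  onInsert : Cmd
  onDelete : Cmd

/-- The program that handles an update. -/
def DynAlg.handler (A : DynAlg) {n : ℕ} : Update n → Cmd
  | .insert _ _ => A.onInsert
  | .delete _ _ => A.onDelete

/-- The memory before the first update: the parameters are in registers `0`, `1`, `2`, all other
memory is zero. -/
def initStore (n α q : ℕ) : Store where
  reg i := if i = 0 then n else if i = 1 then α else if i = 2 then q else 0
  arr _ _ := 0

/-- The endpoints of the edge to be inserted or deleted arrive in registers `3` and `4`; the rest
of the memory is as the algorithm left it. -/
def feed {n : ℕ} (s : Store) : Update n → Store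
  | .insert u v => (s.writeReg 3 u).writeReg 4 v
  | .delete u v => (s.writeReg 3 u).writeReg 4 v

/-- The coloring is stored explicitly: the color of `uv` is in cell `u * n + v` of array `0`. -/
def coloring (n : ℕ) (s : Store) (u v : Fin n) : ℕ :=
  s.arr 0 (u * n + v)

/-- On the word RAM with word length `w`, the algorithm `A` with parameters `n`, `α`, `q` handles
the updates of `us` one after the other; `s t` is the memory after `t` updates, and
handling update number `t` (from zero) takes time `τ t`. -/
def DynAlg.Run (A : DynAlg) (w : ℕ) {n : ℕ} (α q : ℕ) (us : List (Update n)) (s : ℕ → Store)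
    (τ : ℕ → ℕ) : Prop :=
  s 0 = initStore n α q ∧
    ∀ t : Fin us.length,
      Exec (2 ^ w) (A.handler (us.get t)) (feed (s t) (us.get t)) (τ t) (s (t + 1))

end DynGraph

/-! A dynamic edge coloring with few colors, by a decomposition of the vertices into levels.

Put `q = ⌈1 / ε⌉`.  Every vertex has a level between `0` and `L`, where `L` is of the order of
`q log n`, such that every vertex has at most `(4 + 1 / q) α` neighbors that are not below it, and
every vertex above level `0` has at least `(2 + 1 / (4 q)) α` neighbors of at least the level below
its own (`LevelOk`).  As an induced subgraph on `m` vertices has average degree at most `2 α`, the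
second condition makes the level sets shrink geometrically, so that the highest level is empty
(`card_levelSet_succ`, `level_lt_top`).

To color an edge `ab` with `a` not above `b`, a color is taken that is used neither at `b` nor on
the edges from `a` to vertices not below `a`.  The smallest such color is at most
`deg b + (4 + 1 / q) α`; a color with this bound is found in logarithmic time by a descent in two
binary trees that count used colors and always turns left if there is room on the left
(`findFree_spec`).  If an edge `aw` already has this color, then `w` is below `a`; the edge `aw`
loses its color and is colored next.  Levels strictly fall along this chain, which bounds the
recourse of an insertion by `2 L + 1` (`color_step`, `colorLoop_spec`).  Changes of levels do not
affect the coloring, and a deletion only removes a color.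

After an update, the vertices that may violate their conditions are on a stack, and are moved up or
down by one level until all conditions hold.  A move of `v` takes logarithmic time for each of the
`D` neighbors not below `v`.  A potential with the terms `24 (((4 q + 1) α - q D) ⊔ 0) - D`, one for
every vertex and every level below its own, pays for the moves (`pot_promote`, `pot_demote`,
`stabilise_step`), and an update raises it by `O(q L)` only (`pot_le_of_close`).  So the amortized
time of an update is of the order of `q L log n`, and hence of `log² n / ε²` (`run_exists`,
`Par.bounds`).

The algorithm is a program of the word RAM.  Its correctness and running time are proved together,
by rules for weakest preconditions that carry the running time (`wp`, `wp_loop`). -/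

namespace WordRAM

/-! ### Weakest preconditions with running time -/

/-- The program `c` started in `s` halts, and its final memory and running time satisfy `Q`. -/
def wp (W : ℕ) (c : Cmd) (s : Store) (Q : Store → ℕ → Prop) : Prop :=
  ∃ t s', Exec W c s t s' ∧ Q s' t

variable {W : ℕ} {s : Store} {Q Q' : Store → ℕ → Prop} {c c₁ c₂ : Cmd} {d e : Expr}

theorem wp_mono (h : wp W c s Q) (hQ : ∀ s' t, Q s' t → Q' s' t) : wp W c s Q' := by
  obtain ⟨t, s', h1, h2⟩ := h
  exact ⟨t, s', h1, hQ _ _ h2⟩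

theorem wp_skip (h : Q s 1) : wp W .skip s Q := ⟨1, s, .skip s, h⟩

theorem wp_setReg {i x : ℕ} (hx : e.eval W s = x) (h : Q (s.writeReg i x) (e.cost + 1)) :
    wp W (.setReg i e) s Q := by
  subst hx
  exact ⟨_, _, .setReg s i e, h⟩

theorem wp_setCell {a j x : ℕ} (hj : d.eval W s = j) (hx : e.eval W s = x)
    (h : Q (s.writeCell a j x) (d.cost + e.cost + 1)) : wp W (.setCell a d e) s Q := by
  subst hx hj
  exact ⟨_, _, .setCell s a d e, h⟩

theorem wp_seq (h : wp W c₁ s fun s₁ t₁ => wp W c₂ s₁ fun s₂ t₂ => Q s₂ (t₁ + t₂)) :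
    wp W (.seq c₁ c₂) s Q := by
  obtain ⟨t₁, s₁, h1, t₂, s₂, h2, h3⟩ := h
  exact ⟨_, _, .seq h1 h2, h3⟩

theorem wp_cond (h1 : e.eval W s ≠ 0 → wp W c₁ s fun s' t => Q s' (e.cost + 1 + t))
    (h2 : e.eval W s = 0 → wp W c₂ s fun s' t => Q s' (e.cost + 1 + t)) :
    wp W (.cond e c₁ c₂) s Q := by
  by_cases h : e.eval W s = 0
  · obtain ⟨t, s', h3, h4⟩ := h2 h
    exact ⟨_, _, .condFalse h h3, h4⟩
  · obtain ⟨t, s', h3, h4⟩ := h1 h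
    exact ⟨_, _, .condTrue h h3, h4⟩

/-- The loop rule.  `I m s` says that the memory `s` satisfies the invariant and that `m` units of
time are still in reserve; each round has to pay for itself from the reserve, so that the loop
terminates, and what is left of the reserve is available afterwards. -/
theorem wp_loop (I : ℕ → Store → Prop) {m : ℕ} (hI : I m s)
    (step : ∀ m s, I m s → e.eval W s ≠ 0 →
      wp W c s fun s' t => ∃ m', I m' s' ∧ e.cost + 1 + t + m' ≤ m)
    (hQ : ∀ m' s' t, I m' s' → e.eval W s' = 0 → t + m' ≤ m + e.cost + 1 → Q s' t) :
    wp W (.loop e c) s Q := by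
  induction m using Nat.strong_induction_on generalizing s Q with
  | _ m ih =>
    by_cases h : e.eval W s = 0
    · exact ⟨_, _, .loopFalse h, hQ m s _ hI h (by omega)⟩
    · obtain ⟨t, s', h1, m', h2, h3⟩ := step m s hI h
      obtain ⟨t', s'', h4, h5⟩ := ih m' (by omega) h2
        (Q := fun s'' t' => Q s'' (e.cost + 1 + t + t'))
        (fun m'' s'' t' h6 h7 h8 => hQ m'' s'' _ h6 h7 (by omega))
      exact ⟨_, _, .loopTrue h h1 h4, h5⟩

@[simp] theorem Store.reg_writeReg (s : Store) (i x j : ℕ) :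
    (s.writeReg i x).reg j = if j = i then x else s.reg j := by
  simp [Store.writeReg, Function.update_apply]

@[simp] theorem Store.arr_writeReg (s : Store) (i x : ℕ) : (s.writeReg i x).arr = s.arr := rfl

@[simp] theorem Store.reg_writeCell (s : Store) (a j x : ℕ) : (s.writeCell a j x).reg = s.reg := rfl

theorem Store.arr_writeCell (s : Store) (a j x b i : ℕ) :
    (s.writeCell a j x).arr b i = if b = a ∧ i = j then x else s.arr b i := by
  by_cases h : b = a
  · subst h
    simp [Store.writeCell, Function.update_apply]
  · simp [Store.writeCell, h]

theorem Store.arr_writeCell_of_ne (s : Store) {a b : ℕ} (j x : ℕ) (h : b ≠ a) :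
    (s.writeCell a j x).arr b = s.arr b := by
  funext i
  simp [Store.arr_writeCell, h]

/-! Infix notation for programs and expressions. -/

infixr:30 " ;; " => Cmd.seq
infix:40 " ⟵ " => Cmd.setReg
infixl:65 " +ₑ " => Expr.op Op.add
infixl:65 " -ₑ " => Expr.op Op.sub
infixl:70 " *ₑ " => Expr.op Op.mul
infixl:70 " /ₑ " => Expr.op Op.div
infix:50 " <ₑ " => Expr.op Op.lt
infix:50 " =ₑ " => Expr.op Op.eq

section Eval

variable {e₁ e₂ : Expr} {x y : ℕ}

theorem eval_lit {k : ℕ} (h : k < W) : (Expr.lit k).eval W s = k := Nat.mod_eq_of_lt h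

theorem eval_reg {i : ℕ} (h : s.reg i = x) : (Expr.reg i).eval W s = x := h

theorem eval_cell {a : ℕ} (h : e.eval W s = x) (hy : s.arr a x = y) :
    (Expr.cell a e).eval W s = y := by
  rw [Expr.eval, h, hy]

theorem eval_add (h₁ : e₁.eval W s = x) (h₂ : e₂.eval W s = y) (h : x + y < W) :
    (e₁ +ₑ e₂).eval W s = x + y := by
  rw [Expr.eval, h₁, h₂]; exact Nat.mod_eq_of_lt h

theorem eval_mul (h₁ : e₁.eval W s = x) (h₂ : e₂.eval W s = y) (h : x * y < W) :
    (e₁ *ₑ e₂).eval W s = x * y := by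
  rw [Expr.eval, h₁, h₂]; exact Nat.mod_eq_of_lt h

theorem eval_sub (h₁ : e₁.eval W s = x) (h₂ : e₂.eval W s = y) :
    (e₁ -ₑ e₂).eval W s = x - y := by
  rw [Expr.eval, h₁, h₂]; rfl

theorem eval_div (h₁ : e₁.eval W s = x) (h₂ : e₂.eval W s = y) :
    (e₁ /ₑ e₂).eval W s = x / y := by
  rw [Expr.eval, h₁, h₂]; rfl

theorem eval_lt (h₁ : e₁.eval W s = x) (h₂ : e₂.eval W s = y) :
    (e₁ <ₑ e₂).eval W s = if x < y then 1 else 0 := by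
  rw [Expr.eval, h₁, h₂]; rfl

theorem eval_eq (h₁ : e₁.eval W s = x) (h₂ : e₂.eval W s = y) :
    (e₁ =ₑ e₂).eval W s = if x = y then 1 else 0 := by
  rw [Expr.eval, h₁, h₂]; rfl

end Eval

end WordRAM

namespace DynEdgeColoring

open WordRAM

/-! ### Counting trees -/

/-- The number of elements of `S` below node `x` of height `h`, in the complete binary tree with the
leaves `2 ^ k, …, 2 ^ (k + 1) - 1`, where `c` sits at the leaf `2 ^ k + c`. -/
def cnt (k : ℕ) (S : Finset ℕ) (h x : ℕ) : ℕ := (S.filter fun c => (2 ^ k + c) / 2 ^ h = x).card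

/-- In heap order, `f` holds the numbers of elements of `S` below the nodes of the tree. -/
def IsTree (k : ℕ) (f : ℕ → ℕ) (S : Finset ℕ) : Prop :=
  ∀ h ≤ k, ∀ x, 2 ^ (k - h) ≤ x → x < 2 ^ (k - h + 1) → f x = cnt k S h x

theorem cnt_le_card (k : ℕ) (S : Finset ℕ) (h x : ℕ) : cnt k S h x ≤ S.card :=
  Finset.card_filter_le _ _

theorem cnt_root {k : ℕ} {S : Finset ℕ} (hS : S ⊆ Finset.range (2 ^ k)) :
    cnt k S k 1 = S.card := by
  unfold cnt
  congr 1
  apply Finset.filter_true_of_mem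
  intro c hc
  have := Finset.mem_range.1 (hS hc)
  rw [Nat.add_div_left _ (by positivity), Nat.div_eq_of_lt this]

theorem cnt_leaf (k : ℕ) (S : Finset ℕ) (c : ℕ) :
    cnt k S 0 (2 ^ k + c) = if c ∈ S then 1 else 0 := by
  unfold cnt
  simp only [pow_zero, Nat.div_one, Nat.add_left_cancel_iff]
  rw [Finset.filter_eq']
  split_ifs <;> simp

theorem cnt_succ (k : ℕ) (S : Finset ℕ) (h x : ℕ) :
    cnt k S (h + 1) x = cnt k S h (2 * x) + cnt k S h (2 * x + 1) := by
  unfold cnt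
  rw [← Finset.card_union_of_disjoint, ← Finset.filter_or]
  · congr 1
    apply Finset.filter_congr
    intro c _
    rw [pow_succ, ← Nat.div_div_eq_div_mul]
    omega
  · rw [Finset.disjoint_filter]
    intro c _ h1
    omega

theorem cnt_insert {k : ℕ} {S : Finset ℕ} {c : ℕ} (hc : c ∉ S) (h x : ℕ) :
    cnt k (insert c S) h x = cnt k S h x + if (2 ^ k + c) / 2 ^ h = x then 1 else 0 := by
  unfold cnt
  rw [Finset.filter_insert]
  split_ifs
  · rw [Finset.card_insert_of_notMem (by simp [hc])]
  · simp

theorem cnt_erase {k : ℕ} {S : Finset ℕ} {c : ℕ} (hc : c ∈ S) (h x : ℕ) :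
    cnt k S h x = cnt k (S.erase c) h x + if (2 ^ k + c) / 2 ^ h = x then 1 else 0 := by
  conv_lhs => rw [← Finset.insert_erase hc]
  exact cnt_insert (by simp) h x

/-- The node of height `h` above a leaf. -/
theorem ancestor_bounds {k c h : ℕ} (hc : c < 2 ^ k) (hh : h ≤ k) :
    2 ^ (k - h) ≤ (2 ^ k + c) / 2 ^ h ∧ (2 ^ k + c) / 2 ^ h < 2 ^ (k - h + 1) := by
  have h1 : 2 ^ k = 2 ^ (k - h) * 2 ^ h := by rw [← pow_add]; congr 1; omega
  constructor
  · rw [Nat.le_div_iff_mul_le (by positivity)]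
    omega
  · rw [Nat.div_lt_iff_lt_mul (by positivity), pow_succ]
    nlinarith

/-- Nodes of different heights are different. -/
theorem ne_of_height_ne {k h h' x y : ℕ} (hh : h ≤ k) (hh' : h' ≤ k) (hne : h ≠ h')
    (hx : 2 ^ (k - h) ≤ x ∧ x < 2 ^ (k - h + 1)) (hy : 2 ^ (k - h') ≤ y ∧ y < 2 ^ (k - h' + 1)) :
    x ≠ y := by
  rintro rfl
  rcases lt_or_gt_of_ne hne with h1 | h1
  · have : 2 ^ (k - h' + 1) ≤ 2 ^ (k - h) := Nat.pow_le_pow_right (by norm_num) (by omega)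
    omega
  · have : 2 ^ (k - h + 1) ≤ 2 ^ (k - h') := Nat.pow_le_pow_right (by norm_num) (by omega)
    omega

/-- The program that adds `c` to (for `o = .add`) or removes it from (for `o = .sub`) the tree in
slot `es`, where `c` is in register `rc`.  The trees are in array `3`. -/
def treeUpd (o : Op) (es : Expr) (rc : ℕ) : Cmd :=
  20 ⟵ es *ₑ (.reg 6 +ₑ .reg 6) ;;
  22 ⟵ .reg 6 +ₑ .reg rc ;;
  .loop (.reg 22)
    (.setCell 3 (.reg 20 +ₑ .reg 22) (.op o (.cell 3 (.reg 20 +ₑ .reg 22)) (.lit 1)) ;;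
      22 ⟵ .reg 22 /ₑ .lit 2)

/-- `S'` results from `S` by the insertion or removal of `c`. -/
def IsUpd (o : Op) (S S' : Finset ℕ) (c : ℕ) : Prop :=
  (o = .add ∧ c ∉ S ∧ S' = insert c S) ∨ (o = .sub ∧ c ∈ S ∧ S' = S.erase c)

theorem IsUpd.cnt_eq {o : Op} {S S' : Finset ℕ} {c : ℕ} (hu : IsUpd o S S' c) {k h x W : ℕ}
    (hx : (2 ^ k + c) / 2 ^ h = x) (hW : S.card + 1 < W) :
    o.eval W (cnt k S h x) 1 = cnt k S' h x := by
  have h1 := cnt_le_card k S h x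
  rcases hu with ⟨rfl, hc, rfl⟩ | ⟨rfl, hc, rfl⟩
  · rw [cnt_insert hc, if_pos hx, Op.eval, Nat.mod_eq_of_lt (by omega)]
  · rw [cnt_erase hc, if_pos hx, Op.eval]
    omega

theorem IsUpd.cnt_eq_of_ne {o : Op} {S S' : Finset ℕ} {c : ℕ} (hu : IsUpd o S S' c) {k h x : ℕ}
    (hx : (2 ^ k + c) / 2 ^ h ≠ x) : cnt k S h x = cnt k S' h x := by
  rcases hu with ⟨rfl, hc, rfl⟩ | ⟨rfl, hc, rfl⟩
  · rw [cnt_insert hc, if_neg hx, add_zero]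
  · rw [cnt_erase hc, if_neg hx, add_zero]

/-- The address space is large enough for `N` trees. -/
structure Fits (W k N : ℕ) : Prop where
  eight : 8 < W
  trees : N * (2 * 2 ^ k) + 2 * 2 ^ k < W

theorem Fits.base {W k N slot : ℕ} (h : Fits W k N) (hs : slot < N) :
    slot * (2 * 2 ^ k) + 2 * 2 ^ k + 2 * 2 ^ k < W ∧ (slot + 1) * (2 * 2 ^ k) ≤ N * (2 * 2 ^ k) ∧
    (slot + 1) * (2 * 2 ^ k) = slot * (2 * 2 ^ k) + 2 * 2 ^ k := by
  have h1 : (slot + 1) * (2 * 2 ^ k) ≤ N * (2 * 2 ^ k) := Nat.mul_le_mul_right _ hs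
  have h2 := h.trees
  refine ⟨?_, h1, by ring⟩
  nlinarith

theorem treeUpd_spec {W k N slot rc c : ℕ} {s : Store} {o : Op} {es : Expr} {S S' : Finset ℕ}
    (hW : Fits W k N) (h6 : s.reg 6 = 2 ^ k) (hes : es.eval W s = slot) (hslot : slot < N)
    (hrc : rc < 20) (hc : s.reg rc = c) (hck : c < 2 ^ k) (hS : S ⊆ Finset.range (2 ^ k))
    (ht : IsTree k (fun x => s.arr 3 (slot * (2 * 2 ^ k) + x)) S) (hu : IsUpd o S S' c) :
    wp W (treeUpd o es rc) s fun s' t =>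
      (∀ r < 20, s'.reg r = s.reg r) ∧ (∀ a ≠ 3, s'.arr a = s.arr a) ∧
      IsTree k (fun x => s'.arr 3 (slot * (2 * 2 ^ k) + x)) S' ∧
      (∀ i, i < slot * (2 * 2 ^ k) ∨ (slot + 1) * (2 * 2 ^ k) ≤ i → s'.arr 3 i = s.arr 3 i) ∧
      t ≤ es.cost + 20 * (k + 1) + 20 := by
  obtain ⟨hb1, hb2, hb3⟩ := hW.base hslot
  have h8 := hW.eight
  have hP : 0 < 2 ^ k := by positivity
  have hcard : S.card ≤ 2 ^ k := by simpa using Finset.card_le_card hS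
  set B := slot * (2 * 2 ^ k) with hB
  unfold treeUpd
  apply wp_seq
  apply wp_setReg (x := B) (by
    rw [hB, two_mul]
    exact eval_mul hes (eval_add h6 h6 (by omega)) (by rw [← two_mul]; omega))
  apply wp_seq
  apply wp_setReg (x := 2 ^ k + c) (by
    refine eval_add ?_ ?_ (by omega)
    · simp [Expr.eval, h6]
    · simp [Expr.eval, hc]; omega)
  -- After `j` rounds, the counters of height below `j` are those of `S'`, and register `22` holds
  -- the ancestor of height `j` of the leaf of `c`.
  let I : ℕ → Store → Prop := fun m s' => ∃ j ≤ k + 1, m = 20 * (k + 1 - j) ∧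
    (∀ r < 20, s'.reg r = s.reg r) ∧ (∀ a ≠ 3, s'.arr a = s.arr a) ∧
    s'.reg 20 = B ∧ s'.reg 22 = (2 ^ k + c) / 2 ^ j ∧
    (∀ h ≤ k, ∀ x, 2 ^ (k - h) ≤ x → x < 2 ^ (k - h + 1) →
      s'.arr 3 (B + x) = if h < j then cnt k S' h x else cnt k S h x) ∧
    (∀ i, i < B ∨ (slot + 1) * (2 * 2 ^ k) ≤ i → s'.arr 3 i = s.arr 3 i)
  refine wp_loop I (m := 20 * (k + 1)) ⟨0, by omega, by simp, ?_, ?_, ?_, ?_, ?_, ?_⟩ ?_ ?_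
  · intro r hr
    simp [show r ≠ 20 by omega, show r ≠ 22 by omega]
  · intro a _; simp
  · simp
  · simp
  · intro h hh x h1 h2
    simpa using ht h hh x h1 h2
  · intro i _; simp
  · rintro m s' ⟨j, hj, rfl, hreg, harr, h20, h22, htree, hout⟩ htest
    have hjk : j ≤ k := by
      by_contra hcon
      apply htest
      have : j = k + 1 := by omega
      subst this
      rw [Expr.eval, h22, Nat.div_eq_of_lt]
      rw [pow_succ]; omega
    obtain ⟨ha1, ha2⟩ := ancestor_bounds hck hjk
    have ha3 : 2 ^ (k - j + 1) ≤ 2 ^ (k + 1) := Nat.pow_le_pow_right (by norm_num) (by omega)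
    rw [pow_succ 2 k] at ha3
    set x := (2 ^ k + c) / 2 ^ j with hx
    have haddr : (Expr.reg 20 +ₑ Expr.reg 22).eval W s' = B + x :=
      eval_add h20 h22 (by omega)
    apply wp_seq
    apply wp_setCell (x := cnt k S' j x) haddr
    · have e1 : (Expr.cell 3 (Expr.reg 20 +ₑ Expr.reg 22)).eval W s' = cnt k S j x := by
        refine eval_cell haddr ?_
        rw [htree j hjk x ha1 ha2, if_neg (lt_irrefl j)]
      rw [Expr.eval, e1, eval_lit (by omega)]
      exact hu.cnt_eq rfl (by omega)
    apply wp_setReg (x := (2 ^ k + c) / 2 ^ (j + 1))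
    · rw [pow_succ, ← Nat.div_div_eq_div_mul]
      refine eval_div ?_ (eval_lit (by omega))
      simpa [Expr.eval, h22] using hx
    refine ⟨20 * (k + 1 - (j + 1)), ⟨j + 1, by omega, rfl, ?_, ?_, ?_, ?_, ?_, ?_⟩, ?_⟩
    · intro r hr
      simp [show r ≠ 22 by omega, hreg r hr]
    · intro a ha
      simp only [Store.arr_writeReg]
      rw [Store.arr_writeCell_of_ne _ _ _ ha, harr a ha]
    · simp [h20]
    · simp
    · intro h hh y h1 h2
      simp only [Store.arr_writeReg, Store.arr_writeCell, true_and, Nat.add_left_cancel_iff]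
      by_cases hyx : y = x
      · have hhj : h = j := by
          by_contra hne
          exact ne_of_height_ne hh hjk hne ⟨h1, h2⟩ ⟨ha1, ha2⟩ hyx
        subst hhj hyx
        rw [if_pos rfl, if_pos (by omega)]
      · rw [if_neg hyx, htree h hh y h1 h2]
        by_cases hhj : h = j
        · subst hhj
          rw [if_neg (lt_irrefl h), if_pos (by omega)]
          exact hu.cnt_eq_of_ne (Ne.symm hyx)
        · by_cases h3 : h < j
          · rw [if_pos h3, if_pos (by omega)]
          · rw [if_neg h3, if_neg (by omega)]
    · intro i hi
      simp only [Store.arr_writeReg, Store.arr_writeCell, true_and]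
      rw [if_neg (by omega), hout i hi]
    · simp only [Expr.cost]
      omega
  · rintro m s' t ⟨j, hj, rfl, hreg, harr, h20, h22, htree, hout⟩ htest ht
    have hjk : j = k + 1 := by
      by_contra hcon
      have h1 := (ancestor_bounds hck (show j ≤ k by omega)).1
      have h2 : 0 < 2 ^ (k - j) := by positivity
      rw [Expr.eval, h22] at htest
      omega
    subst hjk
    refine ⟨hreg, harr, ?_, hout, ?_⟩
    · intro h hh x h1 h2
      simp only
      rw [htree h hh x h1 h2, if_pos (by omega)]
    · simp only [Expr.cost] at ht ⊢
      omega

/-! ### Descents in counting trees -/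

/-- The number of elements of `S` to the left of node `x` of height `h`. -/
def cntLeft (k : ℕ) (S : Finset ℕ) (h x : ℕ) : ℕ := (S.filter fun c => 2 ^ k + c < x * 2 ^ h).card

theorem cntLeft_left (k : ℕ) (S : Finset ℕ) (h x : ℕ) :
    cntLeft k S h (2 * x) = cntLeft k S (h + 1) x := by
  unfold cntLeft
  rw [show 2 * x * 2 ^ h = x * 2 ^ (h + 1) by rw [pow_succ]; ring]

theorem cntLeft_right (k : ℕ) (S : Finset ℕ) (h x : ℕ) :
    cntLeft k S h (2 * x + 1) = cntLeft k S (h + 1) x + cnt k S h (2 * x) := by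
  rw [← cntLeft_left]
  unfold cntLeft cnt
  rw [← Finset.card_union_of_disjoint, ← Finset.filter_or]
  · congr 1
    apply Finset.filter_congr
    intro c _
    rw [← Nat.div_lt_iff_lt_mul (by positivity), ← Nat.div_lt_iff_lt_mul (by positivity)]
    omega
  · rw [Finset.disjoint_filter]
    intro c _ h1
    rw [← Nat.div_lt_iff_lt_mul (by positivity)] at h1
    omega

theorem cntLeft_root (k : ℕ) (S : Finset ℕ) : cntLeft k S k 1 = 0 := by
  unfold cntLeft
  simp

theorem cntLeft_leaf (k : ℕ) (S : Finset ℕ) (c : ℕ) :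
    cntLeft k S 0 (2 ^ k + c) = (S.filter (· < c)).card := by
  unfold cntLeft
  simp

/-- The program that computes, in register `26`, the element of the tree in slot `es` that has
exactly `er` smaller elements. -/
def select (es er : Expr) : Cmd :=
  24 ⟵ es *ₑ (.reg 6 +ₑ .reg 6) ;;
  25 ⟵ er ;;
  26 ⟵ .lit 1 ;;
  .loop (.reg 26 <ₑ .reg 6)
    (26 ⟵ .reg 26 +ₑ .reg 26 ;;
      .cond (.reg 25 <ₑ .cell 3 (.reg 24 +ₑ .reg 26)) .skip
        (25 ⟵ .reg 25 -ₑ .cell 3 (.reg 24 +ₑ .reg 26) ;;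
          26 ⟵ .reg 26 +ₑ .lit 1)) ;;
  26 ⟵ .reg 26 -ₑ .reg 6

theorem select_spec {W k N slot r : ℕ} {s : Store} {es er : Expr} {S : Finset ℕ}
    (hW : Fits W k N) (h6 : s.reg 6 = 2 ^ k) (hes : es.eval W s = slot) (hslot : slot < N)
    (her : ∀ x, er.eval W (s.writeReg 24 x) = r) (hr : r < S.card)
    (hS : S ⊆ Finset.range (2 ^ k))
    (ht : IsTree k (fun x => s.arr 3 (slot * (2 * 2 ^ k) + x)) S) :
    wp W (select es er) s fun s' t =>
      (∀ r < 20, s'.reg r = s.reg r) ∧ s'.arr = s.arr ∧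
      (∃ c ∈ S, s'.reg 26 = c ∧ (S.filter (· < c)).card = r) ∧
      t ≤ es.cost + er.cost + 30 * (k + 1) + 20 := by
  obtain ⟨hb1, hb2, hb3⟩ := hW.base hslot
  have h8 := hW.eight
  have hP : 0 < 2 ^ k := by positivity
  set B := slot * (2 * 2 ^ k) with hB
  unfold select
  apply wp_seq
  apply wp_setReg (x := B) (by
    rw [hB, two_mul]
    exact eval_mul hes (eval_add h6 h6 (by omega)) (by rw [← two_mul]; omega))
  apply wp_seq
  apply wp_setReg (her _)
  apply wp_seq
  apply wp_setReg (eval_lit (by omega))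
  apply wp_seq
  -- The element that is sought lies below the node `x` of height `h`, and register `25` holds its
  -- rank among the elements below `x`.
  let I : ℕ → Store → Prop := fun m s' => ∃ h ≤ k, ∃ x, m = 30 * h ∧
    (∀ r < 20, s'.reg r = s.reg r) ∧ s'.arr = s.arr ∧
    s'.reg 24 = B ∧ s'.reg 26 = x ∧ 2 ^ (k - h) ≤ x ∧ x < 2 ^ (k - h + 1) ∧
    s'.reg 25 + cntLeft k S h x = r ∧ s'.reg 25 < cnt k S h x
  refine wp_loop I (m := 30 * k) ⟨k, le_rfl, 1, rfl, ?_, ?_, ?_, ?_, ?_, ?_, ?_, ?_⟩ ?_ ?_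
  · intro i hi
    simp [show i ≠ 24 by omega, show i ≠ 25 by omega, show i ≠ 26 by omega]
  · simp
  · simp
  · simp
  · simp
  · simp
  · simp [cntLeft_root]
  · simp [cnt_root hS, hr]
  · rintro m s' ⟨h, hh, x, rfl, hreg, harr, h24, h26, hx1, hx2, h25, hlt⟩ htest
    have h6' : s'.reg 6 = 2 ^ k := by rw [hreg 6 (by omega), h6]
    have hxk : x < 2 ^ k := by
      by_contra hcon
      apply htest
      rw [eval_lt (eval_reg h26) (eval_reg h6'), if_neg hcon]
    obtain ⟨h, rfl⟩ : ∃ h', h = h' + 1 := by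
      apply Nat.exists_eq_succ_of_ne_zero
      rintro rfl
      simp at hx1
      omega
    have hy1 : 2 ^ (k - h) = 2 ^ (k - (h + 1)) * 2 := by rw [← pow_succ]; congr 1; omega
    have hy2 : 2 ^ (k - h + 1) = 2 ^ (k - (h + 1) + 1) * 2 := by rw [← pow_succ]; congr 1; omega
    have hcell : s'.arr 3 (B + (x + x)) = cnt k S h (2 * x) := by
      rw [harr, ← two_mul]
      exact ht h (by omega) (2 * x) (by omega) (by omega)
    apply wp_seq
    apply wp_setReg (x := x + x) (eval_add (eval_reg h26) (eval_reg h26) (by omega))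
    have hcell' : (Expr.cell 3 (Expr.reg 24 +ₑ Expr.reg 26)).eval W (s'.writeReg 26 (x + x))
        = cnt k S h (2 * x) := by
      refine eval_cell (x := B + (x + x)) (eval_add (eval_reg ?_) (eval_reg ?_) (by omega)) ?_
      · simp [h24]
      · simp
      · simpa using hcell
    have h25' : (Expr.reg 25).eval W (s'.writeReg 26 (x + x)) = s'.reg 25 := by
      simp [Expr.eval]
    apply wp_cond
    · intro hc
      rw [eval_lt h25' hcell'] at hc
      have hc' : s'.reg 25 < cnt k S h (2 * x) := by
        by_contra hcon
        rw [if_neg hcon] at hc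
        exact hc rfl
      apply wp_skip
      refine ⟨30 * h, ⟨h, by omega, x + x, rfl, ?_, ?_, ?_, ?_, ?_, ?_, ?_, ?_⟩, ?_⟩
      · intro i hi
        simp [show i ≠ 26 by omega, hreg i hi]
      · simpa using harr
      · simp [h24]
      · simp
      · omega
      · omega
      · rw [← two_mul, cntLeft_left]
        simpa using h25
      · rw [← two_mul]
        simpa using hc'
      · simp only [Expr.cost]
        omega
    · intro hc
      rw [eval_lt h25' hcell'] at hc
      have hc' : cnt k S h (2 * x) ≤ s'.reg 25 := by
        by_contra hcon
        rw [if_pos (by omega)] at hc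
        omega
      apply wp_seq
      apply wp_setReg (eval_sub h25' hcell')
      apply wp_setReg (x := x + x + 1) (eval_add (eval_reg (by simp)) (eval_lit (by omega))
        (by omega))
      refine ⟨30 * h, ⟨h, by omega, x + x + 1, rfl, ?_, ?_, ?_, ?_, ?_, ?_, ?_, ?_⟩, ?_⟩
      · intro i hi
        simp [show i ≠ 26 by omega, show i ≠ 25 by omega, hreg i hi]
      · simpa using harr
      · simp [h24]
      · simp
      · omega
      · omega
      · rw [← two_mul, cntLeft_right]
        simp
        omega
      · rw [cnt_succ] at hlt
        rw [← two_mul]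
        simp
        omega
      · simp only [Expr.cost]
        omega
  · rintro m s' t ⟨h, hh, x, rfl, hreg, harr, h24, h26, hx1, hx2, h25, hlt⟩ htest hT
    have h6' : s'.reg 6 = 2 ^ k := by rw [hreg 6 (by omega), h6]
    have hxk : 2 ^ k ≤ x := by
      by_contra hcon
      rw [eval_lt (eval_reg h26) (eval_reg h6'), if_pos (by omega)] at htest
      omega
    have hh0 : h = 0 := by
      by_contra hne
      have : 2 ^ (k - h + 1) ≤ 2 ^ k := Nat.pow_le_pow_right (by norm_num) (by omega)
      omega
    subst hh0
    obtain ⟨c, rfl⟩ := Nat.exists_eq_add_of_le hxk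
    apply wp_setReg (x := c) (by rw [eval_sub (eval_reg h26) (eval_reg h6')]; omega)
    have hmem : c ∈ S := by
      rw [cnt_leaf] at hlt
      by_contra hcon
      rw [if_neg hcon] at hlt
      omega
    rw [cnt_leaf, if_pos hmem] at hlt
    rw [cntLeft_leaf] at h25
    refine ⟨?_, ?_, ⟨c, hmem, ?_, by omega⟩, ?_⟩
    · intro i hi
      simp [show i ≠ 26 by omega, hreg i hi]
    · simpa using harr
    · simp
    · simp only [Expr.cost] at hT ⊢
      omega

/-- The program that computes, in register `32`, a number that is in neither of the trees in the
slots `e₁` and `e₂`. -/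
def findFree (e₁ e₂ : Expr) : Cmd :=
  30 ⟵ e₁ *ₑ (.reg 6 +ₑ .reg 6) ;;
  31 ⟵ e₂ *ₑ (.reg 6 +ₑ .reg 6) ;;
  32 ⟵ .lit 1 ;;
  33 ⟵ .reg 6 ;;
  .loop (.reg 32 <ₑ .reg 6)
    (32 ⟵ .reg 32 +ₑ .reg 32 ;;
      33 ⟵ .reg 33 /ₑ .lit 2 ;;
      .cond ((.cell 3 (.reg 30 +ₑ .reg 32) +ₑ .cell 3 (.reg 31 +ₑ .reg 32)) <ₑ .reg 33) .skip
        (32 ⟵ .reg 32 +ₑ .lit 1)) ;;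
  32 ⟵ .reg 32 -ₑ .reg 6

/-- The descent goes to the left whenever the left subtree has more leaves than elements of the two
sets.  Hence everything to the left of the result is filled up by these elements, which bounds the
result by their number. -/
theorem findFree_spec {W k N slot₁ slot₂ : ℕ} {s : Store} {e₁ e₂ : Expr} {S₁ S₂ : Finset ℕ}
    (hW : Fits W k N) (h6 : s.reg 6 = 2 ^ k) (he₁ : e₁.eval W s = slot₁) (hslot₁ : slot₁ < N)
    (he₂ : ∀ x, e₂.eval W (s.writeReg 30 x) = slot₂) (hslot₂ : slot₂ < N)
    (hcard : S₁.card + S₂.card < 2 ^ k)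
    (hS₁ : S₁ ⊆ Finset.range (2 ^ k)) (hS₂ : S₂ ⊆ Finset.range (2 ^ k))
    (ht₁ : IsTree k (fun x => s.arr 3 (slot₁ * (2 * 2 ^ k) + x)) S₁)
    (ht₂ : IsTree k (fun x => s.arr 3 (slot₂ * (2 * 2 ^ k) + x)) S₂) :
    wp W (findFree e₁ e₂) s fun s' t =>
      (∀ r < 20, s'.reg r = s.reg r) ∧ s'.arr = s.arr ∧
      (∃ c ∉ S₁, c ∉ S₂ ∧ c ≤ S₁.card + S₂.card ∧ s'.reg 32 = c) ∧
      t ≤ e₁.cost + e₂.cost + 30 * (k + 1) + 30 := by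
  obtain ⟨hb1, hb2, hb3⟩ := hW.base hslot₁
  obtain ⟨hd1, hd2, hd3⟩ := hW.base hslot₂
  have h8 := hW.eight
  have hP : 0 < 2 ^ k := by positivity
  set B := slot₁ * (2 * 2 ^ k) with hB
  set D := slot₂ * (2 * 2 ^ k) with hD
  unfold findFree
  apply wp_seq
  apply wp_setReg (x := B) (by
    rw [hB, two_mul]
    exact eval_mul he₁ (eval_add h6 h6 (by omega)) (by rw [← two_mul]; omega))
  apply wp_seq
  apply wp_setReg (x := D) (by
    have h6' : (s.writeReg 30 B).reg 6 = 2 ^ k := by simp [h6]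
    rw [hD, two_mul]
    exact eval_mul (he₂ B) (eval_add h6' h6' (by omega)) (by rw [← two_mul]; omega))
  apply wp_seq
  apply wp_setReg (eval_lit (by omega))
  apply wp_seq
  apply wp_setReg (x := 2 ^ k) (by simp [Expr.eval, h6])
  apply wp_seq
  -- At the node `x` of height `h`, the two sets have fewer elements below `x` than there are
  -- leaves, and at least as many elements to the left of `x` as there are leaves.
  let I : ℕ → Store → Prop := fun m s' => ∃ h ≤ k, ∃ x, m = 30 * h ∧
    (∀ r < 20, s'.reg r = s.reg r) ∧ s'.arr = s.arr ∧
    s'.reg 30 = B ∧ s'.reg 31 = D ∧ s'.reg 32 = x ∧ s'.reg 33 = 2 ^ h ∧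
    2 ^ (k - h) ≤ x ∧ x < 2 ^ (k - h + 1) ∧
    x * 2 ^ h ≤ 2 ^ k + (cntLeft k S₁ h x + cntLeft k S₂ h x) ∧
    cnt k S₁ h x + cnt k S₂ h x < 2 ^ h
  refine wp_loop I (m := 30 * k) ⟨k, le_rfl, 1, rfl, ?_, ?_, ?_, ?_, ?_, ?_, ?_, ?_, ?_, ?_⟩ ?_ ?_
  · intro i hi
    simp [show i ≠ 30 by omega, show i ≠ 31 by omega, show i ≠ 32 by omega, show i ≠ 33 by omega]
  · simp
  · simp
  · simp
  · simp
  · simp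
  · simp
  · simp
  · simp [cntLeft_root]
  · simp [cnt_root hS₁, cnt_root hS₂, hcard]
  · rintro m s' ⟨h, hh, x, rfl, hreg, harr, h30, h31, h32, h33, hx1, hx2, hleft, hlt⟩ htest
    have h6' : s'.reg 6 = 2 ^ k := by rw [hreg 6 (by omega), h6]
    have hxk : x < 2 ^ k := by
      by_contra hcon
      apply htest
      rw [eval_lt (eval_reg h32) (eval_reg h6'), if_neg hcon]
    obtain ⟨h, rfl⟩ : ∃ h', h = h' + 1 := by
      apply Nat.exists_eq_succ_of_ne_zero
      rintro rfl
      simp at hx1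
      omega
    have hy1 : 2 ^ (k - h) = 2 ^ (k - (h + 1)) * 2 := by rw [← pow_succ]; congr 1; omega
    have hy2 : 2 ^ (k - h + 1) = 2 ^ (k - (h + 1) + 1) * 2 := by rw [← pow_succ]; congr 1; omega
    have hcell₁ : s'.arr 3 (B + (x + x)) = cnt k S₁ h (2 * x) := by
      rw [harr, ← two_mul]
      exact ht₁ h (by omega) (2 * x) (by omega) (by omega)
    have hcell₂ : s'.arr 3 (D + (x + x)) = cnt k S₂ h (2 * x) := by
      rw [harr, ← two_mul]
      exact ht₂ h (by omega) (2 * x) (by omega) (by omega)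
    apply wp_seq
    apply wp_setReg (x := x + x) (eval_add (eval_reg h32) (eval_reg h32) (by omega))
    apply wp_seq
    apply wp_setReg (x := 2 ^ h) (by
      rw [eval_div (x := 2 ^ h * 2) (eval_reg (by simp [h33, pow_succ])) (eval_lit (by omega))]
      simp)
    have h1 : cnt k S₁ h (2 * x) ≤ S₁.card := cnt_le_card _ _ _ _
    have h2 : cnt k S₂ h (2 * x) ≤ S₂.card := cnt_le_card _ _ _ _
    apply wp_cond
    all_goals
      intro hc
      rw [eval_lt (x := cnt k S₁ h (2 * x) + cnt k S₂ h (2 * x)) (y := 2 ^ h)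
        (eval_add (eval_cell (x := B + (x + x))
            (eval_add (eval_reg (by simp [h30])) (eval_reg (by simp)) (by omega))
            (by simpa using hcell₁))
          (eval_cell (x := D + (x + x))
            (eval_add (eval_reg (by simp [h31])) (eval_reg (by simp)) (by omega))
            (by simpa using hcell₂))
          (by omega))
        (eval_reg (by simp))] at hc
    · have hc' : cnt k S₁ h (2 * x) + cnt k S₂ h (2 * x) < 2 ^ h := by
        by_contra hcon
        rw [if_neg hcon] at hc
        exact hc rfl
      apply wp_skip
      refine ⟨30 * h, ⟨h, by omega, x + x, rfl, ?_, ?_, ?_, ?_, ?_, ?_, ?_, ?_, ?_, ?_⟩, ?_⟩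
      · intro i hi
        simp [show i ≠ 32 by omega, show i ≠ 33 by omega, hreg i hi]
      · simpa using harr
      · simp [h30]
      · simp [h31]
      · simp
      · simp
      · omega
      · omega
      · rw [← two_mul, cntLeft_left, cntLeft_left]
        rw [pow_succ] at hleft
        linarith
      · rw [← two_mul]
        exact hc'
      · simp only [Expr.cost]
        omega
    · have hc' : 2 ^ h ≤ cnt k S₁ h (2 * x) + cnt k S₂ h (2 * x) := by
        by_contra hcon
        rw [if_pos (by omega)] at hc
        omega
      apply wp_setReg (x := x + x + 1) (eval_add (eval_reg (by simp)) (eval_lit (by omega))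
        (by omega))
      refine ⟨30 * h, ⟨h, by omega, x + x + 1, rfl, ?_, ?_, ?_, ?_, ?_, ?_, ?_, ?_, ?_, ?_⟩, ?_⟩
      · intro i hi
        simp [show i ≠ 32 by omega, show i ≠ 33 by omega, hreg i hi]
      · simpa using harr
      · simp [h30]
      · simp [h31]
      · simp
      · simp
      · omega
      · omega
      · rw [← two_mul, cntLeft_right, cntLeft_right]
        rw [pow_succ] at hleft
        linarith
      · rw [cnt_succ, cnt_succ, pow_succ] at hlt
        rw [← two_mul]
        omega
      · simp only [Expr.cost]
        omega
  · rintro m s' t ⟨h, hh, x, rfl, hreg, harr, h30, h31, h32, h33, hx1, hx2, hleft, hlt⟩ htest hT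
    have h6' : s'.reg 6 = 2 ^ k := by rw [hreg 6 (by omega), h6]
    have hxk : 2 ^ k ≤ x := by
      by_contra hcon
      rw [eval_lt (eval_reg h32) (eval_reg h6'), if_pos (by omega)] at htest
      omega
    have hh0 : h = 0 := by
      by_contra hne
      have : 2 ^ (k - h + 1) ≤ 2 ^ k := Nat.pow_le_pow_right (by norm_num) (by omega)
      omega
    subst hh0
    obtain ⟨c, rfl⟩ := Nat.exists_eq_add_of_le hxk
    apply wp_setReg (x := c) (by rw [eval_sub (eval_reg h32) (eval_reg h6')]; omega)
    rw [cnt_leaf, cnt_leaf, pow_zero] at hlt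
    rw [cntLeft_leaf, cntLeft_leaf] at hleft
    have hf₁ : (S₁.filter (· < c)).card ≤ S₁.card := Finset.card_filter_le _ _
    have hf₂ : (S₂.filter (· < c)).card ≤ S₂.card := Finset.card_filter_le _ _
    refine ⟨?_, ?_, ⟨c, ?_, ?_, by omega, ?_⟩, ?_⟩
    · intro i hi
      simp [show i ≠ 32 by omega, hreg i hi]
    · simpa using harr
    · intro hmem
      rw [if_pos hmem] at hlt
      omega
    · intro hmem
      rw [if_pos hmem] at hlt
      omega
    · simp
    · simp only [Expr.cost] at hT ⊢
      omega

/-! ### Memory layout -/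

/-! The registers `0` to `4` hold the input: the parameters `n`, `α`, `q` and the endpoints of the
updated edge.  The registers `5`, `6`, `7` hold the derived parameters `k`, `2 ^ k`, `L`, and
register `8` the height of the stack.  The registers `9` to `19` are the variables of the main
programs; those from `20` on belong to the subroutines for counting trees, which leave the smaller
ones unchanged.

Array `0` holds the colors.  If `vw` is an edge with color `c + 1`, then `w` is in cell
`v * 2 ^ k + c` of array `1`; cells of unused colors may hold anything.  Array `2` holds the levels.
Array `3` holds `L + 2` counting trees for every vertex, each in a slot of `2 * 2 ^ k` cells.  Array
`5` holds the stack. -/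

/-- The parameters: the number `n` of vertices, the arboricity bound `α`, the precision `q`, and the
word bound `W`. -/
structure Par where
  n : ℕ
  α : ℕ
  q : ℕ
  W : ℕ

namespace Par

/-- The height of the counting trees.  Their `2 ^ k` leaves outnumber the colors that are forbidden
for an edge, fewer than `n` at each endpoint. -/
def k (p : Par) : ℕ := Nat.clog 2 (2 * p.n)

/-- The highest level of the decomposition.  Passing from one level to the next shrinks the set of
the vertices at or above it by the factor `1 + 1 / (8 q)`, so after `8 q` levels at least by the
factor two. -/
def L (p : Par) : ℕ := 8 * p.q * p.k

/-- A bound for the height of the stack of vertices to be inspected: three times the greatest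
possible potential, plus a constant for the two vertices on the initial stack. -/
def cap (p : Par) : ℕ :=
  3 * (p.n * (p.L * p.n + p.L * (24 * ((4 * p.q + 1) * p.α)))) + 10

/-- The parameters are not degenerate, and the words are large enough. -/
structure Ok (p : Par) : Prop where
  n_pos : 0 < p.n
  α_pos : 0 < p.α
  q_pos : 0 < p.q
  fits : Fits p.W p.k (p.n * (p.L + 2))
  slots : p.n * (p.L + 2) < p.W
  cap_lt : p.cap < p.W
  cmp_lt : 4 * p.q * (2 * p.n) + (8 * p.q + 1) * p.α < p.W

variable {p : Par}

theorem two_n_le (p : Par) : 2 * p.n ≤ 2 ^ p.k := Nat.le_pow_clog (by norm_num) _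

theorem Ok.eight (hp : p.Ok) : 8 < p.W := hp.fits.eight

theorem Ok.mul_pow_lt (hp : p.Ok) : 2 * (p.n * 2 ^ p.k) + 2 * 2 ^ p.k < p.W := by
  have h1 := hp.fits.trees
  have h2 : p.n * 2 ≤ p.n * (p.L + 2) := Nat.mul_le_mul_left _ (by omega)
  have h3 := Nat.mul_le_mul_right (2 * 2 ^ p.k) h2
  nlinarith [Nat.zero_le (p.n * 2 ^ p.k)]

theorem Ok.index_lt (hp : p.Ok) {u v x : ℕ} (hu : u < p.n) (hx : x ≤ 2 ^ p.k)
    (hv : v ≤ 2 ^ p.k) : u * x < p.W ∧ u * x + v < p.W := by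
  have h1 := hp.mul_pow_lt
  have h2 : u * x ≤ p.n * 2 ^ p.k := Nat.mul_le_mul hu.le hx
  omega

theorem slot_lt (p : Par) {v j : ℕ} (hv : v < p.n) (hj : j ≤ p.L + 1) :
    v * (p.L + 2) + j < p.n * (p.L + 2) := by
  have : (v + 1) * (p.L + 2) ≤ p.n * (p.L + 2) := Nat.mul_le_mul_right _ hv
  rw [add_mul] at this
  omega

end Par

theorem mul_add_inj {m u v u' v' : ℕ} (hv : v < m) (hv' : v' < m) :
    u * m + v = u' * m + v' ↔ u = u' ∧ v = v' := by
  constructor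
  · intro h
    have h1 : (u * m + v) / m = u := by
      rw [mul_comm, Nat.mul_add_div (by omega), Nat.div_eq_of_lt hv, add_zero]
    have h2 : (u' * m + v') / m = u' := by
      rw [mul_comm, Nat.mul_add_div (by omega), Nat.div_eq_of_lt hv', add_zero]
    have h3 : u = u' := by rw [← h1, ← h2, h]
    subst h3
    exact ⟨rfl, by omega⟩
  · rintro ⟨rfl, rfl⟩; rfl

variable {p : Par}

/-- Array `3` holds a family of counting trees, indexed by a vertex and a number up to `L + 1`. -/
def Trees (p : Par) (s : Store) (S : ℕ → ℕ → Finset ℕ) : Prop :=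
  ∀ v < p.n, ∀ j ≤ p.L + 1,
    IsTree p.k (fun x => s.arr 3 ((v * (p.L + 2) + j) * (2 * 2 ^ p.k) + x)) (S v j)

/-- The registers with the parameters. -/
structure Globals (p : Par) (s : Store) : Prop where
  r0 : s.reg 0 = p.n
  r1 : s.reg 1 = p.α
  r2 : s.reg 2 = p.q
  r5 : s.reg 5 = p.k
  r6 : s.reg 6 = 2 ^ p.k
  r7 : s.reg 7 = p.L

theorem Globals.frame {s s' : Store} (hg : Globals p s) (h : ∀ r < 8, s'.reg r = s.reg r) :
    Globals p s' :=
  ⟨by rw [h 0 (by omega), hg.r0], by rw [h 1 (by omega), hg.r1], by rw [h 2 (by omega), hg.r2],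
    by rw [h 5 (by omega), hg.r5], by rw [h 6 (by omega), hg.r6], by rw [h 7 (by omega), hg.r7]⟩

/-- The number of the tree with vertex `ev` and index `ej`. -/
def slotE (ev ej : Expr) : Expr := ev *ₑ (.reg 7 +ₑ .lit 2) +ₑ ej

theorem eval_slotE (hp : p.Ok) {s : Store} (h7 : s.reg 7 = p.L) {ev ej : Expr} {v j : ℕ}
    (hev : ev.eval p.W s = v) (hej : ej.eval p.W s = j) (hv : v < p.n) (hj : j ≤ p.L + 1) :
    (slotE ev ej).eval p.W s = v * (p.L + 2) + j := by
  have h1 := hp.slots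
  have h2 := p.slot_lt hv hj
  have h3 := hp.eight
  have h4 : 1 * (p.L + 2) ≤ p.n * (p.L + 2) := Nat.mul_le_mul_right _ hp.n_pos
  exact eval_add (eval_mul hev (eval_add h7 (eval_lit (by omega)) (by omega)) (by omega)) hej
    (by omega)

/-- The effect of an operation of `treeUpd` on a set. -/
def updSet (o : Op) (c : ℕ) (S : Finset ℕ) : Finset ℕ :=
  match o with
  | .add => insert c S
  | _ => S.erase c

/-- Only missing elements are added, and only existing ones are removed. -/
def CanUpd (o : Op) (c : ℕ) (S : Finset ℕ) : Prop := (o = .add ∧ c ∉ S) ∨ (o = .sub ∧ c ∈ S)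

theorem CanUpd.isUpd {o : Op} {c : ℕ} {S : Finset ℕ} (h : CanUpd o c S) :
    IsUpd o S (updSet o c S) c := by
  rcases h with ⟨rfl, h⟩ | ⟨rfl, h⟩
  · exact Or.inl ⟨rfl, h, rfl⟩
  · exact Or.inr ⟨rfl, h, rfl⟩

theorem updSet_subset {o : Op} {c m : ℕ} {S : Finset ℕ} (hc : c < m) (h : S ⊆ Finset.range m) :
    updSet o c S ⊆ Finset.range m := by
  have h1 : S.erase c ⊆ Finset.range m := (Finset.erase_subset _ _).trans h
  cases o <;> simp only [updSet] <;> try exact h1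
  intro x hx
  rcases Finset.mem_insert.1 hx with rfl | hx
  · simpa using hc
  · exact h hx

theorem slotUpd_spec (hp : p.Ok) {s : Store} (hg : Globals p s) {o : Op} {ev ej : Expr}
    {rc c v j : ℕ} {S : ℕ → ℕ → Finset ℕ} (hev : ev.eval p.W s = v) (hej : ej.eval p.W s = j)
    (hv : v < p.n) (hj : j ≤ p.L + 1) (hrc : rc < 20) (hc : s.reg rc = c) (hck : c < 2 ^ p.k)
    (hS : ∀ v j, S v j ⊆ Finset.range (2 ^ p.k)) (ht : Trees p s S) (hu : CanUpd o c (S v j)) :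
    wp p.W (treeUpd o (slotE ev ej) rc) s fun s' t =>
      (∀ r < 20, s'.reg r = s.reg r) ∧ (∀ a ≠ 3, s'.arr a = s.arr a) ∧
      Trees p s' (fun v' j' => if v' = v ∧ j' = j then updSet o c (S v' j') else S v' j') ∧
      t ≤ ev.cost + ej.cost + 50 * (p.k + 1) := by
  refine wp_mono (treeUpd_spec hp.fits hg.r6 (eval_slotE hp hg.r7 hev hej hv hj)
    (p.slot_lt hv hj) hrc hc hck (hS v j) (ht v hv j hj) hu.isUpd) ?_
  rintro s' t ⟨h1, h2, h3, h4, h5⟩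
  refine ⟨h1, h2, ?_, ?_⟩
  · intro v' hv' j' hj'
    by_cases h : v' = v ∧ j' = j
    · obtain ⟨rfl, rfl⟩ := h
      simpa using h3
    · simp only [h, if_false]
      have hne : v' * (p.L + 2) + j' ≠ v * (p.L + 2) + j := by
        rw [Ne, mul_add_inj (by omega) (by omega)]
        exact h
      have hlt : ∀ x, x < 2 * 2 ^ p.k →
          s'.arr 3 ((v' * (p.L + 2) + j') * (2 * 2 ^ p.k) + x) =
            s.arr 3 ((v' * (p.L + 2) + j') * (2 * 2 ^ p.k) + x) := by
        intro x hx
        apply h4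
        rcases lt_or_gt_of_ne hne with h6 | h6
        · left
          have := Nat.mul_le_mul_right (2 * 2 ^ p.k) (Nat.succ_le_of_lt h6)
          rw [Nat.succ_mul] at this
          omega
        · right
          have := Nat.mul_le_mul_right (2 * 2 ^ p.k) (Nat.succ_le_of_lt h6)
          rw [Nat.succ_eq_add_one] at this
          omega
      intro h hh x hx1 hx2
      have hx3 : 2 ^ (p.k - h + 1) ≤ 2 ^ (p.k + 1) := Nat.pow_le_pow_right (by norm_num) (by omega)
      rw [pow_succ 2 p.k] at hx3
      simp only
      rw [hlt x (by omega)]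
      exact ht v' hv' j' hj' h hh x hx1 hx2
  · simp only [slotE, Expr.cost] at h5
    omega

/-- The update of the trees with the same index `ej` at two vertices. -/
def pairUpd (o : Op) (rv rw : ℕ) (ej : Expr) (rc : ℕ) : Cmd :=
  treeUpd o (slotE (.reg rv) ej) rc ;; treeUpd o (slotE (.reg rw) ej) rc

theorem pairUpd_spec (hp : p.Ok) {s : Store} (hg : Globals p s) {o : Op} {ej : Expr}
    {rv rw rc c v w j : ℕ} {S : ℕ → ℕ → Finset ℕ} (hrw : rw < 20) (hrc : rc < 20)
    (hv' : s.reg rv = v) (hw' : s.reg rw = w) (hc : s.reg rc = c)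
    (hej : ∀ s' : Store, (∀ r < 20, s'.reg r = s.reg r) → ej.eval p.W s' = j)
    (hv : v < p.n) (hw : w < p.n) (hvw : v ≠ w) (hj : j ≤ p.L + 1) (hck : c < 2 ^ p.k)
    (hS : ∀ v j, S v j ⊆ Finset.range (2 ^ p.k)) (ht : Trees p s S)
    (hu : CanUpd o c (S v j)) (hu' : CanUpd o c (S w j)) :
    wp p.W (pairUpd o rv rw ej rc) s fun s' t =>
      (∀ r < 20, s'.reg r = s.reg r) ∧ (∀ a ≠ 3, s'.arr a = s.arr a) ∧
      Trees p s' (fun x i => if (x = v ∨ x = w) ∧ i = j then updSet o c (S x i) else S x i) ∧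
      t ≤ 2 * ej.cost + 102 * (p.k + 1) := by
  apply wp_seq
  refine wp_mono (slotUpd_spec hp hg (ev := .reg rv) hv' (hej s fun _ _ => rfl) hv hj hrc hc hck
    hS ht hu) ?_
  rintro s₁ t₁ ⟨h1, h2, h3, h4⟩
  refine wp_mono (slotUpd_spec hp (hg.frame fun r hr => h1 r (by omega)) (ev := .reg rw)
    (by rw [Expr.eval, h1 _ hrw, hw']) (hej s₁ h1) hw hj hrc (by rw [h1 _ hrc, hc]) hck
    ?_ h3 ?_) ?_
  · intro v' j'
    split_ifs
    · exact updSet_subset hck (hS _ _)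
    · exact hS _ _
  · rw [if_neg (by simp [hvw.symm])]
    exact hu'
  · rintro s₂ t₂ ⟨h5, h6, h7, h8⟩
    refine ⟨fun r hr => by rw [h5 r hr, h1 r hr], fun a ha => by rw [h6 a ha, h2 a ha], ?_, ?_⟩
    · intro x hx i hi
      have := h7 x hx i hi
      by_cases h9 : x = v
      · subst h9
        simpa [hvw] using this
      · simpa [h9] using this
    · simp only [Expr.cost] at h4 h8
      omega

/-- A proper partial edge coloring with the colors `1, …, 2 ^ k` on the vertices below `n`; `0`
stands for "no color". -/
structure IsCol (p : Par) (χ : ℕ → ℕ → ℕ) : Prop where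
  symm : ∀ u v, χ u v = χ v u
  irrefl : ∀ v, χ v v = 0
  lt : ∀ u v, χ u v ≠ 0 → u < p.n
  le : ∀ u v, χ u v ≤ 2 ^ p.k
  proper : ∀ u v w, χ u v ≠ 0 → χ u v = χ u w → v = w

open Classical in
/-- The set in the tree with vertex `v` and index `j`: the colors, counted from zero, of the edges
`vw` with key `κ v w = j`, and of all edges at `v` if `j = L + 1`. -/
noncomputable def slotSet (p : Par) (χ κ : ℕ → ℕ → ℕ) (v j : ℕ) : Finset ℕ :=
  (Finset.range (2 ^ p.k)).filter fun c => ∃ w, χ v w = c + 1 ∧ (j = p.L + 1 ∨ κ v w = j)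

open Classical in
theorem slotSet_subset (χ κ : ℕ → ℕ → ℕ) (v j : ℕ) :
    slotSet p χ κ v j ⊆ Finset.range (2 ^ p.k) := Finset.filter_subset _ _

open Classical in
theorem IsCol.mem_slotSet {χ : ℕ → ℕ → ℕ} (hχ : IsCol p χ) {κ : ℕ → ℕ → ℕ} {v j c : ℕ} :
    c ∈ slotSet p χ κ v j ↔ ∃ w, χ v w = c + 1 ∧ (j = p.L + 1 ∨ κ v w = j) := by
  rw [slotSet, Finset.mem_filter, Finset.mem_range, and_iff_right_iff_imp]
  rintro ⟨w, h, _⟩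
  have := hχ.le v w
  omega

/-- The memory represents the coloring `χ`, the keys `κ` of the edges and the levels `ℓ`. -/
structure Rep (p : Par) (s : Store) (χ κ : ℕ → ℕ → ℕ) (ℓ : ℕ → ℕ) : Prop where
  glob : Globals p s
  col : ∀ u < p.n, ∀ v < p.n, s.arr 0 (u * p.n + v) = χ u v
  own : ∀ u v c, χ u v = c + 1 → s.arr 1 (u * 2 ^ p.k + c) = v
  lev : ∀ v < p.n, s.arr 2 v = ℓ v
  tree : Trees p s (slotSet p χ κ)

theorem Rep.frame {s s' : Store} {χ κ : ℕ → ℕ → ℕ} {ℓ : ℕ → ℕ} (h : Rep p s χ κ ℓ)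
    (hr : ∀ r < 8, s'.reg r = s.reg r) (ha : ∀ a < 4, s'.arr a = s.arr a) : Rep p s' χ κ ℓ where
  glob := h.glob.frame hr
  col u hu v hv := by rw [ha 0 (by omega)]; exact h.col u hu v hv
  own u v c hc := by rw [ha 1 (by omega)]; exact h.own u v c hc
  lev v hv := by rw [ha 2 (by omega)]; exact h.lev v hv
  tree v hv j hj := by rw [ha 3 (by omega)]; exact h.tree v hv j hj

/-- Changing a symmetric table at one unordered pair. -/
def setPair (χ : ℕ → ℕ → ℕ) (a b x : ℕ) : ℕ → ℕ → ℕ :=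
  fun u v => if (u = a ∧ v = b) ∨ (u = b ∧ v = a) then x else χ u v

theorem setPair_comm (χ : ℕ → ℕ → ℕ) (a b x : ℕ) : setPair χ a b x = setPair χ b a x := by
  funext u v
  simp only [setPair, or_comm]

theorem setPair_self (χ : ℕ → ℕ → ℕ) (a b x : ℕ) : setPair χ a b x a b = x := by
  simp [setPair]

theorem setPair_symm {χ : ℕ → ℕ → ℕ} (h : ∀ u v, χ u v = χ v u) (a b x u v : ℕ) :
    setPair χ a b x u v = setPair χ a b x v u := by
  unfold setPair
  rw [h u v]
  congr 1
  apply propext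
  tauto

/-- At an endpoint of the pair, `setPair` changes one entry of the row. -/
theorem setPair_row {a b v : ℕ} (hab : a ≠ b) (hv : v = a ∨ v = b) (χ : ℕ → ℕ → ℕ) (x : ℕ) :
    ∃ y, ((v = a ∧ y = b) ∨ (v = b ∧ y = a)) ∧ setPair χ a b x v y = x ∧
      ∀ z, z ≠ y → setPair χ a b x v z = χ v z := by
  rcases hv with rfl | rfl
  · refine ⟨b, Or.inl ⟨rfl, rfl⟩, setPair_self _ _ _ _, fun z hz => if_neg ?_⟩
    rintro (⟨_, h⟩ | ⟨h, _⟩)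
    · exact hz h
    · exact hab h
  · refine ⟨a, Or.inr ⟨rfl, rfl⟩, by rw [setPair_comm, setPair_self], fun z hz => if_neg ?_⟩
    rintro (⟨h, _⟩ | ⟨_, h⟩)
    · exact hab h.symm
    · exact hz h

theorem setPair_of_ne {a b v : ℕ} (hv : ¬ (v = a ∨ v = b)) (χ : ℕ → ℕ → ℕ) (x y : ℕ) :
    setPair χ a b x v y = χ v y := if_neg (by tauto)

theorem slotSet_setPair {χ κ : ℕ → ℕ → ℕ} {o : Op} {a b m c x : ℕ} (hab : a ≠ b)
    (hκ : κ a b = m) (hκ' : κ b a = m) (hχ : IsCol p χ) (hχ' : IsCol p (setPair χ a b x))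
    (ho : (o = .add ∧ χ a b = 0 ∧ x = c + 1) ∨ (o = .sub ∧ χ a b = c + 1 ∧ x = 0)) (v j : ℕ) :
    slotSet p (setPair χ a b x) κ v j =
      if (v = a ∨ v = b) ∧ (j = p.L + 1 ∨ j = m) then updSet o c (slotSet p χ κ v j)
      else slotSet p χ κ v j := by
  by_cases hv : v = a ∨ v = b
  swap
  · rw [if_neg (by tauto)]
    ext d
    rw [hχ'.mem_slotSet, hχ.mem_slotSet]
    simp only [setPair_of_ne hv]
  obtain ⟨y, hvy, hset, hother⟩ := setPair_row hab hv χ x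
  have hκy : κ v y = m := by rcases hvy with ⟨rfl, rfl⟩ | ⟨rfl, rfl⟩ <;> assumption
  have hχy : χ v y = χ a b := by
    rcases hvy with ⟨rfl, rfl⟩ | ⟨rfl, rfl⟩
    · rfl
    · exact hχ.symm _ _
  have hold : ∀ d, d ∈ slotSet p χ κ v j ↔ (χ a b = d + 1 ∧ (j = p.L + 1 ∨ j = m)) ∨
      ∃ z, z ≠ y ∧ χ v z = d + 1 ∧ (j = p.L + 1 ∨ κ v z = j) := by
    intro d
    rw [hχ.mem_slotSet]
    constructor
    · rintro ⟨z, h1, h2⟩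
      by_cases hz : z = y
      · subst hz
        exact Or.inl ⟨by omega, by omega⟩
      · exact Or.inr ⟨z, hz, h1, h2⟩
    · rintro (⟨h1, h2⟩ | ⟨z, _, h1, h2⟩)
      · exact ⟨y, by omega, by omega⟩
      · exact ⟨z, h1, h2⟩
  have hnew : ∀ d, d ∈ slotSet p (setPair χ a b x) κ v j ↔
      (x = d + 1 ∧ (j = p.L + 1 ∨ j = m)) ∨
      ∃ z, z ≠ y ∧ χ v z = d + 1 ∧ (j = p.L + 1 ∨ κ v z = j) := by
    intro d
    rw [hχ'.mem_slotSet]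
    constructor
    · rintro ⟨z, h1, h2⟩
      by_cases hz : z = y
      · subst hz
        exact Or.inl ⟨by omega, by omega⟩
      · exact Or.inr ⟨z, hz, by rwa [hother z hz] at h1, h2⟩
    · rintro (⟨h1, h2⟩ | ⟨z, hz, h1, h2⟩)
      · exact ⟨y, by omega, by omega⟩
      · exact ⟨z, by rwa [hother z hz], h2⟩
  ext d
  rw [hnew]
  by_cases hj : j = p.L + 1 ∨ j = m
  · rw [if_pos ⟨hv, hj⟩]
    rcases ho with ⟨rfl, h0, rfl⟩ | ⟨rfl, h0, rfl⟩
    · simp only [updSet, Finset.mem_insert, hold]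
      constructor
      · rintro (h | h)
        · left; omega
        · exact Or.inr (Or.inr h)
      · rintro (h | h | h)
        · left; omega
        · omega
        · exact Or.inr h
    · simp only [updSet, Finset.mem_erase, hold]
      constructor
      · rintro (h | ⟨z, h1, h2, h3⟩)
        · omega
        · refine ⟨?_, Or.inr ⟨z, h1, h2, h3⟩⟩
          rintro rfl
          exact h1 (hχ.proper v z y (by omega) (by omega))
      · rintro ⟨h1, h | h⟩
        · omega
        · exact Or.inr h
  · rw [if_neg (by tauto), hold]
    simp only [hj, and_false, false_or]

/-- The program that gives the edge `ab` with key `m` the color `ex`: for `o = .add`, the edge was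
uncolored and `ex` is `c + 1`; for `o = .sub`, the edge had the color `c + 1` and `ex` is zero.  The
operands are in the registers `ra`, `rb`, `rm`, `rc`. -/
def edgeUpd (o : Op) (ra rb rm rc : ℕ) (ex : Expr) : Cmd :=
  .setCell 0 (.reg ra *ₑ .reg 0 +ₑ .reg rb) ex ;;
  .setCell 0 (.reg rb *ₑ .reg 0 +ₑ .reg ra) ex ;;
  .setCell 1 (.reg ra *ₑ .reg 6 +ₑ .reg rc) (.reg rb) ;;
  .setCell 1 (.reg rb *ₑ .reg 6 +ₑ .reg rc) (.reg ra) ;;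
  pairUpd o ra rb (.reg rm) rc ;;
  pairUpd o ra rb (.reg 7 +ₑ .lit 1) rc

theorem IsCol.notMem_slotSet {χ : ℕ → ℕ → ℕ} {a b c : ℕ} (hχ : IsCol p χ)
    (hχ' : IsCol p (setPair χ a b (c + 1))) (h0 : χ a b = 0) (κ : ℕ → ℕ → ℕ) (j : ℕ) :
    c ∉ slotSet p χ κ a j ∧ c ∉ slotSet p χ κ b j := by
  have key : ∀ a b, IsCol p (setPair χ a b (c + 1)) → χ a b = 0 → c ∉ slotSet p χ κ a j := by
    intro a b hχ' h0 hmem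
    obtain ⟨w, hw, _⟩ := hχ.mem_slotSet.1 hmem
    have hwb : w ≠ b := by rintro rfl; omega
    apply hwb
    apply (hχ'.proper a b w _ _).symm
    · rw [setPair_self]; omega
    · rw [setPair_self]
      unfold setPair
      rw [if_neg, hw]
      rintro (⟨_, h⟩ | ⟨rfl, h⟩)
      · exact hwb h
      · exact hwb h
  exact ⟨key a b hχ' h0, key b a (by rwa [setPair_comm]) (by rwa [hχ.symm])⟩

theorem own_setPair {χ : ℕ → ℕ → ℕ} {o : Op} {a b c x u v d y : ℕ} (hχ : IsCol p χ)
    (hχ' : IsCol p (setPair χ a b x))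
    (ho : (o = .add ∧ χ a b = 0 ∧ x = c + 1) ∨ (o = .sub ∧ χ a b = c + 1 ∧ x = 0))
    (hv : χ u v = d + 1 → y = v) (hd : setPair χ a b x u v = d + 1) :
    (if u = b ∧ d = c then a else if u = a ∧ d = c then b else y) = v := by
  unfold setPair at hd
  rcases ho with ⟨rfl, h0, rfl⟩ | ⟨rfl, h0, rfl⟩
  · have key : ∀ w, (u = a ∧ w = b) ∨ (u = b ∧ w = a) → d = c → v = w := by
      intro w hw hdc
      have e1 : setPair χ a b (c + 1) u w = c + 1 := if_pos hw
      exact (hχ'.proper u w v (by omega) (by rw [e1, setPair, hd, hdc])).symm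
    by_cases h1 : u = b ∧ d = c
    · rw [if_pos h1]
      exact (key a (Or.inr ⟨h1.1, rfl⟩) h1.2).symm
    rw [if_neg h1]
    by_cases h2 : u = a ∧ d = c
    · rw [if_pos h2]
      exact (key b (Or.inl ⟨h2.1, rfl⟩) h2.2).symm
    rw [if_neg h2]
    by_cases h3 : (u = a ∧ v = b) ∨ (u = b ∧ v = a)
    · rw [if_pos h3] at hd
      omega
    · rw [if_neg h3] at hd
      exact hv hd
  · by_cases h3 : (u = a ∧ v = b) ∨ (u = b ∧ v = a)
    · rw [if_pos h3] at hd
      omega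
    rw [if_neg h3] at hd
    have h0' : χ b a = c + 1 := by rw [hχ.symm, h0]
    by_cases h1 : u = b ∧ d = c
    · obtain ⟨rfl, rfl⟩ := h1
      rw [if_pos ⟨rfl, rfl⟩]
      exact hχ.proper u a v (by omega) (by omega)
    rw [if_neg h1]
    by_cases h2 : u = a ∧ d = c
    · obtain ⟨rfl, rfl⟩ := h2
      rw [if_pos ⟨rfl, rfl⟩]
      exact hχ.proper u b v (by omega) (by omega)
    rw [if_neg h2]
    exact hv hd

theorem edgeUpd_spec (hp : p.Ok) {s : Store} {χ κ : ℕ → ℕ → ℕ} {ℓ : ℕ → ℕ}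
    (hR : Rep p s χ κ ℓ) {o : Op} {ra rb rm rc a b m c x : ℕ} {ex : Expr}
    (hra : ra < 20) (hrb : rb < 20) (hrm : rm < 20) (hrc : rc < 20)
    (ha' : s.reg ra = a) (hb' : s.reg rb = b) (hm' : s.reg rm = m) (hc' : s.reg rc = c)
    (hex : ∀ s' : Store, (∀ r < 20, s'.reg r = s.reg r) → ex.eval p.W s' = x)
    (hexc : ex.cost ≤ 3) (ha : a < p.n) (hb : b < p.n) (hab : a ≠ b)
    (hm : m ≤ p.L) (hκ : κ a b = m) (hκ' : κ b a = m) (hck : c < 2 ^ p.k)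
    (hχ : IsCol p χ) (hχ' : IsCol p (setPair χ a b x))
    (ho : (o = .add ∧ χ a b = 0 ∧ x = c + 1) ∨ (o = .sub ∧ χ a b = c + 1 ∧ x = 0)) :
    wp p.W (edgeUpd o ra rb rm rc ex) s fun s' t =>
      (∀ r < 20, s'.reg r = s.reg r) ∧ (∀ i, 4 ≤ i → s'.arr i = s.arr i) ∧
      Rep p s' (setPair χ a b x) κ ℓ ∧ t ≤ 300 * (p.k + 1) := by
  have h2n := p.two_n_le
  have hP : 0 < 2 ^ p.k := by positivity
  have h8 := hp.eight
  have hbound : p.L + 1 < p.W := by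
    have h1 := hp.slots
    have h4 : 1 * (p.L + 2) ≤ p.n * (p.L + 2) := Nat.mul_le_mul_right _ hp.n_pos
    omega
  have hxeq : ∀ (u v : ℕ) (r : ℕ) (s' : Store), s'.reg = s.reg →
      ∀ {ru rv r0 : ℕ}, s.reg ru = u → s.reg rv = v → s.reg r0 = r → u < p.n → r ≤ 2 ^ p.k →
      v ≤ 2 ^ p.k → (Expr.reg ru *ₑ .reg r0 +ₑ .reg rv).eval p.W s' = u * r + v := by
    intro u v r s' hs' ru rv r0 h1 h2 h3 h4 h5 h6
    obtain ⟨h7, h8⟩ := hp.index_lt h4 h5 h6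
    refine eval_add (eval_mul (eval_reg ?_) (eval_reg ?_) h7) (eval_reg ?_) h8 <;> rw [hs'] <;>
      assumption
  have hgl := hR.glob
  apply wp_seq
  apply wp_setCell (hxeq a b p.n s rfl ha' hb' hgl.r0 ha (by omega) (by omega))
    (hex s fun _ _ => rfl)
  apply wp_seq
  apply wp_setCell (hxeq b a p.n _ (by simp) hb' ha' hgl.r0 hb (by omega) (by omega))
    (hex _ fun _ _ => by simp)
  apply wp_seq
  apply wp_setCell (x := b) (hxeq a c (2 ^ p.k) _ (by simp) ha' hc' hgl.r6 ha le_rfl hck.le)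
    (by simpa [Expr.eval] using hb')
  apply wp_seq
  apply wp_setCell (x := a) (hxeq b c (2 ^ p.k) _ (by simp) hb' hc' hgl.r6 hb le_rfl hck.le)
    (by simpa [Expr.eval] using ha')
  set s₁ := ((((s.writeCell 0 (a * p.n + b) x).writeCell 0 (b * p.n + a) x).writeCell 1
    (a * 2 ^ p.k + c) b).writeCell 1 (b * 2 ^ p.k + c) a) with hs₁
  have hreg₁ : s₁.reg = s.reg := rfl
  have harr₁ : ∀ i, i ≠ 0 → i ≠ 1 → s₁.arr i = s.arr i := by
    intro i h0 h1
    simp only [hs₁, Store.arr_writeCell_of_ne _ _ _ h0, Store.arr_writeCell_of_ne _ _ _ h1]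
  have hcan : ∀ j, j = p.L + 1 ∨ j = m →
      CanUpd o c (slotSet p χ κ a j) ∧ CanUpd o c (slotSet p χ κ b j) := by
    intro j hj
    rcases ho with ⟨rfl, h0, rfl⟩ | ⟨rfl, h0, rfl⟩
    · obtain ⟨h1, h2⟩ := hχ.notMem_slotSet hχ' h0 κ j
      exact ⟨Or.inl ⟨rfl, h1⟩, Or.inl ⟨rfl, h2⟩⟩
    · refine ⟨Or.inr ⟨rfl, ?_⟩, Or.inr ⟨rfl, ?_⟩⟩
      · exact hχ.mem_slotSet.2 ⟨b, h0, by rw [hκ]; tauto⟩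
      · exact hχ.mem_slotSet.2 ⟨a, by rw [hχ.symm, h0], by rw [hκ']; tauto⟩
  have ht₁ : Trees p s₁ (slotSet p χ κ) := by
    intro v hv j hj
    rw [harr₁ 3 (by omega) (by omega)]
    exact hR.tree v hv j hj
  apply wp_seq
  refine wp_mono (pairUpd_spec hp (hgl.frame fun r _ => by rw [hreg₁]) hrb hrc
    (by rw [hreg₁, ha']) (by rw [hreg₁, hb']) (by rw [hreg₁, hc'])
    (fun s' hs' => by rw [Expr.eval, hs' _ hrm, hreg₁, hm']) ha hb hab (by omega : m ≤ p.L + 1) hck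
    (slotSet_subset χ κ) ht₁ (hcan m (Or.inr rfl)).1 (hcan m (Or.inr rfl)).2) ?_
  rintro s₂ t₂ ⟨hreg₂, harr₂, ht₂, htime₂⟩
  refine wp_mono (pairUpd_spec hp (hgl.frame fun r hr => by rw [hreg₂ r (by omega), hreg₁]) hrb
    hrc (by rw [hreg₂ _ hra, hreg₁, ha']) (by rw [hreg₂ _ hrb, hreg₁, hb'])
    (by rw [hreg₂ _ hrc, hreg₁, hc']) (j := p.L + 1)
    (fun s' hs' => eval_add (eval_reg (by rw [hs' 7 (by omega), hreg₂ 7 (by omega), hreg₁, hgl.r7]))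
      (eval_lit (by omega)) (by omega)) ha hb hab le_rfl hck ?_ ht₂ ?_ ?_) ?_
  · intro v j
    split_ifs
    · exact updSet_subset hck (slotSet_subset _ _ _ _)
    · exact slotSet_subset _ _ _ _
  · rw [if_neg (by omega)]
    exact (hcan _ (Or.inl rfl)).1
  · rw [if_neg (by omega)]
    exact (hcan _ (Or.inl rfl)).2
  rintro s₃ t₃ ⟨hreg₃, harr₃, ht₃, htime₃⟩
  have hreg : ∀ r < 20, s₃.reg r = s.reg r := fun r hr => by rw [hreg₃ r hr, hreg₂ r hr, hreg₁]
  have harr : ∀ i, i ≠ 3 → s₃.arr i = s₁.arr i := fun i hi => by rw [harr₃ i hi, harr₂ i hi]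
  refine ⟨hreg, fun i hi => by rw [harr i (by omega), harr₁ i (by omega) (by omega)], ?_, ?_⟩
  · refine ⟨hgl.frame fun r hr => hreg r (by omega), ?_, ?_, ?_, ?_⟩
    · intro u hu v hv
      rw [harr 0 (by omega)]
      simp only [hs₁, Store.arr_writeCell, Nat.zero_ne_one, false_and, if_false, true_and,
        mul_add_inj hv ha, mul_add_inj hv hb]
      unfold setPair
      rw [hR.col u hu v hv]
      by_cases h1 : u = b ∧ v = a
      · rw [if_pos h1, if_pos (Or.inr h1)]
      · by_cases h2 : u = a ∧ v = b
        · rw [if_neg h1, if_pos h2, if_pos (Or.inl h2)]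
        · rw [if_neg h1, if_neg h2, if_neg (by tauto)]
    · intro u v d hd
      rw [harr 1 (by omega)]
      have hdk : d < 2 ^ p.k := by
        have := hχ'.le u v
        omega
      simp only [hs₁, Store.arr_writeCell, Nat.one_ne_zero, false_and, if_false, true_and,
        mul_add_inj hdk hck]
      exact own_setPair hχ hχ' ho (hR.own u v d) hd
    · intro v hv
      rw [harr 2 (by omega), harr₁ 2 (by omega) (by omega)]
      exact hR.lev v hv
    · intro v hv j hj
      have := ht₃ v hv j hj
      convert this using 1
      rw [slotSet_setPair hab hκ hκ' hχ hχ' ho]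
      by_cases h1 : v = a ∨ v = b <;> by_cases h2 : j = p.L + 1
      · simp [h1, h2, show p.L + 1 ≠ m by omega]
      · simp [h1, h2]
      · simp [h1]
      · simp [h1]
  · simp only [Expr.cost] at htime₂ htime₃ ⊢
    omega

/-- The program that changes the key of an edge from `i` to `i'`; the edge, its color, counted from
zero, and the keys are in the registers `rv`, `rw`, `rc`, `ri`, `ri'`. -/
def moveEdge (rv rw rc ri ri' : ℕ) : Cmd :=
  pairUpd .sub rv rw (.reg ri) rc ;; pairUpd .add rv rw (.reg ri') rc

theorem moveEdge_spec (hp : p.Ok) {s : Store} {χ κ : ℕ → ℕ → ℕ} {ℓ : ℕ → ℕ}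
    (hR : Rep p s χ κ ℓ) {rv rw rc ri ri' v w c i i' : ℕ}
    (hrv : rv < 20) (hrw : rw < 20) (hrc : rc < 20) (hri : ri < 20) (hri' : ri' < 20)
    (hv' : s.reg rv = v) (hw' : s.reg rw = w) (hc' : s.reg rc = c) (hi' : s.reg ri = i)
    (hi'' : s.reg ri' = i') (hχ : IsCol p χ) (hc : χ v w = c + 1) (hκ : κ v w = i)
    (hκ' : κ w v = i) (hii : i ≠ i') (hi : i ≤ p.L) (hi2 : i' ≤ p.L) :
    wp p.W (moveEdge rv rw rc ri ri') s fun s' t =>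
      (∀ r < 20, s'.reg r = s.reg r) ∧ (∀ i, 4 ≤ i → s'.arr i = s.arr i) ∧
      Rep p s' χ (setPair κ v w i') ℓ ∧ t ≤ 210 * (p.k + 1) := by
  have hwc : χ w v = c + 1 := by rw [hχ.symm, hc]
  have hv : v < p.n := hχ.lt v w (by omega)
  have hw : w < p.n := hχ.lt w v (by omega)
  have hvw : v ≠ w := by
    rintro rfl
    have := hχ.irrefl v
    omega
  have hck : c < 2 ^ p.k := by
    have := hχ.le v w
    omega
  have hgl := hR.glob
  apply wp_seq
  refine wp_mono (pairUpd_spec hp hgl hrw hrc hv' hw' hc'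
    (fun s' hs' => by rw [Expr.eval, hs' _ hri, hi']) hv hw hvw (by omega : i ≤ p.L + 1) hck
    (slotSet_subset χ κ) hR.tree ?_ ?_) ?_
  · exact Or.inr ⟨rfl, hχ.mem_slotSet.2 ⟨w, hc, Or.inr hκ⟩⟩
  · exact Or.inr ⟨rfl, hχ.mem_slotSet.2 ⟨v, hwc, Or.inr hκ'⟩⟩
  rintro s₂ t₂ ⟨hreg₂, harr₂, ht₂, htime₂⟩
  refine wp_mono (pairUpd_spec hp (hgl.frame fun r hr => by rw [hreg₂ r (by omega)]) hrw
    hrc (by rw [hreg₂ _ hrv, hv']) (by rw [hreg₂ _ hrw, hw'])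
    (by rw [hreg₂ _ hrc, hc']) (j := i')
    (fun s' hs' => by rw [Expr.eval, hs' _ hri', hreg₂ _ hri', hi'']) hv hw hvw (by omega) hck
    ?_ ht₂ ?_ ?_) ?_
  · intro v j
    split_ifs
    · exact updSet_subset hck (slotSet_subset _ _ _ _)
    · exact slotSet_subset _ _ _ _
  · rw [if_neg (by omega)]
    refine Or.inl ⟨rfl, fun hmem => ?_⟩
    obtain ⟨y, h1, h2⟩ := hχ.mem_slotSet.1 hmem
    have := hχ.proper v w y (by omega) (by omega)
    subst this
    omega
  · rw [if_neg (by omega)]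
    refine Or.inl ⟨rfl, fun hmem => ?_⟩
    obtain ⟨y, h1, h2⟩ := hχ.mem_slotSet.1 hmem
    have := hχ.proper w v y (by omega) (by omega)
    subst this
    omega
  rintro s₃ t₃ ⟨hreg₃, harr₃, ht₃, htime₃⟩
  have hreg : ∀ r < 20, s₃.reg r = s.reg r := fun r hr => by rw [hreg₃ r hr, hreg₂ r hr]
  have harr : ∀ i, i ≠ 3 → s₃.arr i = s.arr i := fun i hi => by rw [harr₃ i hi, harr₂ i hi]
  refine ⟨hreg, fun i hi => harr i (by omega), ?_, ?_⟩
  · refine ⟨hgl.frame fun r hr => hreg r (by omega), ?_, ?_, ?_, ?_⟩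
    · intro u hu v hv
      rw [harr 0 (by omega)]
      exact hR.col u hu v hv
    · intro u v d hd
      rw [harr 1 (by omega)]
      exact hR.own u v d hd
    · intro v hv
      rw [harr 2 (by omega)]
      exact hR.lev v hv
    · intro x hx j hj
      have := ht₃ x hx j hj
      convert this using 1
      ext d
      have e1 : ∀ j, d ∈ slotSet p χ κ x j ↔ _ := fun j => hχ.mem_slotSet
      rw [hχ.mem_slotSet]
      by_cases hxe : x = v ∨ x = w
      · obtain ⟨y, hvy, hset, hother⟩ := setPair_row hvw hxe κ i'
        have hκy : κ x y = i := by rcases hvy with ⟨rfl, rfl⟩ | ⟨rfl, rfl⟩ <;> assumption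
        have hxy : χ x y = c + 1 := by rcases hvy with ⟨rfl, rfl⟩ | ⟨rfl, rfl⟩ <;> assumption
        have hd : ∀ j, (∃ z, χ x z = d + 1 ∧ (j = p.L + 1 ∨ setPair κ v w i' x z = j)) ↔
            if d = c then j = p.L + 1 ∨ j = i' else d ∈ slotSet p χ κ x j := by
          intro j
          by_cases hdc : d = c
          · subst hdc
            rw [if_pos rfl]
            constructor
            · rintro ⟨z, h1, h2⟩
              have := hχ.proper x y z (by omega) (by omega)
              subst this
              omega
            · intro h
              exact ⟨y, hxy, by omega⟩
          · rw [if_neg hdc, e1]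
            refine exists_congr fun z => and_congr_right fun h => ?_
            rw [hother z]
            rintro rfl
            omega
        rw [hd]
        have hmemc : ∀ j, c ∈ slotSet p χ κ x j ↔ j = p.L + 1 ∨ j = i := by
          intro j
          rw [hχ.mem_slotSet]
          constructor
          · rintro ⟨z, h1, h2⟩
            have := hχ.proper x y z (by omega) (by omega)
            subst this
            omega
          · intro h
            exact ⟨y, hxy, by omega⟩
        simp only [hxe, true_and, updSet]
        by_cases hdc : d = c
        · subst hdc
          rw [if_pos rfl]
          by_cases hj1 : j = i'
          · simp [hj1]
          · by_cases hj2 : j = i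
            · subst hj2
              simp [hii]
              omega
            · simp [hj1, hj2, hmemc]
        · rw [if_neg hdc]
          by_cases hj1 : j = i' <;> by_cases hj2 : j = i <;> simp [hj1, hj2, hdc, hii, Ne.symm hii]
      · simp only [hxe, false_and, if_false]
        rw [hχ.mem_slotSet]
        simp only [setPair_of_ne hxe]
  · simp only [Expr.cost] at htime₂ htime₃ ⊢
    omega

/-! ### Levels of vertices -/

/-- The neighbors of `v` of level at least `i`. -/
def upNbrs (p : Par) (χ : ℕ → ℕ → ℕ) (ℓ : ℕ → ℕ) (i v : ℕ) : Finset ℕ :=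
  (Finset.range p.n).filter fun w => χ v w ≠ 0 ∧ i ≤ ℓ w

/-- The number of neighbors of `v` of level at least `i`.  For `i = 0` it is the degree. -/
def upDeg (p : Par) (χ : ℕ → ℕ → ℕ) (ℓ : ℕ → ℕ) (i v : ℕ) : ℕ := (upNbrs p χ ℓ i v).card

/-- The key of an edge outside of a change of levels, the smaller level of its endpoints.  With
these keys, the tree of `v` with index `ℓ v` holds the colors of the edges to vertices that are not
below `v`. -/
def minKey (ℓ : ℕ → ℕ) (u v : ℕ) : ℕ := min (ℓ u) (ℓ v)

theorem IsCol.lt_right {χ : ℕ → ℕ → ℕ} (hχ : IsCol p χ) {v w : ℕ} (h : χ v w ≠ 0) : w < p.n :=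
  hχ.lt w v (by rwa [hχ.symm])

theorem IsCol.mem_upNbrs {χ : ℕ → ℕ → ℕ} (hχ : IsCol p χ) {ℓ : ℕ → ℕ} {i v w : ℕ} :
    w ∈ upNbrs p χ ℓ i v ↔ χ v w ≠ 0 ∧ i ≤ ℓ w := by
  simp only [upNbrs, Finset.mem_filter, Finset.mem_range, and_iff_right_iff_imp]
  exact fun h => hχ.lt_right h.1

theorem IsCol.card_slotSet {χ : ℕ → ℕ → ℕ} (hχ : IsCol p χ) (κ : ℕ → ℕ → ℕ) (v j : ℕ) :
    (slotSet p χ κ v j).card =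
      ((Finset.range p.n).filter fun w => χ v w ≠ 0 ∧ (j = p.L + 1 ∨ κ v w = j)).card := by
  symm
  apply Finset.card_bij fun w _ => χ v w - 1
  · intro w hw
    rw [Finset.mem_filter] at hw
    exact hχ.mem_slotSet.2 ⟨w, by omega, hw.2.2⟩
  · intro w hw w' hw' h
    rw [Finset.mem_filter] at hw hw'
    exact hχ.proper v w w' hw.2.1 (by omega)
  · intro c hc
    obtain ⟨w, h1, h2⟩ := hχ.mem_slotSet.1 hc
    refine ⟨w, ?_, by omega⟩
    rw [Finset.mem_filter, Finset.mem_range]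
    exact ⟨hχ.lt_right (v := v) (by omega), by omega, h2⟩

/-- The number of neighbors that are not below `v` can be read off at the root of the tree with
index `ℓ v`. -/
theorem IsCol.card_slotSet_up {χ : ℕ → ℕ → ℕ} (hχ : IsCol p χ) {ℓ : ℕ → ℕ} {v : ℕ}
    (hv : ℓ v ≤ p.L) : (slotSet p χ (minKey ℓ) v (ℓ v)).card = upDeg p χ ℓ (ℓ v) v := by
  rw [hχ.card_slotSet, upDeg, upNbrs]
  congr 1
  apply Finset.filter_congr
  intro w _
  unfold minKey
  apply and_congr_right
  intro _
  omega

theorem IsCol.card_slotSet_all {χ : ℕ → ℕ → ℕ} (hχ : IsCol p χ) (κ : ℕ → ℕ → ℕ) (ℓ : ℕ → ℕ)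
    (v : ℕ) : (slotSet p χ κ v (p.L + 1)).card = upDeg p χ ℓ 0 v := by
  rw [hχ.card_slotSet, upDeg, upNbrs]
  simp

theorem IsCol.card_slotSet_pred {χ : ℕ → ℕ → ℕ} (hχ : IsCol p χ) {ℓ : ℕ → ℕ} {v : ℕ}
    (hv : ℓ v ≤ p.L) (hpos : 0 < ℓ v) :
    upDeg p χ ℓ (ℓ v) v + (slotSet p χ (minKey ℓ) v (ℓ v - 1)).card =
      upDeg p χ ℓ (ℓ v - 1) v := by
  rw [hχ.card_slotSet, upDeg, upNbrs, upDeg, upNbrs, ← Finset.card_union_of_disjoint,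
    ← Finset.filter_or]
  · congr 1
    apply Finset.filter_congr
    intro w _
    unfold minKey
    rw [← and_or_left]
    apply and_congr_right
    intro _
    omega
  · rw [Finset.disjoint_filter]
    intro w _ h1 h2
    unfold minKey at h2
    omega

open Classical in
theorem slotSet_congr {χ κ κ' : ℕ → ℕ → ℕ} (h : ∀ u v, χ u v ≠ 0 → κ u v = κ' u v) (v j : ℕ) :
    slotSet p χ κ v j = slotSet p χ κ' v j := by
  unfold slotSet
  apply Finset.filter_congr
  intro c _
  refine exists_congr fun w => and_congr_right fun hc => ?_
  rw [h v w (by omega)]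

theorem Rep.congr_key {s : Store} {χ κ κ' : ℕ → ℕ → ℕ} {ℓ : ℕ → ℕ} (hR : Rep p s χ κ ℓ)
    (h : ∀ u v, χ u v ≠ 0 → κ u v = κ' u v) : Rep p s χ κ' ℓ where
  glob := hR.glob
  col := hR.col
  own := hR.own
  lev := hR.lev
  tree v hv j hj := by
    rw [← slotSet_congr h]
    exact hR.tree v hv j hj

/-- The size of the tree with vertex `ev` and index `ej`. -/
def rootE (ev ej : Expr) : Expr := .cell 3 (slotE ev ej *ₑ (.reg 6 +ₑ .reg 6) +ₑ .lit 1)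

theorem eval_rootE (hp : p.Ok) {s : Store} {χ κ : ℕ → ℕ → ℕ} {ℓ : ℕ → ℕ} (hR : Rep p s χ κ ℓ)
    {s' : Store} (hreg : ∀ r < 8, s'.reg r = s.reg r) (harr : s'.arr 3 = s.arr 3)
    {ev ej : Expr} {v j : ℕ} (hev : ev.eval p.W s' = v) (hej : ej.eval p.W s' = j) (hv : v < p.n)
    (hj : j ≤ p.L + 1) : (rootE ev ej).eval p.W s' = (slotSet p χ κ v j).card := by
  obtain ⟨h1, h2, h3⟩ := hp.fits.base (p.slot_lt hv hj)
  have h8 := hp.eight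
  have hP : 0 < 2 ^ p.k := by positivity
  have hg := hR.glob.frame hreg
  refine eval_cell (x := (v * (p.L + 2) + j) * (2 * 2 ^ p.k) + 1) ?_ ?_
  · rw [two_mul]
    rw [two_mul] at h1
    exact eval_add (eval_mul (eval_slotE hp hg.r7 hev hej hv hj) (eval_add hg.r6 hg.r6 (by omega))
      (by omega)) (eval_lit (by omega)) (by omega)
  · rw [harr]
    rw [← cnt_root (slotSet_subset χ κ v j)]
    exact hR.tree v hv j hj p.k le_rfl 1 (by simp) (by simp)

/-- If `c` is the last element of `S` before `θ`, then all later elements are at least `θ`. -/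
theorem le_of_card_filter_lt {S : Finset ℕ} {c c' θ r : ℕ} (hc : c ∈ S) (hc' : c' ∈ S)
    (h : c < c') (h1 : (S.filter (· < c)).card = r) (h2 : (S.filter (· < θ)).card = r + 1) :
    θ ≤ c' := by
  by_contra hcon
  have hsub : insert c' (insert c (S.filter (· < c))) ⊆ S.filter (· < θ) := by
    intro d hd
    simp only [Finset.mem_insert, Finset.mem_filter] at hd ⊢
    rcases hd with rfl | rfl | hd
    · exact ⟨hc', by omega⟩
    · exact ⟨hc, by omega⟩
    · exact ⟨hd.1, by omega⟩
  have := Finset.card_le_card hsub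
  rw [Finset.card_insert_of_notMem (by simp; omega), Finset.card_insert_of_notMem (by simp)] at this
  omega

/-! ### Changing the level of a vertex -/

/-- One round of `relevel`: the last edge that has not been inspected is found in the counting tree.
If the other endpoint is not below the new level, then the key of the edge changes to the new level,
and the other endpoint is pushed on the stack. -/
def relevelRound : Cmd :=
  13 ⟵ .reg 13 -ₑ .lit 1 ;;
  select (slotE (.reg 10) (.reg 12)) (.reg 13) ;;
  14 ⟵ .reg 26 ;;
  15 ⟵ .cell 1 (.reg 10 *ₑ .reg 6 +ₑ .reg 14) ;;
  .cond (.cell 2 (.reg 15) <ₑ .reg 11) .skip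
    (moveEdge 10 15 14 12 11 ;;
      .setCell 5 (.reg 8) (.reg 15) ;;
      8 ⟵ .reg 8 +ₑ .lit 1)

/-- The program that changes the level of the vertex in register `10` to the value of register
`11`, and pushes all neighbors whose degrees into higher levels are affected on the stack. -/
def relevel : Cmd :=
  12 ⟵ .cell 2 (.reg 10) ;;
  13 ⟵ rootE (.reg 10) (.reg 12) ;;
  .loop (.reg 13) relevelRound ;;
  .setCell 2 (.reg 10) (.reg 11)

/-- The invariant of the loop of `relevel`.  The edges at `v` with key `ℓ v` are inspected in the
order of falling colors; the `ρ` edges with colors below `θ` are still to be inspected. -/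
structure RelevelInv (p : Par) (s₀ : Store) (χ : ℕ → ℕ → ℕ) (ℓ : ℕ → ℕ) (v i' ρ : ℕ)
    (κ : ℕ → ℕ → ℕ) (θ : ℕ) (s : Store) : Prop where
  rep : Rep p s χ κ ℓ
  r10 : s.reg 10 = v
  r11 : s.reg 11 = i'
  r12 : s.reg 12 = ℓ v
  r13 : s.reg 13 = ρ
  symm : ∀ x y, κ x y = κ y x
  other : ∀ x y, x ≠ v → y ≠ v → κ x y = minKey ℓ x y
  own : ∀ w, χ v w ≠ 0 → κ v w = minKey ℓ v w ∨
    (κ v w = i' ∧ i' ≤ ℓ w ∧ ℓ v ≤ ℓ w ∧ ∃ j < s.reg 8, s.arr 5 j = w)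
  card : ((slotSet p χ κ v (ℓ v)).filter (· < θ)).card = ρ
  done : ∀ c ∈ slotSet p χ κ v (ℓ v), θ ≤ c → ∀ w, χ v w = c + 1 → ℓ w < i'
  sp_le : s.reg 8 + ρ ≤ s₀.reg 8 + upDeg p χ ℓ (ℓ v) v
  le_sp : s₀.reg 8 ≤ s.reg 8
  old : ∀ j < s₀.reg 8, s.arr 5 j = s₀.arr 5 j
  new : ∀ j, s₀.reg 8 ≤ j → j < s.reg 8 → s.arr 5 j < p.n

/-- A round of `relevel`.  Colors of inspected edges that keep their keys stay in the tree, to the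
right of `θ`, so that the element of rank `ρ` is always the last edge to be inspected. -/
theorem relevel_step (hp : p.Ok) {s₀ s : Store} {χ κ : ℕ → ℕ → ℕ} {ℓ : ℕ → ℕ} {v i' ρ θ : ℕ}
    (hχ : IsCol p χ) (hv : v < p.n) (hℓ : ∀ v, ℓ v ≤ p.L) (hi' : i' ≤ p.L) (hne : ℓ v ≠ i')
    (hsp : s₀.reg 8 + upDeg p χ ℓ (ℓ v) v < p.W)
    (hI : RelevelInv p s₀ χ ℓ v i' (ρ + 1) κ θ s) :
    wp p.W relevelRound s fun s' t =>
      (∃ κ' θ', RelevelInv p s₀ χ ℓ v i' ρ κ' θ' s') ∧ t ≤ 340 * (p.k + 1) := by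
  unfold relevelRound
  have h8 := hp.eight
  have hg := hI.rep.glob
  have hP : 0 < 2 ^ p.k := by positivity
  have hLv := hℓ v
  apply wp_seq
  apply wp_setReg (x := ρ) (by
    rw [eval_sub (eval_reg hI.r13) (eval_lit (by omega))]; omega)
  apply wp_seq
  have hg₁ : Globals p (s.writeReg 13 ρ) := hg.frame fun r hr => by
    simp [show r ≠ 13 by omega]
  have hρ : ρ < (slotSet p χ κ v (ℓ v)).card := by
    have h1 := hI.card
    have h2 := Finset.card_filter_le (slotSet p χ κ v (ℓ v)) (· < θ)
    omega
  refine wp_mono (select_spec (N := p.n * (p.L + 2)) (slot := v * (p.L + 2) + ℓ v) (r := ρ)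
    hp.fits hg₁.r6 (eval_slotE hp hg₁.r7 (eval_reg (by simp [hI.r10]))
    (eval_reg (by simp [hI.r12])) hv (by omega)) (p.slot_lt hv (by omega))
    (fun x => by simp [Expr.eval]) hρ (slotSet_subset χ κ v (ℓ v))
    (hI.rep.tree v hv (ℓ v) (by omega))) ?_
  rintro s₁ t₁ ⟨hreg₁, harr₁, ⟨c, hcS, hc26, hrank⟩, ht₁⟩
  obtain ⟨w, hcw, hκw⟩ := hχ.mem_slotSet.1 hcS
  replace hκw : κ v w = ℓ v := by omega
  have hw : w < p.n := hχ.lt_right (v := v) (by omega)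
  have hck : c < 2 ^ p.k := by
    have := hχ.le v w
    omega
  have hreg₁' : ∀ r < 20, r ≠ 13 → s₁.reg r = s.reg r := by
    intro r hr h
    rw [hreg₁ r hr]
    simp [h]
  have harr₁' : s₁.arr = s.arr := by rw [harr₁]; simp
  have hle : ∀ c' ∈ slotSet p χ κ v (ℓ v), c < c' → θ ≤ c' := fun c' hc' h =>
    le_of_card_filter_lt hcS hc' h hrank hI.card
  have hℓw : ℓ v ≤ ℓ w := by
    rcases hI.own w (by omega) with h | ⟨h, _⟩
    · rw [hκw, minKey] at h
      omega
    · omega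
  apply wp_seq
  apply wp_setReg (x := c) (eval_reg hc26)
  apply wp_seq
  obtain ⟨hm1, hm2⟩ := hp.index_lt hv le_rfl hck.le
  apply wp_setReg (x := w) (by
    refine eval_cell (x := v * 2 ^ p.k + c) (eval_add (eval_mul (eval_reg ?_) (eval_reg ?_) hm1)
      (eval_reg ?_) hm2) ?_
    · simp [hreg₁' 10, hI.r10]
    · simp [hreg₁' 6, hg.r6]
    · simp
    · simpa [harr₁'] using hI.rep.own v w c hcw)
  set s₂ := (s₁.writeReg 14 c).writeReg 15 w with hs₂
  have hreg₂ : ∀ r < 13, s₂.reg r = s.reg r := by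
    intro r hr
    simp [hs₂, show r ≠ 14 by omega, show r ≠ 15 by omega, hreg₁' r (by omega) (by omega)]
  have harr₂ : s₂.arr = s.arr := by simp [hs₂, harr₁']
  have h14 : s₂.reg 14 = c := by simp [hs₂]
  have h15 : s₂.reg 15 = w := by simp [hs₂]
  have h13 : s₂.reg 13 = ρ := by simp [hs₂, hreg₁ 13]
  have hR₂ : Rep p s₂ χ κ ℓ := hI.rep.frame (fun r hr => hreg₂ r (by omega))
    (fun a _ => by rw [harr₂])
  have htest : (Expr.cell 2 (.reg 15) <ₑ .reg 11).eval p.W s₂ = if ℓ w < i' then 1 else 0 :=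
    eval_lt (eval_cell (eval_reg h15) (hR₂.lev w hw))
      (eval_reg (by rw [hreg₂ 11 (by omega), hI.r11]))
  apply wp_cond
  · intro hc
    have hlt : ℓ w < i' := by
      by_contra hcon
      rw [htest, if_neg hcon] at hc
      exact hc rfl
    apply wp_skip
    refine ⟨⟨κ, c, hR₂, by rw [hreg₂ 10 (by omega), hI.r10], by rw [hreg₂ 11 (by omega), hI.r11],
      by rw [hreg₂ 12 (by omega), hI.r12], h13, hI.symm, hI.other, ?_, hrank, ?_, ?_, ?_, ?_,
      ?_⟩, ?_⟩
    · rw [hreg₂ 8 (by omega), harr₂]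
      exact hI.own
    · intro c' hc' hcc' w' hw'
      rcases hcc'.lt_or_eq with h | rfl
      · exact hI.done c' hc' (hle c' hc' h) w' hw'
      · rwa [hχ.proper v w' w (by omega) (by omega)]
    · rw [hreg₂ 8 (by omega)]
      have := hI.sp_le
      omega
    · rw [hreg₂ 8 (by omega)]
      exact hI.le_sp
    · rw [harr₂]
      exact hI.old
    · rw [hreg₂ 8 (by omega), harr₂]
      exact hI.new
    · simp only [slotE, Expr.cost] at ht₁ ⊢
      omega
  · intro hc
    have hlt : i' ≤ ℓ w := by
      by_contra hcon
      rw [htest, if_pos (by omega)] at hc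
      omega
    have hvw : v ≠ w := by
      rintro rfl
      have := hχ.irrefl v
      omega
    have hspW : s.reg 8 + 1 < p.W := by
      have := hI.sp_le
      omega
    apply wp_seq
    refine wp_mono (moveEdge_spec hp hR₂ (rv := 10) (rw := 15) (rc := 14) (ri := 12) (ri' := 11)
      (by omega) (by omega) (by omega) (by omega) (by omega)
      (by rw [hreg₂ 10 (by omega), hI.r10]) h15 h14 (by rw [hreg₂ 12 (by omega), hI.r12])
      (by rw [hreg₂ 11 (by omega), hI.r11]) hχ hcw hκw (by rw [hI.symm, hκw]) hne hLv hi') ?_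
    rintro s₃ t₃ ⟨hreg₃, harr₃, hR₃, ht₃⟩
    have h8₃ : s₃.reg 8 = s.reg 8 := by rw [hreg₃ 8 (by omega), hreg₂ 8 (by omega)]
    apply wp_seq
    apply wp_setCell (j := s.reg 8) (x := w) (eval_reg h8₃)
      (eval_reg (by rw [hreg₃ 15 (by omega), h15]))
    apply wp_setReg (x := s.reg 8 + 1) (eval_add (eval_reg (by simp [h8₃])) (eval_lit (by omega))
      hspW)
    set s₄ := (s₃.writeCell 5 (s.reg 8) w).writeReg 8 (s.reg 8 + 1) with hs₄
    have hreg₄ : ∀ r < 20, r ≠ 8 → s₄.reg r = s₂.reg r := by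
      intro r hr h
      simp [hs₄, h, hreg₃ r hr]
    have harr₄ : ∀ a, a ≠ 5 → s₄.arr a = s₃.arr a := by
      intro a ha
      simp [hs₄, Store.arr_writeCell_of_ne _ _ _ ha]
    have h5 : ∀ j, s₄.arr 5 j = if j = s.reg 8 then w else s.arr 5 j := by
      intro j
      simp [hs₄, Store.arr_writeCell, harr₃ 5, harr₂]
    have h84 : s₄.reg 8 = s.reg 8 + 1 := by simp [hs₄]
    have hR₄ : Rep p s₄ χ (setPair κ v w i') ℓ :=
      hR₃.frame (fun r hr => by rw [hreg₄ r (by omega) (by omega), hreg₃ r (by omega)])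
        (fun a ha => harr₄ a (by omega))
    obtain ⟨y, hy, hset, hother⟩ := setPair_row hvw (Or.inl rfl) κ i'
    have hyw : y = w := by tauto
    subst hyw
    have hmem : ∀ d, d ∈ slotSet p χ (setPair κ v y i') v (ℓ v) ↔
        d ∈ slotSet p χ κ v (ℓ v) ∧ d ≠ c := by
      intro d
      rw [hχ.mem_slotSet, hχ.mem_slotSet]
      constructor
      · rintro ⟨z, h1, h2⟩
        have hzy : z ≠ y := by
          rintro rfl
          omega
        rw [hother z hzy] at h2
        refine ⟨⟨z, h1, h2⟩, ?_⟩
        rintro rfl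
        exact hzy (hχ.proper v z y (by omega) (by omega))
      · rintro ⟨⟨z, h1, h2⟩, h3⟩
        refine ⟨z, h1, ?_⟩
        rwa [hother z]
        rintro rfl
        omega
    refine ⟨⟨setPair κ v y i', c, hR₄, ?_, ?_, ?_, ?_, setPair_symm hI.symm _ _ _, ?_, ?_, ?_, ?_,
      ?_, ?_, ?_, ?_⟩, ?_⟩
    · rw [hreg₄ 10 (by omega) (by omega), hreg₂ 10 (by omega), hI.r10]
    · rw [hreg₄ 11 (by omega) (by omega), hreg₂ 11 (by omega), hI.r11]
    · rw [hreg₄ 12 (by omega) (by omega), hreg₂ 12 (by omega), hI.r12]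
    · rw [hreg₄ 13 (by omega) (by omega), h13]
    · intro a b ha hb
      rw [setPair, if_neg (by tauto)]
      exact hI.other a b ha hb
    · intro z hz
      by_cases hzy : z = y
      · subst hzy
        right
        refine ⟨hset, hlt, hℓw, s.reg 8, by omega, ?_⟩
        rw [h5, if_pos rfl]
      · rw [hother z hzy]
        rcases hI.own z hz with h | ⟨h1, h2, h3, j, h4, h6⟩
        · exact Or.inl h
        · refine Or.inr ⟨h1, h2, h3, j, by omega, ?_⟩
          rw [h5, if_neg (by omega), h6]
    · rw [← hrank]
      congr 1
      ext d
      rw [Finset.mem_filter, Finset.mem_filter, hmem]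
      constructor
      · rintro ⟨⟨h1, _⟩, h2⟩; exact ⟨h1, h2⟩
      · rintro ⟨h1, h2⟩; exact ⟨⟨h1, by omega⟩, h2⟩
    · intro c' hc' hcc' w' hw'
      obtain ⟨h1, h2⟩ := (hmem c').1 hc'
      exact hI.done c' h1 (hle c' h1 (by omega)) w' hw'
    · rw [h84]
      have := hI.sp_le
      omega
    · rw [h84]
      have := hI.le_sp
      omega
    · intro j hj
      have := hI.le_sp
      rw [h5, if_neg (by omega)]
      exact hI.old j hj
    · intro j h1 h2
      rw [h5]
      split_ifs with h3
      · exact hw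
      · exact hI.new j h1 (by omega)
    · simp only [slotE, Expr.cost] at ht₁ ⊢
      omega

theorem relevel_spec (hp : p.Ok) {s : Store} {χ : ℕ → ℕ → ℕ} {ℓ : ℕ → ℕ} {v i' : ℕ}
    (hR : Rep p s χ (minKey ℓ) ℓ) (hχ : IsCol p χ) (hv : v < p.n) (hℓ : ∀ v, ℓ v ≤ p.L)
    (hi' : i' ≤ p.L) (hii : i' = ℓ v + 1 ∨ ℓ v = i' + 1) (h10 : s.reg 10 = v)
    (h11 : s.reg 11 = i') (hsp : s.reg 8 + upDeg p χ ℓ (ℓ v) v < p.W) :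
    wp p.W relevel s fun s' t =>
      Rep p s' χ (minKey (Function.update ℓ v i')) (Function.update ℓ v i') ∧
      s.reg 8 ≤ s'.reg 8 ∧ s'.reg 8 ≤ s.reg 8 + upDeg p χ ℓ (ℓ v) v ∧
      (∀ j < s.reg 8, s'.arr 5 j = s.arr 5 j) ∧
      (∀ j, s.reg 8 ≤ j → j < s'.reg 8 → s'.arr 5 j < p.n) ∧
      (∀ w, χ v w ≠ 0 → ℓ v ≤ ℓ w → i' ≤ ℓ w → ∃ j < s'.reg 8, s'.arr 5 j = w) ∧
      t ≤ 350 * (p.k + 1) * (upDeg p χ ℓ (ℓ v) v + 1) := by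
  have h8 := hp.eight
  have hLv := hℓ v
  have hne : ℓ v ≠ i' := by omega
  apply wp_seq
  apply wp_setReg (x := ℓ v) (eval_cell (eval_reg h10) (hR.lev v hv))
  apply wp_seq
  apply wp_setReg (x := upDeg p χ ℓ (ℓ v) v) (by
    rw [← hχ.card_slotSet_up hLv]
    refine eval_rootE hp hR (fun r hr => ?_) (by simp) (eval_reg ?_) (eval_reg ?_) hv (by omega)
    · simp [show r ≠ 12 by omega]
    · simp [h10]
    · simp)
  apply wp_seq
  let I : ℕ → Store → Prop := fun m s' => ∃ ρ κ θ, m = 345 * (p.k + 1) * ρ ∧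
    RelevelInv p s χ ℓ v i' ρ κ θ s'
  refine wp_loop I (m := 345 * (p.k + 1) * upDeg p χ ℓ (ℓ v) v)
    ⟨_, minKey ℓ, 2 ^ p.k, rfl, ?_⟩ ?_ ?_
  · refine ⟨hR.frame (fun r hr => ?_) (by simp), by simp [h10], by simp [h11], by simp, by simp, ?_,
      fun _ _ _ _ => rfl, fun _ _ => Or.inl rfl, ?_, ?_, by simp, by simp, by simp, ?_⟩
    · simp [show r ≠ 12 by omega, show r ≠ 13 by omega]
    · intro x y
      exact min_comm _ _
    · rw [← hχ.card_slotSet_up hLv, Finset.filter_true_of_mem]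
      intro c hc
      simpa using slotSet_subset _ _ _ _ hc
    · intro c hc hle
      have := Finset.mem_range.1 (slotSet_subset _ _ _ _ hc)
      omega
    · intro j h1 h2
      simp at h2
      omega
  · rintro m s' ⟨ρ, κ, θ, rfl, hI⟩ htest
    have hρ : ρ ≠ 0 := by
      rwa [eval_reg hI.r13] at htest
    obtain ⟨ρ, rfl⟩ := Nat.exists_eq_succ_of_ne_zero hρ
    refine wp_mono (relevel_step hp hχ hv hℓ hi' hne hsp hI) ?_
    rintro s'' t ⟨⟨κ', θ', hI'⟩, ht⟩
    refine ⟨_, ⟨ρ, κ', θ', rfl, hI'⟩, ?_⟩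
    have h1 : 345 * (p.k + 1) * ρ.succ = 345 * (p.k + 1) * ρ + 345 * (p.k + 1) := by
      rw [Nat.succ_eq_add_one]; ring
    rw [h1]
    simp only [Expr.cost]
    omega
  · rintro m s' t ⟨ρ, κ, θ, rfl, hI⟩ htest ht
    have hρ : ρ = 0 := by
      rwa [eval_reg hI.r13] at htest
    subst hρ
    apply wp_setCell (eval_reg hI.r10) (eval_reg hI.r11)
    have hdone : ∀ w, χ v w ≠ 0 → κ v w = ℓ v → ℓ w < i' := by
      intro w hw hκ
      have hmem : χ v w - 1 ∈ slotSet p χ κ v (ℓ v) :=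
        hχ.mem_slotSet.2 ⟨w, by omega, Or.inr hκ⟩
      refine hI.done _ hmem ?_ w (by omega)
      by_contra hcon
      have := hI.card
      rw [Finset.card_eq_zero] at this
      have h1 : χ v w - 1 ∈ (slotSet p χ κ v (ℓ v)).filter (· < θ) :=
        Finset.mem_filter.2 ⟨hmem, by omega⟩
      rw [this] at h1
      simp at h1
    have hkey : ∀ w, χ v w ≠ 0 → κ v w = min i' (ℓ w) := by
      intro w hw
      rcases hI.own w hw with h | ⟨h, h', _⟩
      · by_cases hle : ℓ v ≤ ℓ w
        · have h1 : κ v w = ℓ v := by rw [h, minKey]; omega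
          have h2 := hdone w hw h1
          omega
        · rw [h, minKey]
          omega
      · omega
    have hkey' : ∀ x y, χ x y ≠ 0 → κ x y = minKey (Function.update ℓ v i') x y := by
      intro x y hxy
      have hxney : x ≠ y := by
        rintro rfl
        exact hxy (hχ.irrefl x)
      by_cases hx : x = v
      · subst hx
        rw [hkey y hxy, minKey, Function.update_self, Function.update_of_ne (Ne.symm hxney)]
      · by_cases hy : y = v
        · subst hy
          rw [hI.symm, hkey x (by rwa [hχ.symm]), minKey, Function.update_self,
            Function.update_of_ne hxney, min_comm]
        · rw [hI.other x y hx hy, minKey, minKey, Function.update_of_ne hx,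
            Function.update_of_ne hy]
    have harr : ∀ a, a ≠ 2 → (s'.writeCell 2 v i').arr a = s'.arr a := fun a ha =>
      Store.arr_writeCell_of_ne _ _ _ ha
    refine ⟨?_, ?_, ?_, ?_, ?_, ?_, ?_⟩
    · have hR' := hI.rep.congr_key hkey'
      refine ⟨hR'.glob.frame (by simp), ?_, ?_, ?_, ?_⟩
      · rw [harr 0 (by omega)]
        exact hR'.col
      · rw [harr 1 (by omega)]
        exact hR'.own
      · intro x hx
        rw [Store.arr_writeCell, Function.update_apply]
        simp only [true_and]
        split_ifs
        · rfl
        · exact hR'.lev x hx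
      · intro x hx j hj
        rw [harr 3 (by omega)]
        exact hR'.tree x hx j hj
    · simpa using hI.le_sp
    · have := hI.sp_le
      simpa using this
    · rw [harr 5 (by omega)]
      exact hI.old
    · rw [harr 5 (by omega)]
      simpa using hI.new
    · intro w hw h1 h2
      rw [harr 5 (by omega)]
      rcases hI.own w hw with h | ⟨_, _, _, h⟩
      · have h3 : κ v w = ℓ v := by rw [h, minKey]; omega
        have := hdone w hw h3
        omega
      · simpa using h
    · simp only [rootE, slotE, Expr.cost] at ht ⊢
      nlinarith

/-! ### The decomposition into levels -/

/-- The condition on the level of `v`: at most `(4 + 1 / q) α` neighbors of level at least `ℓ v`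
(except on the highest level), and at least `(2 + 1 / (4 q)) α` neighbors of level at least
`ℓ v - 1` (except on the lowest level).  The upper threshold is close to twice the lower one, which
is what the potential needs; the lower one exceeds the average degree of a graph of arboricity `α`.
-/
def LevelOk (p : Par) (χ : ℕ → ℕ → ℕ) (ℓ : ℕ → ℕ) (v : ℕ) : Prop :=
  (ℓ v < p.L → p.q * upDeg p χ ℓ (ℓ v) v ≤ (4 * p.q + 1) * p.α) ∧
  (0 < ℓ v → (8 * p.q + 1) * p.α ≤ 4 * p.q * upDeg p χ ℓ (ℓ v - 1) v)

theorem upDeg_antitone (χ : ℕ → ℕ → ℕ) (ℓ : ℕ → ℕ) {i j : ℕ} (h : i ≤ j) (v : ℕ) :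
    upDeg p χ ℓ j v ≤ upDeg p χ ℓ i v := by
  apply Finset.card_le_card
  intro w hw
  simp only [upNbrs, Finset.mem_filter] at hw ⊢
  exact ⟨hw.1, hw.2.1, h.trans hw.2.2⟩

theorem upDeg_le (χ : ℕ → ℕ → ℕ) (ℓ : ℕ → ℕ) (i v : ℕ) : upDeg p χ ℓ i v ≤ p.n :=
  (Finset.card_filter_le _ _).trans (by simp)

/-- The contribution to the potential of a level below that of a vertex, where `D` is the number of
neighbors at or above this level.  The subtraction is truncated: only the amount by which `D` falls
short of the upper threshold `(4 + 1 / q) α` counts. -/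
def phi (p : Par) (D : ℕ) : ℤ := 24 * (((4 * p.q + 1) * p.α - p.q * D : ℕ) : ℤ) - D

/-- The contribution of `v` to the potential.  The first term, which the changes of levels do not
affect, makes it nonnegative. -/
def vpot (p : Par) (χ : ℕ → ℕ → ℕ) (ℓ : ℕ → ℕ) (v : ℕ) : ℤ :=
  p.L * upDeg p χ ℓ 0 v + ∑ i ∈ Finset.range (ℓ v), phi p (upDeg p χ ℓ i v)

/-- The potential of the decomposition.  It pays for the changes of levels. -/
def pot (p : Par) (χ : ℕ → ℕ → ℕ) (ℓ : ℕ → ℕ) : ℤ := ∑ v ∈ Finset.range p.n, vpot p χ ℓ v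

theorem phi_antitone {D D' : ℕ} (h : D ≤ D') : phi p D' ≤ phi p D := by
  unfold phi
  have : p.q * D ≤ p.q * D' := Nat.mul_le_mul_left _ h
  omega

theorem phi_le_succ {D D' : ℕ} (h : D ≤ D' + 1) (h' : D' ≤ D + 1) :
    phi p D' ≤ phi p D + (24 * p.q + 1) := by
  unfold phi
  have h1 : p.q * D ≤ p.q * (D' + 1) := Nat.mul_le_mul_left _ h
  rw [mul_add] at h1
  omega

theorem phi_le (D : ℕ) : phi p D ≤ 24 * ((4 * p.q + 1) * p.α : ℕ) := by
  unfold phi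
  omega

theorem vpot_nonneg (χ : ℕ → ℕ → ℕ) {ℓ : ℕ → ℕ} {v : ℕ} (hℓ : ℓ v ≤ p.L) : 0 ≤ vpot p χ ℓ v := by
  have h1 : ∑ i ∈ Finset.range (ℓ v), (-(upDeg p χ ℓ 0 v : ℤ)) ≤
      ∑ i ∈ Finset.range (ℓ v), phi p (upDeg p χ ℓ i v) := by
    apply Finset.sum_le_sum
    intro i _
    have := upDeg_antitone (p := p) χ ℓ (Nat.zero_le i) v
    unfold phi
    omega
  rw [Finset.sum_const, Finset.card_range, nsmul_eq_mul] at h1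
  have h2 : ((ℓ v : ℕ) : ℤ) * upDeg p χ ℓ 0 v ≤ p.L * upDeg p χ ℓ 0 v := by
    exact_mod_cast Nat.mul_le_mul_right _ hℓ
  unfold vpot
  linarith

theorem pot_nonneg (χ : ℕ → ℕ → ℕ) {ℓ : ℕ → ℕ} (hℓ : ∀ v, ℓ v ≤ p.L) : 0 ≤ pot p χ ℓ :=
  Finset.sum_nonneg fun v _ => vpot_nonneg χ (hℓ v)

theorem pot_le (χ : ℕ → ℕ → ℕ) {ℓ : ℕ → ℕ} (hℓ : ∀ v, ℓ v ≤ p.L) :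
    pot p χ ℓ ≤ (p.n * (p.L * p.n + p.L * (24 * ((4 * p.q + 1) * p.α))) : ℕ) := by
  have h1 : ∀ v ∈ Finset.range p.n, vpot p χ ℓ v ≤
      ((p.L * p.n + p.L * (24 * ((4 * p.q + 1) * p.α)) : ℕ) : ℤ) := by
    intro v _
    unfold vpot
    rw [Nat.cast_add]
    apply add_le_add
    · exact_mod_cast Nat.mul_le_mul_left _ (upDeg_le _ _ _ _)
    · have h2 := Finset.sum_le_card_nsmul (Finset.range (ℓ v))
        (fun i => phi p (upDeg p χ ℓ i v)) _ (fun i _ => phi_le (p := p) (upDeg p χ ℓ i v))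
      rw [Finset.card_range, nsmul_eq_mul] at h2
      refine h2.trans ?_
      exact_mod_cast Nat.mul_le_mul_right _ (hℓ v)
  have := Finset.sum_le_card_nsmul _ _ _ h1
  rw [Finset.card_range, nsmul_eq_mul] at this
  exact_mod_cast this

/-- The potential when the degrees change by at most one, at the endpoints of one edge only. -/
theorem pot_le_of_close {χ χ' : ℕ → ℕ → ℕ} {ℓ : ℕ → ℕ} (hℓ : ∀ v, ℓ v ≤ p.L) {a b : ℕ}
    (hsame : ∀ v i, v ≠ a → v ≠ b → upDeg p χ' ℓ i v = upDeg p χ ℓ i v)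
    (hle : ∀ v i, upDeg p χ ℓ i v ≤ upDeg p χ' ℓ i v + 1)
    (hle' : ∀ v i, upDeg p χ' ℓ i v ≤ upDeg p χ ℓ i v + 1) :
    pot p χ' ℓ ≤ pot p χ ℓ + (2 * p.L * (24 * p.q + 2) : ℕ) := by
  have h1 : ∀ v ∈ Finset.range p.n, vpot p χ' ℓ v ≤ vpot p χ ℓ v +
      ((if v = a then ((p.L * (24 * p.q + 2) : ℕ) : ℤ) else 0) +
        (if v = b then ((p.L * (24 * p.q + 2) : ℕ) : ℤ) else 0)) := by
    intro v _
    by_cases hv : v ≠ a ∧ v ≠ b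
    · rw [if_neg hv.1, if_neg hv.2]
      unfold vpot
      simp only [hsame v _ hv.1 hv.2]
      simp
    · have h2 : ((p.L * (24 * p.q + 2) : ℕ) : ℤ) ≤
          (if v = a then ((p.L * (24 * p.q + 2) : ℕ) : ℤ) else 0) +
          (if v = b then ((p.L * (24 * p.q + 2) : ℕ) : ℤ) else 0) := by
        split_ifs <;> omega
      refine le_trans ?_ (add_le_add_right h2 _)
      unfold vpot
      have h3 : ∑ i ∈ Finset.range (ℓ v), phi p (upDeg p χ' ℓ i v) ≤
          ∑ i ∈ Finset.range (ℓ v), (phi p (upDeg p χ ℓ i v) + (24 * p.q + 1)) :=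
        Finset.sum_le_sum fun i _ => phi_le_succ (hle v i) (hle' v i)
      rw [Finset.sum_add_distrib, Finset.sum_const, Finset.card_range, nsmul_eq_mul] at h3
      have h4 : (ℓ v : ℤ) * (24 * p.q + 1) ≤ p.L * (24 * p.q + 1) := by
        exact_mod_cast Nat.mul_le_mul_right _ (hℓ v)
      have h5 : (p.L : ℤ) * upDeg p χ' ℓ 0 v ≤ p.L * (upDeg p χ ℓ 0 v + 1) := by
        exact_mod_cast Nat.mul_le_mul_left _ (hle' v 0)
      push_cast
      linarith
  refine (Finset.sum_le_sum h1).trans ?_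
  rw [Finset.sum_add_distrib, Finset.sum_add_distrib, Finset.sum_ite_eq', Finset.sum_ite_eq']
  unfold pot
  have h6 : (0 : ℤ) ≤ ((p.L * (24 * p.q + 2) : ℕ) : ℤ) := by positivity
  have h7 : ((2 * p.L * (24 * p.q + 2) : ℕ) : ℤ) = 2 * ((p.L * (24 * p.q + 2) : ℕ) : ℤ) := by
    push_cast; ring
  rw [h7]
  split_ifs <;> linarith

/-- The neighborhoods in a graph that gains or loses the edge `ab`. -/
theorem upDeg_close {χ χ' : ℕ → ℕ → ℕ} {a b : ℕ} (hab : a ≠ b)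
    (h : ∀ u v, χ' u v ≠ 0 ↔ χ u v ≠ 0 ∨ ((u = a ∧ v = b) ∨ (u = b ∧ v = a))) (ℓ : ℕ → ℕ) :
    (∀ v i, v ≠ a → v ≠ b → upDeg p χ' ℓ i v = upDeg p χ ℓ i v) ∧
    (∀ v i, upDeg p χ ℓ i v ≤ upDeg p χ' ℓ i v) ∧
    (∀ v i, upDeg p χ' ℓ i v ≤ upDeg p χ ℓ i v + 1) := by
  refine ⟨?_, ?_, ?_⟩
  · intro v i ha hb
    unfold upDeg upNbrs
    congr 1
    apply Finset.filter_congr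
    intro w _
    rw [h]
    tauto
  · intro v i
    apply Finset.card_le_card
    intro w hw
    simp only [upNbrs, Finset.mem_filter] at hw ⊢
    exact ⟨hw.1, (h v w).2 (Or.inl hw.2.1), hw.2.2⟩
  · intro v i
    have hsub : upNbrs p χ' ℓ i v ⊆ insert (if v = a then b else a) (upNbrs p χ ℓ i v) := by
      intro w hw
      simp only [upNbrs, Finset.mem_filter, Finset.mem_insert] at hw ⊢
      rcases (h v w).1 hw.2.1 with h1 | ⟨rfl, rfl⟩ | ⟨rfl, rfl⟩
      · exact Or.inr ⟨hw.1, h1, hw.2.2⟩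
      · exact Or.inl (by simp)
      · exact Or.inl (by simp [hab.symm])
    exact (Finset.card_le_card hsub).trans (Finset.card_insert_le _ _)

theorem upDeg_congr {χ χ' : ℕ → ℕ → ℕ} {ℓ ℓ' : ℕ → ℕ} {i v : ℕ}
    (h : ∀ w, χ' v w ≠ 0 ∧ i ≤ ℓ' w ↔ χ v w ≠ 0 ∧ i ≤ ℓ w) :
    upDeg p χ' ℓ' i v = upDeg p χ ℓ i v := by
  unfold upDeg upNbrs
  simp only [h]

/-- A vertex whose condition breaks when the level of `v` changes is a neighbor of `v` whose level
is at least the old and the new level of `v`. -/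
theorem LevelOk.update {χ : ℕ → ℕ → ℕ} {ℓ : ℕ → ℕ} (hχ : IsCol p χ) {v w i' : ℕ} (hwv : w ≠ v)
    (hi' : i' = ℓ v + 1 ∨ ℓ v = i' + 1) (hw : LevelOk p χ ℓ w)
    (hnot : ¬ (χ v w ≠ 0 ∧ ℓ v ≤ ℓ w ∧ i' ≤ ℓ w)) :
    LevelOk p χ (Function.update ℓ v i') w := by
  have key : ∀ j ≤ ℓ w, upDeg p χ (Function.update ℓ v i') j w = upDeg p χ ℓ j w := by
    intro j hj
    apply upDeg_congr
    intro x
    by_cases hx : x = v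
    · subst hx
      rw [Function.update_self]
      rw [hχ.symm] at hnot
      apply and_congr_right
      intro h
      omega
    · rw [Function.update_of_ne hx]
  unfold LevelOk
  rw [Function.update_of_ne hwv, key _ le_rfl, key _ (Nat.sub_le _ _)]
  exact hw

theorem upDeg_update_self {χ : ℕ → ℕ → ℕ} (hχ : IsCol p χ) (ℓ : ℕ → ℕ) (v i' j : ℕ) :
    upDeg p χ (Function.update ℓ v i') j v = upDeg p χ ℓ j v := by
  apply upDeg_congr
  intro w
  by_cases hw : w = v
  · subst hw
    simp [hχ.irrefl]
  · rw [Function.update_of_ne hw]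

/-- Moving a vertex with many neighbors up lowers the potential: its new term is `-D`, as the
truncated difference vanishes, and the terms of its neighbors do not grow. -/
theorem pot_promote {χ : ℕ → ℕ → ℕ} (hχ : IsCol p χ) {ℓ : ℕ → ℕ} {v : ℕ} (hv : v < p.n)
    (h : (4 * p.q + 1) * p.α < p.q * upDeg p χ ℓ (ℓ v) v) :
    pot p χ (Function.update ℓ v (ℓ v + 1)) + upDeg p χ ℓ (ℓ v) v ≤ pot p χ ℓ := by
  have h1 : ∀ w ∈ Finset.range p.n, vpot p χ (Function.update ℓ v (ℓ v + 1)) w +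
      (if w = v then (upDeg p χ ℓ (ℓ v) v : ℤ) else 0) ≤ vpot p χ ℓ w := by
    intro w _
    by_cases hw : w = v
    · subst hw
      unfold vpot
      simp only [upDeg_update_self hχ, Function.update_self, if_true]
      rw [Finset.sum_range_succ]
      have : phi p (upDeg p χ ℓ (ℓ w) w) = -(upDeg p χ ℓ (ℓ w) w : ℤ) := by
        unfold phi
        rw [Nat.sub_eq_zero_of_le h.le]
        simp
      rw [this]
      linarith
    · rw [if_neg hw, add_zero]
      unfold vpot
      rw [Function.update_of_ne hw]
      have h0 : upDeg p χ (Function.update ℓ v (ℓ v + 1)) 0 w = upDeg p χ ℓ 0 w :=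
        upDeg_congr (by simp)
      rw [h0]
      gcongr with i _
      apply phi_antitone
      apply Finset.card_le_card
      intro x hx
      simp only [upNbrs, Finset.mem_filter] at hx ⊢
      refine ⟨hx.1, hx.2.1, hx.2.2.trans ?_⟩
      rw [Function.update_apply]
      split_ifs with h2
      · subst h2; omega
      · rfl
  have h2 := Finset.sum_le_sum h1
  rw [Finset.sum_add_distrib, Finset.sum_ite_eq', if_pos (Finset.mem_range.2 hv)] at h2
  exact h2

/-- Moving a vertex with few neighbors down lowers the potential.  Of the neighbors, at most the `D`
ones at or above the new level gain, each at most `24 q + 1`.  The vertex loses a term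
`24 ((4 q + 1) α - q D) - D`; as `D` is at most about half of the upper threshold, this outweighs
the gains by more than `D`. -/
theorem pot_demote (hp : p.Ok) {χ : ℕ → ℕ → ℕ} (hχ : IsCol p χ) {ℓ : ℕ → ℕ} {v i : ℕ}
    (hv : v < p.n) (hi : ℓ v = i + 1)
    (h : 4 * p.q * upDeg p χ ℓ i v < (8 * p.q + 1) * p.α) :
    pot p χ (Function.update ℓ v i) + upDeg p χ ℓ i v + 1 ≤ pot p χ ℓ := by
  set ℓ' := Function.update ℓ v i with hℓ'
  set D := upDeg p χ ℓ i v with hD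
  have h1 : ∀ w ∈ Finset.range p.n, vpot p χ ℓ' w + (if w = v then phi p D else 0) ≤
      vpot p χ ℓ w + (if w ∈ upNbrs p χ ℓ i v then (24 * p.q + 1 : ℤ) else 0) := by
    intro w _
    by_cases hw : w = v
    · subst hw
      have h2 : (0 : ℤ) ≤ if w ∈ upNbrs p χ ℓ i w then (24 * p.q + 1 : ℤ) else 0 := by
        split_ifs <;> positivity
      unfold vpot
      simp only [hℓ', upDeg_update_self hχ, Function.update_self, if_true]
      rw [hi, Finset.sum_range_succ, ← hD]
      linarith
    · rw [if_neg hw, add_zero]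
      unfold vpot
      have h0 : upDeg p χ ℓ' 0 w = upDeg p χ ℓ 0 w := upDeg_congr (by simp)
      rw [hℓ', Function.update_of_ne hw, ← hℓ', h0, add_assoc]
      apply add_le_add_right
      have hsame : ∀ j, j ≠ i + 1 → upDeg p χ ℓ' j w = upDeg p χ ℓ j w := by
        intro j hj
        apply upDeg_congr
        intro x
        apply and_congr_right
        intro _
        rw [hℓ', Function.update_apply]
        split_ifs with h3
        · subst h3; omega
        · rfl
      by_cases hmem : χ w v ≠ 0 ∧ i + 1 < ℓ w
      · rw [if_pos (hχ.mem_upNbrs.2 ⟨by rw [hχ.symm]; exact hmem.1, by omega⟩)]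
        have h4 : i + 1 ∈ Finset.range (ℓ w) := Finset.mem_range.2 hmem.2
        rw [← Finset.add_sum_erase _ _ h4, ← Finset.add_sum_erase _ _ h4]
        have h5 : ∑ j ∈ (Finset.range (ℓ w)).erase (i + 1), phi p (upDeg p χ ℓ' j w) =
            ∑ j ∈ (Finset.range (ℓ w)).erase (i + 1), phi p (upDeg p χ ℓ j w) :=
          Finset.sum_congr rfl fun j hj => by rw [hsame j (Finset.ne_of_mem_erase hj)]
        rw [h5]
        have h6 : phi p (upDeg p χ ℓ' (i + 1) w) ≤
            phi p (upDeg p χ ℓ (i + 1) w) + (24 * p.q + 1) := by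
          have hsub : upNbrs p χ ℓ' (i + 1) w ⊆ upNbrs p χ ℓ (i + 1) w := by
            intro x hx
            rw [hχ.mem_upNbrs] at hx ⊢
            refine ⟨hx.1, hx.2.trans ?_⟩
            rw [hℓ', Function.update_apply]
            split_ifs with h7
            · subst h7; omega
            · rfl
          have hsub' : upNbrs p χ ℓ (i + 1) w ⊆ insert v (upNbrs p χ ℓ' (i + 1) w) := by
            intro x hx
            rw [Finset.mem_insert, hχ.mem_upNbrs]
            rw [hχ.mem_upNbrs] at hx
            by_cases hxv : x = v
            · exact Or.inl hxv
            · rw [hℓ', Function.update_of_ne hxv]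
              exact Or.inr hx
          have h8 := Finset.card_le_card hsub
          have h9 := (Finset.card_le_card hsub').trans (Finset.card_insert_le _ _)
          exact phi_le_succ h9 (h8.trans (Nat.le_succ _))
        linarith
      · have h10 : (0 : ℤ) ≤ if w ∈ upNbrs p χ ℓ i v then (24 * p.q + 1 : ℤ) else 0 := by
          split_ifs <;> positivity
        have h11 : ∑ j ∈ Finset.range (ℓ w), phi p (upDeg p χ ℓ' j w) =
            ∑ j ∈ Finset.range (ℓ w), phi p (upDeg p χ ℓ j w) := by
          apply Finset.sum_congr rfl
          intro j hj
          congr 1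
          by_cases hji : j = i + 1
          · subst hji
            have hwv : ¬ χ w v ≠ 0 := fun hcon => hmem ⟨hcon, Finset.mem_range.1 hj⟩
            apply upDeg_congr
            intro x
            by_cases hxv : x = v
            · subst hxv; tauto
            · rw [hℓ', Function.update_of_ne hxv]
          · exact hsame j hji
        rw [h11]
        linarith
  have h2 := Finset.sum_le_sum h1
  rw [Finset.sum_add_distrib, Finset.sum_add_distrib, Finset.sum_ite_eq',
    if_pos (Finset.mem_range.2 hv), Finset.sum_ite_mem] at h2
  have h3 : Finset.range p.n ∩ upNbrs p χ ℓ i v = upNbrs p χ ℓ i v :=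
    Finset.inter_eq_right.2 (Finset.filter_subset _ _)
  rw [h3, Finset.sum_const, nsmul_eq_mul] at h2
  have h4 : ((upNbrs p χ ℓ i v).card : ℤ) = D := rfl
  rw [h4] at h2
  have hq := hp.q_pos
  have hα := hp.α_pos
  have h5 : 4 * D < 9 * p.α := by
    have h6 : p.q * (4 * D) < p.q * (9 * p.α) := by
      calc p.q * (4 * D) = 4 * p.q * D := by ring
        _ < (8 * p.q + 1) * p.α := h
        _ ≤ (8 * p.q + p.q) * p.α := Nat.mul_le_mul_right _ (by omega)
        _ = p.q * (9 * p.α) := by ring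
    exact lt_of_mul_lt_mul_left h6 (Nat.zero_le _)
  have h7 : phi p D = 24 * (((4 * p.q + 1) * p.α : ℕ) : ℤ) - 24 * ((p.q * D : ℕ) : ℤ) - D := by
    unfold phi
    have : p.q * D ≤ (4 * p.q + 1) * p.α := by nlinarith
    omega
  unfold pot
  rw [h7] at h2
  push_cast at h2 ⊢
  zify at h h5 hα hq
  nlinarith

/-! ### The highest level is empty -/

/-- Twice the number of the edges inside `S`, expressed through degrees, in a graph of bounded
arboricity. -/
theorem sum_inner_degree_le {V : Type*} [Fintype V] [DecidableEq V] {G : SimpleGraph V}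
    [DecidableRel G.Adj] {α : ℕ} (h : DynGraph.ArboricityLE G α) (S : Finset V) :
    ∑ v ∈ S, (S.filter fun w => G.Adj v w).card ≤ 2 * α * S.card := by
  by_cases hS : 2 ≤ S.card
  · have h1 := h S hS
    have hpos : (0 : ℝ) < (S.card : ℝ) - 1 := by
      have : (2 : ℝ) ≤ S.card := by exact_mod_cast hS
      linarith
    rw [Nat.ceil_le, div_le_iff₀ hpos] at h1
    have h2 := (G.induce (S : Set V)).sum_degrees_eq_twice_card_edges
    have h3 : ((G.induce (S : Set V)).edgeSet.ncard) = (G.induce (S : Set V)).edgeFinset.card := by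
      rw [← SimpleGraph.coe_edgeFinset, Set.ncard_coe_finset]
    have h4 : ∑ v ∈ S, (S.filter fun w => G.Adj v w).card =
        ∑ v : (S : Set V), (G.induce (S : Set V)).degree v := by
      rw [← Finset.sum_coe_sort S]
      apply Finset.sum_congr rfl
      rintro ⟨v, hv⟩ _
      rw [← SimpleGraph.card_neighborFinset_eq_degree]
      symm
      apply Finset.card_bij fun (w : (S : Set V)) _ => (w : V)
      · intro w hw
        rw [SimpleGraph.mem_neighborFinset] at hw
        exact Finset.mem_filter.2 ⟨w.2, hw⟩
      · intro w _ w' _ hww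
        exact Subtype.ext hww
      · intro w hw
        rw [Finset.mem_filter] at hw
        exact ⟨⟨w, hw.1⟩, by rw [SimpleGraph.mem_neighborFinset]; exact hw.2, rfl⟩
    rw [h4, h2, ← h3]
    have h5 : ((G.induce (S : Set V)).edgeSet.ncard : ℝ) ≤ α * S.card := by
      have : (0 : ℝ) ≤ α := by positivity
      nlinarith
    have h6 : (G.induce (S : Set V)).edgeSet.ncard ≤ α * S.card := by exact_mod_cast h5
    linarith
  · have h1 : ∀ v ∈ S, (S.filter fun w => G.Adj v w).card = 0 := by
      intro v hv
      rw [Finset.card_eq_zero, Finset.filter_eq_empty_iff]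
      intro w hw hadj
      exact hadj.ne (Finset.card_le_one.1 (by omega) v hv w hw)
    rw [Finset.sum_eq_zero h1]
    exact Nat.zero_le _

/-- `χ` colors exactly the edges of `G`. -/
def Supports {n : ℕ} (χ : ℕ → ℕ → ℕ) (G : SimpleGraph (Fin n)) : Prop :=
  ∀ u v : Fin n, χ u v ≠ 0 ↔ G.Adj u v

/-- The vertices of level at least `i`. -/
def levelSet (n : ℕ) (ℓ : ℕ → ℕ) (i : ℕ) : Finset (Fin n) :=
  Finset.univ.filter fun v => i ≤ ℓ v

open Classical in
theorem upDeg_eq_card {χ : ℕ → ℕ → ℕ} {G : SimpleGraph (Fin p.n)} (hG : Supports χ G)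
    (ℓ : ℕ → ℕ) (i : ℕ) (v : Fin p.n) :
    upDeg p χ ℓ i v = ((levelSet p.n ℓ i).filter fun w => G.Adj v w).card := by
  symm
  apply Finset.card_bij fun (w : Fin p.n) _ => (w : ℕ)
  · intro w hw
    simp only [levelSet, Finset.mem_filter, Finset.mem_univ, true_and] at hw
    simp only [upNbrs, Finset.mem_filter, Finset.mem_range]
    exact ⟨w.2, (hG v w).2 hw.2, hw.1⟩
  · intro w _ w' _ hww
    exact Fin.ext hww
  · intro w hw
    simp only [upNbrs, Finset.mem_filter, Finset.mem_range] at hw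
    refine ⟨⟨w, hw.1⟩, ?_, rfl⟩
    simp only [levelSet, Finset.mem_filter, Finset.mem_univ, true_and]
    exact ⟨hw.2.2, (hG v ⟨w, hw.1⟩).1 hw.2.1⟩

/-- By double counting, the sizes of the level sets shrink by a constant factor. -/
theorem card_levelSet_succ (hp : p.Ok) {χ : ℕ → ℕ → ℕ} {G : SimpleGraph (Fin p.n)}
    (hG : Supports χ G) (hα : DynGraph.ArboricityLE G p.α) {ℓ : ℕ → ℕ}
    (hok : ∀ v < p.n, LevelOk p χ ℓ v) (i : ℕ) :
    (8 * p.q + 1) * (levelSet p.n ℓ (i + 1)).card ≤ 8 * p.q * (levelSet p.n ℓ i).card := by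
  classical
  have h1 := sum_inner_degree_le hα (levelSet p.n ℓ i)
  have hsub : levelSet p.n ℓ (i + 1) ⊆ levelSet p.n ℓ i := by
    intro v hv
    simp only [levelSet, Finset.mem_filter, Finset.mem_univ, true_and] at hv ⊢
    omega
  have h2 : ∑ v ∈ levelSet p.n ℓ (i + 1), upDeg p χ ℓ i v ≤
      ∑ v ∈ levelSet p.n ℓ i, ((levelSet p.n ℓ i).filter fun w => G.Adj v w).card := by
    rw [Finset.sum_congr rfl fun (v : Fin p.n) _ => upDeg_eq_card hG ℓ i v]
    exact Finset.sum_le_sum_of_subset hsub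
  have h3 : (levelSet p.n ℓ (i + 1)).card * ((8 * p.q + 1) * p.α) ≤
      4 * p.q * ∑ v ∈ levelSet p.n ℓ (i + 1), upDeg p χ ℓ i v := by
    rw [Finset.mul_sum, ← smul_eq_mul]
    apply Finset.card_nsmul_le_sum
    intro v hv
    simp only [levelSet, Finset.mem_filter, Finset.mem_univ, true_and] at hv
    refine ((hok v v.2).2 (by omega)).trans ?_
    exact Nat.mul_le_mul_left _ (upDeg_antitone χ ℓ (by omega) v)
  have h4 : (8 * p.q + 1) * (levelSet p.n ℓ (i + 1)).card * p.α ≤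
      8 * p.q * (levelSet p.n ℓ i).card * p.α := by
    calc (8 * p.q + 1) * (levelSet p.n ℓ (i + 1)).card * p.α
        = (levelSet p.n ℓ (i + 1)).card * ((8 * p.q + 1) * p.α) := by ring
      _ ≤ 4 * p.q * (2 * p.α * (levelSet p.n ℓ i).card) :=
          h3.trans (Nat.mul_le_mul_left _ (h2.trans h1))
      _ = 8 * p.q * (levelSet p.n ℓ i).card * p.α := by ring
  exact le_of_mul_le_mul_right h4 hp.α_pos

/-- Bernoulli's inequality for `(1 + 1 / m) ^ m`, without denominators. -/
theorem two_mul_pow_le (m : ℕ) (hm : 0 < m) : 2 * m ^ m ≤ (m + 1) ^ m := by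
  have h := one_add_mul_le_pow (a := (1 / m : ℚ)) (by
    have : (0 : ℚ) ≤ 1 / m := by positivity
    linarith) m
  have hm' : (m : ℚ) ≠ 0 := by positivity
  have h1 : (2 : ℚ) ≤ (1 + 1 / m) ^ m := by
    refine le_trans ?_ h
    field_simp
    norm_num
  have h2 : (1 + 1 / (m : ℚ)) ^ m * (m : ℚ) ^ m = (m + 1) ^ m := by
    rw [← mul_pow]
    congr 1
    field_simp
  have h3 : (2 : ℚ) * (m : ℚ) ^ m ≤ ((m : ℚ) + 1) ^ m := by
    rw [← h2]
    gcongr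
  exact_mod_cast h3

/-- If all level conditions hold, then no vertex has the highest level: the level sets shrink
geometrically, from `n` vertices to less than one.  Hence the upper bound in `LevelOk` holds for all
vertices. -/
theorem level_lt_top (hp : p.Ok) {χ : ℕ → ℕ → ℕ} {G : SimpleGraph (Fin p.n)}
    (hG : Supports χ G) (hα : DynGraph.ArboricityLE G p.α) {ℓ : ℕ → ℕ}
    (hok : ∀ v < p.n, LevelOk p χ ℓ v) {v : ℕ} (hv : v < p.n) : ℓ v < p.L := by
  have h1 : ∀ i, (8 * p.q + 1) ^ i * (levelSet p.n ℓ i).card ≤ (8 * p.q) ^ i * p.n := by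
    intro i
    induction i with
    | zero => simp [levelSet]
    | succ i ih =>
      calc (8 * p.q + 1) ^ (i + 1) * (levelSet p.n ℓ (i + 1)).card
          = (8 * p.q + 1) ^ i * ((8 * p.q + 1) * (levelSet p.n ℓ (i + 1)).card) := by ring
        _ ≤ (8 * p.q + 1) ^ i * (8 * p.q * (levelSet p.n ℓ i).card) :=
            Nat.mul_le_mul_left _ (card_levelSet_succ hp hG hα hok i)
        _ = 8 * p.q * ((8 * p.q + 1) ^ i * (levelSet p.n ℓ i).card) := by ring
        _ ≤ 8 * p.q * ((8 * p.q) ^ i * p.n) := Nat.mul_le_mul_left _ ih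
        _ = (8 * p.q) ^ (i + 1) * p.n := by ring
  have hm : 0 < 8 * p.q := by have := hp.q_pos; omega
  have h2 : 2 ^ p.k * (8 * p.q) ^ p.L ≤ (8 * p.q + 1) ^ p.L := by
    rw [Par.L, pow_mul _ (8 * p.q), pow_mul _ (8 * p.q), ← mul_pow]
    exact Nat.pow_le_pow_left (two_mul_pow_le _ hm) _
  have h3 : 2 ^ p.k * (levelSet p.n ℓ p.L).card ≤ p.n := by
    have h4 : (8 * p.q) ^ p.L * (2 ^ p.k * (levelSet p.n ℓ p.L).card) ≤ (8 * p.q) ^ p.L * p.n := by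
      calc (8 * p.q) ^ p.L * (2 ^ p.k * (levelSet p.n ℓ p.L).card)
          = 2 ^ p.k * (8 * p.q) ^ p.L * (levelSet p.n ℓ p.L).card := by ring
        _ ≤ (8 * p.q + 1) ^ p.L * (levelSet p.n ℓ p.L).card := Nat.mul_le_mul_right _ h2
        _ ≤ _ := h1 _
    exact le_of_mul_le_mul_left h4 (by positivity)
  by_contra hcon
  have hmem : (⟨v, hv⟩ : Fin p.n) ∈ levelSet p.n ℓ p.L := by
    simp only [levelSet, Finset.mem_filter, Finset.mem_univ, true_and]
    omega
  have h5 := Finset.card_pos.2 ⟨_, hmem⟩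
  have h6 := p.two_n_le
  nlinarith

/-! ### Restoring the level conditions -/

/-- The program that computes, in register `11`, the level to which the vertex in register `10` is
to be moved; register `12` holds its present level. -/
def chooseLevel : Cmd :=
  12 ⟵ .cell 2 (.reg 10) ;;
  11 ⟵ .reg 12 ;;
  16 ⟵ rootE (.reg 10) (.reg 12) ;;
  .cond ((.lit 4 *ₑ .reg 2 +ₑ .lit 1) *ₑ .reg 1 <ₑ .reg 2 *ₑ .reg 16)
    (.cond (.reg 12 <ₑ .reg 7) (11 ⟵ .reg 12 +ₑ .lit 1) .skip)
    (.cond (.reg 12)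
      (16 ⟵ .reg 16 +ₑ rootE (.reg 10) (.reg 12 -ₑ .lit 1) ;;
        .cond (.lit 4 *ₑ .reg 2 *ₑ .reg 16 <ₑ (.lit 8 *ₑ .reg 2 +ₑ .lit 1) *ₑ .reg 1)
          (11 ⟵ .reg 12 -ₑ .lit 1) .skip)
      .skip)

theorem Par.Ok.small (hp : p.Ok) : 8 * p.q + 1 < p.W ∧ (8 * p.q + 1) * p.α < p.W ∧
    (4 * p.q + 1) * p.α < p.W ∧ (∀ D ≤ 2 * p.n, 4 * p.q * D < p.W) ∧ p.L + 1 < p.W ∧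
    2 * p.n < p.W := by
  have h1 := hp.cmp_lt
  have h2 := hp.α_pos
  have h3 : (8 * p.q + 1) * 1 ≤ (8 * p.q + 1) * p.α := Nat.mul_le_mul_left _ h2
  have h4 : (4 * p.q + 1) * p.α ≤ (8 * p.q + 1) * p.α := Nat.mul_le_mul_right _ (by omega)
  have h5 := hp.slots
  have h6 : 1 * (p.L + 2) ≤ p.n * (p.L + 2) := Nat.mul_le_mul_right _ hp.n_pos
  have h7 : p.n * 2 ≤ p.n * (p.L + 2) := Nat.mul_le_mul_left _ (by omega)
  refine ⟨by omega, by omega, by omega, ?_, by omega, by omega⟩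
  intro D hD
  have h8 : 4 * p.q * D ≤ 4 * p.q * (2 * p.n) := Nat.mul_le_mul_left _ hD
  omega

theorem chooseLevel_spec (hp : p.Ok) {s : Store} {χ : ℕ → ℕ → ℕ} {ℓ : ℕ → ℕ} {v : ℕ}
    (hR : Rep p s χ (minKey ℓ) ℓ) (hχ : IsCol p χ) (hv : v < p.n) (hℓ : ∀ v, ℓ v ≤ p.L)
    (h10 : s.reg 10 = v) :
    wp p.W chooseLevel s fun s' t =>
      (∀ r < 11, s'.reg r = s.reg r) ∧ s'.arr = s.arr ∧ s'.reg 12 = ℓ v ∧ t ≤ 120 ∧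
      ((s'.reg 11 = ℓ v ∧ LevelOk p χ ℓ v) ∨
        (s'.reg 11 = ℓ v + 1 ∧ ℓ v < p.L ∧
          (4 * p.q + 1) * p.α < p.q * upDeg p χ ℓ (ℓ v) v) ∨
        (ℓ v = s'.reg 11 + 1 ∧
          4 * p.q * upDeg p χ ℓ (s'.reg 11) v < (8 * p.q + 1) * p.α)) := by
  have h8 := hp.eight
  obtain ⟨hW1, hW2, hW3, hW4, hW5, hW6⟩ := hp.small
  have hLv := hℓ v
  have hg := hR.glob
  set D := upDeg p χ ℓ (ℓ v) v with hD
  have hDn : D ≤ p.n := upDeg_le _ _ _ _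
  have hq4 : 4 * p.q ≤ 8 * p.q + 1 := by omega
  have hqD : p.q * D ≤ 4 * p.q * D := Nat.mul_le_mul_right _ (by omega)
  have hqDW := hW4 D (by omega)
  apply wp_seq
  apply wp_setReg (x := ℓ v) (eval_cell (eval_reg h10) (hR.lev v hv))
  apply wp_seq
  apply wp_setReg (x := ℓ v) (eval_reg (by simp))
  apply wp_seq
  apply wp_setReg (x := D) (by
    rw [hD, ← hχ.card_slotSet_up hLv]
    refine eval_rootE hp hR (fun r hr => ?_) (by simp) (eval_reg ?_) (eval_reg ?_) hv (by omega)
    · simp [show r ≠ 12 by omega, show r ≠ 11 by omega]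
    · simp [h10]
    · simp)
  set s₁ := ((s.writeReg 12 (ℓ v)).writeReg 11 (ℓ v)).writeReg 16 D with hs₁
  have hreg₁ : ∀ r < 11, s₁.reg r = s.reg r := by
    intro r hr
    simp [hs₁, show r ≠ 12 by omega, show r ≠ 11 by omega, show r ≠ 16 by omega]
  have harr₁ : s₁.arr = s.arr := by simp [hs₁]
  have h11 : s₁.reg 11 = ℓ v := by simp [hs₁]
  have h12 : s₁.reg 12 = ℓ v := by simp [hs₁]
  have h16 : s₁.reg 16 = D := by simp [hs₁]
  have hg₁ : Globals p s₁ := hg.frame fun r hr => hreg₁ r (by omega)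
  have hcost : (rootE (Expr.reg 10) (Expr.reg 12)).cost = 14 := rfl
  have hcost' : (rootE (Expr.reg 10) (.reg 12 -ₑ .lit 1)).cost = 16 := rfl
  have htest : ((.lit 4 *ₑ .reg 2 +ₑ .lit 1) *ₑ .reg 1 <ₑ .reg 2 *ₑ .reg 16 : Expr).eval p.W s₁ =
      if (4 * p.q + 1) * p.α < p.q * D then 1 else 0 :=
    eval_lt (eval_mul (eval_add (eval_mul (eval_lit (by omega)) (eval_reg hg₁.r2) (by omega))
      (eval_lit (by omega)) (by omega)) (eval_reg hg₁.r1) hW3)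
      (eval_mul (eval_reg hg₁.r2) (eval_reg h16) (by omega))
  apply wp_cond
  · intro hc
    have hlt : (4 * p.q + 1) * p.α < p.q * D := by
      by_contra hcon
      rw [htest, if_neg hcon] at hc
      exact hc rfl
    have htest' : (.reg 12 <ₑ .reg 7 : Expr).eval p.W s₁ = if ℓ v < p.L then 1 else 0 :=
      eval_lt (eval_reg h12) (eval_reg hg₁.r7)
    apply wp_cond
    · intro hc'
      have hlt' : ℓ v < p.L := by
        by_contra hcon
        rw [htest', if_neg hcon] at hc'
        exact hc' rfl
      apply wp_setReg (x := ℓ v + 1) (eval_add (eval_reg h12) (eval_lit (by omega)) (by omega))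
      refine ⟨?_, by simpa using harr₁, by simpa using h12, ?_,
        Or.inr (Or.inl ⟨by simp, hlt', hlt⟩)⟩
      · intro r hr
        simp [show r ≠ 11 by omega, hreg₁ r hr]
      · simp only [hcost, Expr.cost]
        omega
    · intro hc'
      have hlt' : ¬ ℓ v < p.L := by
        intro hcon
        rw [htest', if_pos hcon] at hc'
        omega
      apply wp_skip
      refine ⟨hreg₁, harr₁, h12, ?_, Or.inl ⟨h11, fun h => absurd h hlt', fun _ => ?_⟩⟩
      · simp only [hcost, Expr.cost]
        omega
      · have h1 : 4 * p.q * D ≤ 4 * p.q * upDeg p χ ℓ (ℓ v - 1) v :=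
          Nat.mul_le_mul_left _ (upDeg_antitone χ ℓ (Nat.sub_le _ _) v)
        nlinarith
  · intro hc
    have hle : p.q * D ≤ (4 * p.q + 1) * p.α := by
      by_contra hcon
      rw [htest, if_pos (by omega)] at hc
      omega
    apply wp_cond
    · intro hc'
      have hpos : 0 < ℓ v := by
        rw [eval_reg h12] at hc'
        omega
      set D' := upDeg p χ ℓ (ℓ v - 1) v with hD'
      have hsum := hχ.card_slotSet_pred hLv hpos
      have hD'n : D' ≤ p.n := upDeg_le _ _ _ _
      have hqD' := hW4 D' (by omega)
      apply wp_seq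
      apply wp_setReg (x := D') (by
        rw [hD', ← hsum]
        have hroot : (rootE (.reg 10) (.reg 12 -ₑ .lit 1)).eval p.W s₁ =
            (slotSet p χ (minKey ℓ) v (ℓ v - 1)).card :=
          eval_rootE hp hR (fun r hr => hreg₁ r (by omega)) (by rw [harr₁])
            (eval_reg (by rw [hreg₁ 10 (by omega), h10]))
            (eval_sub (eval_reg h12) (eval_lit (by omega))) hv (by omega)
        exact eval_add (eval_reg h16) hroot (by omega))
      have htest' : (.lit 4 *ₑ .reg 2 *ₑ .reg 16 <ₑ (.lit 8 *ₑ .reg 2 +ₑ .lit 1) *ₑ .reg 1 :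
          Expr).eval p.W (s₁.writeReg 16 D') =
          if 4 * p.q * D' < (8 * p.q + 1) * p.α then 1 else 0 :=
        eval_lt (eval_mul (eval_mul (eval_lit (by omega)) (eval_reg (by simp [hg₁.r2])) (by omega))
          (eval_reg (by simp)) hqD')
          (eval_mul (eval_add (eval_mul (eval_lit (by omega)) (eval_reg (by simp [hg₁.r2]))
            (by omega)) (eval_lit (by omega)) hW1) (eval_reg (by simp [hg₁.r1])) hW2)
      apply wp_cond
      · intro hc''
        have hlt' : 4 * p.q * D' < (8 * p.q + 1) * p.α := by
          by_contra hcon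
          rw [htest', if_neg hcon] at hc''
          exact hc'' rfl
        apply wp_setReg (x := ℓ v - 1) (eval_sub (eval_reg (by simp [h12])) (eval_lit (by omega)))
        refine ⟨?_, by simpa using harr₁, by simpa using h12, ?_,
          Or.inr (Or.inr ⟨by simp; omega, ?_⟩)⟩
        · intro r hr
          simp [show r ≠ 11 by omega, show r ≠ 16 by omega, hreg₁ r hr]
        · simp only [hcost, hcost', Expr.cost]
          omega
        · simpa using hlt'
      · intro hc''
        have hlt' : (8 * p.q + 1) * p.α ≤ 4 * p.q * D' := by
          by_contra hcon
          rw [htest', if_pos (by omega)] at hc''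
          omega
        apply wp_skip
        refine ⟨?_, by simpa using harr₁, by simpa using h12, ?_,
          Or.inl ⟨by simpa using h11, fun _ => hle, fun _ => hlt'⟩⟩
        · intro r hr
          simp [show r ≠ 16 by omega, hreg₁ r hr]
        · simp only [hcost, hcost', Expr.cost]
          omega
    · intro hc'
      have hpos : ℓ v = 0 := by
        rwa [eval_reg h12] at hc'
      apply wp_skip
      refine ⟨hreg₁, harr₁, h12, ?_, Or.inl ⟨h11, fun _ => hle, fun h => by omega⟩⟩
      simp only [hcost, Expr.cost]
      omega

/-- One round of `stabilise`: the topmost vertex of the stack is removed if its condition holds;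
otherwise it stays on the stack and changes its level by one. -/
def stabiliseRound : Cmd :=
  8 ⟵ .reg 8 -ₑ .lit 1 ;;
  10 ⟵ .cell 5 (.reg 8) ;;
  chooseLevel ;;
  .cond (.reg 11 =ₑ .reg 12) .skip
    (.setCell 5 (.reg 8) (.reg 10) ;;
      8 ⟵ .reg 8 +ₑ .lit 1 ;;
      relevel)

/-- The program that inspects the vertices on the stack until it is empty.  The height of the stack
is in register `8`. -/
def stabilise : Cmd :=
  .loop (.reg 8) stabiliseRound

/-- The invariant of `stabilise`: every vertex that violates its level condition is on the stack.
The number `M` combines the potential and the height of the stack. -/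
structure StabInv (p : Par) (χ : ℕ → ℕ → ℕ) (ℓ : ℕ → ℕ) (M : ℕ) (s : Store) : Prop where
  rep : Rep p s χ (minKey ℓ) ℓ
  le : ∀ v, ℓ v ≤ p.L
  ok : ∀ v < p.n, LevelOk p χ ℓ v ∨ ∃ j < s.reg 8, s.arr 5 j = v
  lt : ∀ j < s.reg 8, s.arr 5 j < p.n
  eq : (M : ℤ) = s.reg 8 + 3 * pot p χ ℓ
  cap : M ≤ p.cap

/-- A round of `stabilise`.  A vertex that leaves the stack pays for its inspection.  The time for a
change of level is of the order of `k (D + 1)`, where `D` edges have to be inspected.  The potential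
drops by at least `D`, and its weight three pays both for the time and for the vertices that are
pushed. -/
theorem stabilise_step (hp : p.Ok) {s : Store} {χ : ℕ → ℕ → ℕ} {ℓ : ℕ → ℕ} {M : ℕ}
    (hχ : IsCol p χ) (hI : StabInv p χ ℓ M s) (hsp : s.reg 8 ≠ 0) :
    wp p.W stabiliseRound s fun s' t =>
      ∃ ℓ' M', StabInv p χ ℓ' M' s' ∧ 2 + t + 600 * (p.k + 1) * M' ≤ 600 * (p.k + 1) * M := by
  unfold stabiliseRound
  have h8 := hp.eight
  obtain ⟨sp, hsp'⟩ := Nat.exists_eq_succ_of_ne_zero hsp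
  rw [Nat.succ_eq_add_one] at hsp'
  have hcapW := hp.cap_lt
  have hpot := pot_nonneg (p := p) χ hI.le
  have hMeq := hI.eq
  have hMcap := hI.cap
  have hMsp : s.reg 8 ≤ M := by omega
  have finish : ∀ {t M' c : ℕ}, M' + c ≤ M → 2 + t ≤ 600 * (p.k + 1) * c →
      2 + t + 600 * (p.k + 1) * M' ≤ 600 * (p.k + 1) * M := by
    intro t M' c h1 h2
    have h3 : 600 * (p.k + 1) * (M' + c) ≤ 600 * (p.k + 1) * M := Nat.mul_le_mul_left _ h1
    rw [mul_add] at h3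
    omega
  apply wp_seq
  apply wp_setReg (x := sp) (by
    rw [eval_sub (eval_reg hsp') (eval_lit (by omega))]; omega)
  apply wp_seq
  set v := s.arr 5 sp with hv
  have hvn : v < p.n := hI.lt sp (by omega)
  apply wp_setReg (x := v) (eval_cell (x := sp) (eval_reg (by simp)) (by simp [hv]))
  set s₁ := (s.writeReg 8 sp).writeReg 10 v with hs₁
  have hreg₁ : ∀ r < 8, s₁.reg r = s.reg r := by
    intro r hr
    simp [hs₁, show r ≠ 8 by omega, show r ≠ 10 by omega]
  have harr₁ : s₁.arr = s.arr := by simp [hs₁]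
  have h8₁ : s₁.reg 8 = sp := by simp [hs₁]
  have h10₁ : s₁.reg 10 = v := by simp [hs₁]
  have hR₁ : Rep p s₁ χ (minKey ℓ) ℓ := hI.rep.frame hreg₁ fun a _ => by rw [harr₁]
  apply wp_seq
  refine wp_mono (chooseLevel_spec hp hR₁ hχ hvn hI.le h10₁) ?_
  rintro s₂ t₂ ⟨hreg₂, harr₂, h12, ht₂, hcases⟩
  have h8₂ : s₂.reg 8 = sp := by rw [hreg₂ 8 (by omega), h8₁]
  have h10₂ : s₂.reg 10 = v := by rw [hreg₂ 10 (by omega), h10₁]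
  have harr₂' : s₂.arr = s.arr := by rw [harr₂, harr₁]
  have hR₂ : Rep p s₂ χ (minKey ℓ) ℓ :=
    hR₁.frame (fun r hr => hreg₂ r (by omega)) fun a _ => by rw [harr₂]
  have htest : (.reg 11 =ₑ .reg 12 : Expr).eval p.W s₂ = if s₂.reg 11 = ℓ v then 1 else 0 :=
    eval_eq rfl (eval_reg h12)
  apply wp_cond
  · intro hc
    have heq : s₂.reg 11 = ℓ v := by
      by_contra hcon
      rw [htest, if_neg hcon] at hc
      exact hc rfl
    have hok : LevelOk p χ ℓ v := by
      rcases hcases with h | h | h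
      · exact h.2
      · omega
      · omega
    apply wp_skip
    refine ⟨ℓ, M - 1, ⟨hR₂, hI.le, ?_, ?_, by omega, by omega⟩, finish (c := 1) (by omega) ?_⟩
    · intro w hw
      rcases hI.ok w hw with h | ⟨j, hj, hjw⟩
      · exact Or.inl h
      · by_cases hwv : w = v
        · exact Or.inl (hwv ▸ hok)
        · refine Or.inr ⟨j, ?_, by rw [harr₂', hjw]⟩
          have : j ≠ sp := by
            rintro rfl
            exact hwv hjw.symm
          omega
    · intro j hj
      rw [harr₂']
      exact hI.lt j (by omega)
    · simp only [Expr.cost]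
      omega
  · intro hc
    have hne : s₂.reg 11 ≠ ℓ v := by
      intro hcon
      rw [htest, if_pos hcon] at hc
      omega
    set i' := s₂.reg 11 with hi'
    set D := upDeg p χ ℓ (ℓ v) v with hD
    have hLv := hI.le v
    -- The vertex stays on the stack, which makes room for at most `D` new entries; the factor three
    -- of the potential leaves `D + 1` units for the running time.
    have hpay : i' ≤ p.L ∧ (i' = ℓ v + 1 ∨ ℓ v = i' + 1) ∧
        3 * pot p χ (Function.update ℓ v i') + 2 * D + 1 ≤ 3 * pot p χ ℓ ∧
        3 * pot p χ (Function.update ℓ v i') + 3 * D ≤ 3 * pot p χ ℓ := by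
      rcases hcases with h | ⟨h1, h2, h3⟩ | ⟨h1, h2⟩
      · exact absurd h.1 hne
      · have h4 := pot_promote hχ hvn h3
        rw [← h1, ← hD] at h4
        have h5 : 0 < D := by
          apply Nat.pos_of_ne_zero
          intro h0
          rw [h0] at h3
          omega
        exact ⟨by omega, Or.inl h1, by omega, by omega⟩
      · have h4 := pot_demote hp hχ hvn h1 h2
        have h5 : D ≤ upDeg p χ ℓ i' v := upDeg_antitone χ ℓ (by omega) v
        exact ⟨by omega, Or.inr h1, by omega, by omega⟩
    obtain ⟨hi'L, hii, hpay, hpay'⟩ := hpay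
    have hle' : ∀ w, Function.update ℓ v i' w ≤ p.L := by
      intro w
      rw [Function.update_apply]
      split_ifs
      · exact hi'L
      · exact hI.le w
    have hpot' := pot_nonneg (p := p) χ hle'
    apply wp_seq
    apply wp_setCell (eval_reg h8₂) (eval_reg h10₂)
    apply wp_seq
    apply wp_setReg (x := sp + 1) (eval_add (eval_reg (by simp [h8₂])) (eval_lit (by omega))
      (by omega))
    set s₃ := (s₂.writeCell 5 sp v).writeReg 8 (sp + 1) with hs₃
    have hreg₃ : ∀ r, r ≠ 8 → s₃.reg r = s₂.reg r := by
      intro r hr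
      simp [hs₃, hr]
    have h8₃ : s₃.reg 8 = sp + 1 := by simp [hs₃]
    have harr₃ : s₃.arr = s.arr := by
      funext a i
      simp only [hs₃, Store.arr_writeReg, Store.arr_writeCell, harr₂']
      split_ifs with h
      · rw [h.1, h.2, hv]
      · rfl
    have hR₃ : Rep p s₃ χ (minKey ℓ) ℓ :=
      hR₂.frame (fun r hr => hreg₃ r (by omega)) fun a _ => by rw [harr₃, harr₂']
    refine wp_mono (relevel_spec hp hR₃ hχ hvn hI.le hi'L hii (by rw [hreg₃ 10 (by omega), h10₂])
      (by rw [hreg₃ 11 (by omega)]) (by rw [h8₃]; omega)) ?_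
    rintro s₄ t₄ ⟨hR₄, hle₄, hge₄, hold, hnew, hpush, ht₄⟩
    rw [h8₃] at hle₄ hge₄ hold hnew
    rw [← hD] at hge₄ ht₄
    have hMnat : ∃ M' : ℕ, (M' : ℤ) = s₄.reg 8 + 3 * pot p χ (Function.update ℓ v i') :=
      ⟨(s₄.reg 8 + 3 * pot p χ (Function.update ℓ v i')).toNat, Int.toNat_of_nonneg (by omega)⟩
    obtain ⟨M', hM'⟩ := hMnat
    have hdec : M' + (D + 1) ≤ M := by omega
    refine ⟨Function.update ℓ v i', M', ⟨hR₄, hle', ?_, ?_, hM', by omega⟩,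
      finish (c := D + 1) hdec ?_⟩
    · intro w hw
      by_cases hwv : w = v
      · refine Or.inr ⟨sp, by omega, ?_⟩
        rw [hold sp (by omega), harr₃, hwv]
      · rcases hI.ok w hw with h | ⟨j, hj, hjw⟩
        · by_cases hmoved : χ v w ≠ 0 ∧ ℓ v ≤ ℓ w ∧ i' ≤ ℓ w
          · exact Or.inr (hpush w hmoved.1 hmoved.2.1 hmoved.2.2)
          · exact Or.inl (h.update hχ hwv hii hmoved)
        · refine Or.inr ⟨j, by omega, ?_⟩
          rw [hold j (by omega), harr₃, hjw]
    · intro j hj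
      by_cases hjsp : j < sp + 1
      · rw [hold j hjsp, harr₃]
        exact hI.lt j (by omega)
      · exact hnew j (by omega) hj
    · simp only [Expr.cost]
      have : 600 * (p.k + 1) * (D + 1) =
          350 * (p.k + 1) * (D + 1) + 250 * ((p.k + 1) * (D + 1)) := by
        ring
      have h9 : 1 ≤ (p.k + 1) * (D + 1) := Nat.mul_pos (by omega) (by omega)
      omega

theorem stabilise_spec (hp : p.Ok) {s : Store} {χ : ℕ → ℕ → ℕ} {ℓ : ℕ → ℕ} {M : ℕ}
    (hχ : IsCol p χ) (hI : StabInv p χ ℓ M s) :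
    wp p.W stabilise s fun s' t =>
      ∃ (ℓ' : ℕ → ℕ) (M' : ℕ), Rep p s' χ (minKey ℓ') ℓ' ∧ (∀ v, ℓ' v ≤ p.L) ∧
        (∀ v < p.n, LevelOk p χ ℓ' v) ∧ (M' : ℤ) = 3 * pot p χ ℓ' ∧
        t + 600 * (p.k + 1) * M' ≤ 600 * (p.k + 1) * M + 2 := by
  let I : ℕ → Store → Prop := fun m s' => ∃ ℓ' M', m = 600 * (p.k + 1) * M' ∧ StabInv p χ ℓ' M' s'
  refine wp_loop I (m := 600 * (p.k + 1) * M) ⟨ℓ, M, rfl, hI⟩ ?_ ?_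
  · rintro m s' ⟨ℓ', M', rfl, hI'⟩ htest
    refine wp_mono (stabilise_step hp hχ hI' htest) ?_
    rintro s'' t ⟨ℓ'', M'', hI'', ht⟩
    exact ⟨_, ⟨ℓ'', M'', rfl, hI''⟩, ht⟩
  · rintro m s' t ⟨ℓ', M', rfl, hI'⟩ htest ht
    have h0 : s'.reg 8 = 0 := htest
    refine ⟨ℓ', M', hI'.rep, hI'.le, ?_, ?_, ht⟩
    · intro v hv
      rcases hI'.ok v hv with h | ⟨j, hj, _⟩
      · exact h
      · omega
    · rw [hI'.eq, h0]
      simp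

/-! ### Coloring a new edge -/

/-- The program that computes the parameters `k`, `2 ^ k` and `L` from the input. -/
def setup : Cmd :=
  5 ⟵ .lit 0 ;;
  6 ⟵ .lit 1 ;;
  .loop (.reg 6 <ₑ .lit 2 *ₑ .reg 0)
    (6 ⟵ .reg 6 +ₑ .reg 6 ;; 5 ⟵ .reg 5 +ₑ .lit 1) ;;
  7 ⟵ .lit 8 *ₑ .reg 2 *ₑ .reg 5

theorem setup_spec (hp : p.Ok) {s : Store} (h0 : s.reg 0 = p.n) (h1 : s.reg 1 = p.α)
    (h2 : s.reg 2 = p.q) :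
    wp p.W setup s fun s' t =>
      Globals p s' ∧ s'.arr = s.arr ∧ s'.reg 3 = s.reg 3 ∧ s'.reg 4 = s.reg 4 ∧
      t ≤ 40 * (p.k + 1) := by
  have h8 := hp.eight
  obtain ⟨hW1, hW2, hW3, hW4, hW5, hW6⟩ := hp.small
  have hpow := hp.fits.trees
  have hkpow : p.k < 2 ^ p.k := Nat.lt_two_pow_self
  apply wp_seq
  apply wp_setReg (eval_lit (by omega))
  apply wp_seq
  apply wp_setReg (eval_lit (by omega))
  apply wp_seq
  let I : ℕ → Store → Prop := fun m s' => ∃ j ≤ p.k, m = 20 * (p.k - j) ∧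
    (∀ r < 5, s'.reg r = s.reg r) ∧ s'.arr = s.arr ∧ s'.reg 5 = j ∧ s'.reg 6 = 2 ^ j
  have htest : ∀ (s' : Store) (j : ℕ), (∀ r < 5, s'.reg r = s.reg r) → s'.reg 6 = 2 ^ j →
      (.reg 6 <ₑ .lit 2 *ₑ .reg 0 : Expr).eval p.W s' = if 2 ^ j < 2 * p.n then 1 else 0 := by
    intro s' j hr h6
    exact eval_lt (eval_reg h6) (eval_mul (eval_lit (by omega))
      (eval_reg (by rw [hr 0 (by omega), h0])) hW6)
  refine wp_loop I (m := 20 * p.k) ⟨0, Nat.zero_le _, by simp, ?_, by simp, by simp, by simp⟩ ?_ ?_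
  · intro r hr
    simp [show r ≠ 5 by omega, show r ≠ 6 by omega]
  · rintro m s' ⟨j, hj, rfl, hreg, harr, h5, h6⟩ hc
    have hlt : 2 ^ j < 2 * p.n := by
      by_contra hcon
      rw [htest s' j hreg h6, if_neg hcon] at hc
      exact hc rfl
    have hjk : j < p.k := (Nat.lt_clog_iff_pow_lt (by norm_num)).2 hlt
    have hpk : 2 ^ j ≤ 2 ^ p.k := Nat.pow_le_pow_right (by norm_num) hj
    apply wp_seq
    apply wp_setReg (x := 2 ^ j + 2 ^ j) (eval_add (eval_reg h6) (eval_reg h6) (by omega))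
    apply wp_setReg (x := j + 1) (eval_add (eval_reg (by simp [h5])) (eval_lit (by omega))
      (by omega))
    refine ⟨20 * (p.k - (j + 1)), ⟨j + 1, by omega, rfl, ?_, ?_, ?_, ?_⟩, ?_⟩
    · intro r hr
      simp [show r ≠ 5 by omega, show r ≠ 6 by omega, hreg r hr]
    · simpa using harr
    · simp
    · simp [pow_succ, mul_two]
    · simp only [Expr.cost]
      omega
  · rintro m s' t ⟨j, hj, rfl, hreg, harr, h5, h6⟩ hc ht
    have hle : ¬ 2 ^ j < 2 * p.n := by
      intro hcon
      rw [htest s' j hreg h6, if_pos hcon] at hc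
      omega
    have hjk : j = p.k := by
      by_contra hne
      exact hle ((Nat.lt_clog_iff_pow_lt (by norm_num)).1 (show j < p.k by omega))
    subst hjk
    have hq : s'.reg 2 = p.q := by rw [hreg 2 (by omega), h2]
    have hL : p.L = 8 * p.q * p.k := rfl
    apply wp_setReg (x := p.L) (eval_mul (eval_mul (eval_lit (by omega)) (eval_reg hq) (by omega))
      (eval_reg h5) (by omega))
    refine ⟨⟨?_, ?_, ?_, ?_, ?_, ?_⟩, by simpa using harr, ?_, ?_, ?_⟩
    · simp [hreg 0, h0]
    · simp [hreg 1, h1]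
    · simp [hq]
    · simp [h5]
    · simp [h6]
    · simp
    · simp [hreg 3]
    · simp [hreg 4]
    · simp only [Expr.cost] at ht ⊢
      omega

theorem IsCol.setPair_succ {χ : ℕ → ℕ → ℕ} (hχ : IsCol p χ) {a b c : ℕ} (hab : a ≠ b)
    (ha : a < p.n) (hb : b < p.n) (hc : c < 2 ^ p.k) (hca : ∀ w, χ a w ≠ c + 1)
    (hcb : ∀ w, χ b w ≠ c + 1) : IsCol p (setPair χ a b (c + 1)) where
  symm := setPair_symm hχ.symm a b _
  irrefl v := by
    rw [setPair, if_neg (by omega)]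
    exact hχ.irrefl v
  lt u v h := by
    unfold setPair at h
    split_ifs at h with h1
    · omega
    · exact hχ.lt u v h
  le u v := by
    unfold setPair
    split_ifs
    · omega
    · exact hχ.le u v
  proper u v w h1 h2 := by
    by_cases hu : u = a ∨ u = b
    · obtain ⟨y, hy, hset, hother⟩ := setPair_row hab hu χ (c + 1)
      have hfree : ∀ z, χ u z ≠ c + 1 := by
        rcases hu with rfl | rfl <;> assumption
      by_cases hv : v = y
      · by_cases hw : w = y
        · rw [hv, hw]
        · rw [hv, hset, hother w hw] at h2
          exact absurd h2.symm (hfree w)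
      · by_cases hw : w = y
        · rw [hw, hset, hother v hv] at h2
          exact absurd h2 (hfree v)
        · rw [hother v hv, hother w hw] at h2
          rw [hother v hv] at h1
          exact hχ.proper u v w h1 h2
    · rw [setPair_of_ne hu, setPair_of_ne hu] at h2
      rw [setPair_of_ne hu] at h1
      exact hχ.proper u v w h1 h2

theorem IsCol.setPair_zero {χ : ℕ → ℕ → ℕ} (hχ : IsCol p χ) (a b : ℕ) :
    IsCol p (setPair χ a b 0) where
  symm := setPair_symm hχ.symm a b _
  irrefl v := by
    unfold setPair
    split_ifs
    · rfl
    · exact hχ.irrefl v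
  lt u v h := by
    unfold setPair at h
    split_ifs at h with h1
    · exact absurd rfl h
    · exact hχ.lt u v h
  le u v := by
    unfold setPair
    split_ifs
    · exact Nat.zero_le _
    · exact hχ.le u v
  proper u v w h1 h2 := by
    unfold setPair at h1 h2
    split_ifs at h1 h2 with h3 h4
    · exact absurd rfl h1
    · exact absurd rfl h1
    · exact absurd h2 h1
    · exact hχ.proper u v w h1 h2

/-- The number of edges whose color changes. -/
def changes (n : ℕ) (χ χ' : ℕ → ℕ → ℕ) : ℕ :=
  DynGraph.recourse (n := n) (fun u v => χ u v) (fun u v => χ' u v)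

theorem changes_self (n : ℕ) (χ : ℕ → ℕ → ℕ) : changes n χ χ = 0 := by
  simp [changes, DynGraph.recourse]

theorem changes_triangle (n : ℕ) (χ χ' χ'' : ℕ → ℕ → ℕ) :
    changes n χ χ'' ≤ changes n χ χ' + changes n χ' χ'' := by
  unfold changes DynGraph.recourse
  refine le_trans (Finset.card_le_card ?_) (Finset.card_union_le _ _)
  intro x hx
  simp only [Finset.mem_union, Finset.mem_filter, Finset.mem_univ, true_and] at hx ⊢
  by_cases h : χ x.1 x.2 = χ' x.1 x.2
  · exact Or.inr ⟨hx.1, by rw [← h]; exact hx.2⟩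
  · exact Or.inl ⟨hx.1, h⟩

theorem changes_setPair (n : ℕ) (χ : ℕ → ℕ → ℕ) (a b x : ℕ) :
    changes n χ (setPair χ a b x) ≤ 1 := by
  unfold changes DynGraph.recourse
  rw [Finset.card_le_one]
  have key : ∀ y : Fin n × Fin n, y.1 < y.2 → χ y.1 y.2 ≠ setPair χ a b x y.1 y.2 →
      (y.1 : ℕ) = min a b ∧ (y.2 : ℕ) = max a b := by
    intro y h1 h2
    have h3 : (y.1 : ℕ) < y.2 := h1
    unfold setPair at h2
    split_ifs at h2 with h4
    · omega
    · exact absurd rfl h2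
  intro y hy z hz
  simp only [Finset.mem_filter, Finset.mem_univ, true_and] at hy hz
  obtain ⟨h1, h2⟩ := key y hy.1 hy.2
  obtain ⟨h3, h4⟩ := key z hz.1 hz.2
  exact Prod.ext (Fin.ext (by omega)) (Fin.ext (by omega))

/-- The state in which all edges of the graph `ψ`, given as a table with nonzero entries at the
edges, except `ab` are colored, with colors `x` such that `q * x ≤ Λ`.  The level of `a` is at most
that of `b`. -/
structure Pending (p : Par) (χ ψ : ℕ → ℕ → ℕ) (ℓ : ℕ → ℕ) (Λ a b : ℕ) : Prop where
  col : IsCol p χ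
  bound : ∀ u v, p.q * χ u v ≤ Λ
  ne : a ≠ b
  lt : a < p.n
  lt' : b < p.n
  zero : χ a b = 0
  le : ℓ a ≤ ℓ b
  supp : ∀ u v, ψ u v ≠ 0 ↔ χ u v ≠ 0 ∨ ((u = a ∧ v = b) ∨ (u = b ∧ v = a))

theorem upDeg_succ_le {χ ψ : ℕ → ℕ → ℕ} {ℓ : ℕ → ℕ} {a b i : ℕ} (hb : b < p.n)
    (hzero : χ a b = 0) (hψ : ψ a b ≠ 0) (hsupp : ∀ v, χ a v ≠ 0 → ψ a v ≠ 0) (hi : i ≤ ℓ b) :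
    upDeg p χ ℓ i a + 1 ≤ upDeg p ψ ℓ i a := by
  unfold upDeg
  have hnot : b ∉ upNbrs p χ ℓ i a := by simp [upNbrs, hzero]
  rw [← Finset.card_insert_of_notMem hnot]
  apply Finset.card_le_card
  intro w hw
  simp only [upNbrs, Finset.mem_insert, Finset.mem_filter, Finset.mem_range] at hw ⊢
  rcases hw with rfl | ⟨h1, h2, h3⟩
  · exact ⟨hb, hψ, hi⟩
  · exact ⟨h1, hsupp w h2, h3⟩

/-- One round of `colorLoop`: the pending edge gets a color that is unused at the vertex in register
`17` and on the edges from the vertex in register `9` to vertices not below it.  If an edge to a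
vertex below has this color, then that edge is uncolored and becomes pending. -/
def colorRound : Cmd :=
  12 ⟵ .cell 2 (.reg 9) ;;
  findFree (slotE (.reg 17) (.reg 7 +ₑ .lit 1)) (slotE (.reg 9) (.reg 12)) ;;
  14 ⟵ .reg 32 ;;
  .cond (.cell 3 (slotE (.reg 9) (.reg 7 +ₑ .lit 1) *ₑ (.reg 6 +ₑ .reg 6) +ₑ
      (.reg 6 +ₑ .reg 14)))
    (18 ⟵ .cell 1 (.reg 9 *ₑ .reg 6 +ₑ .reg 14) ;;
      13 ⟵ .cell 2 (.reg 18) ;;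
      edgeUpd .sub 18 9 13 14 (.lit 0) ;;
      edgeUpd .add 9 17 12 14 (.reg 14 +ₑ .lit 1) ;;
      17 ⟵ .reg 9 ;;
      9 ⟵ .reg 18)
    (edgeUpd .add 9 17 12 14 (.reg 14 +ₑ .lit 1) ;;
      19 ⟵ .lit 0)

/-- The program that colors the edge between the vertices in the registers `9` and `17`. -/
def colorLoop : Cmd :=
  19 ⟵ .lit 1 ;;
  .loop (.reg 19) colorRound

/-- All edges of the graph `ψ` are colored. -/
structure Settled (p : Par) (χ ψ : ℕ → ℕ → ℕ) (Λ : ℕ) : Prop where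
  col : IsCol p χ
  bound : ∀ u v, p.q * χ u v ≤ Λ
  supp : ∀ u v, ψ u v ≠ 0 ↔ χ u v ≠ 0

/-- The invariant of `colorLoop`: either an edge is pending, and the levels that are left below it
bound the number of further color changes, or all edges are colored. -/
structure ColorInv (p : Par) (s₀ : Store) (χ₀ ψ : ℕ → ℕ → ℕ) (ℓ : ℕ → ℕ) (Λ m : ℕ) (s : Store)
    (χ : ℕ → ℕ → ℕ) : Prop where
  rep : Rep p s χ (minKey ℓ) ℓ
  reg : ∀ r < 9, s.reg r = s₀.reg r
  cases : (∃ a b, s.reg 19 = 1 ∧ s.reg 9 = a ∧ s.reg 17 = b ∧ Pending p χ ψ ℓ Λ a b ∧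
      changes p.n χ₀ χ + 2 * ℓ a ≤ 2 * p.L ∧ m = 800 * (p.k + 1) * (ℓ a + 1)) ∨
    (s.reg 19 = 0 ∧ Settled p χ ψ Λ ∧ changes p.n χ₀ χ ≤ 2 * p.L + 1)

set_option maxRecDepth 4000 in
/-- A round of `colorLoop`.  The new color of the pending edge `ab` is unused at `b` and on the
edges from `a` to vertices that are not below `a`.  So at most one edge `aw` has the same color, and
`w` is below `a`; it becomes the pending edge. -/
theorem color_step (hp : p.Ok) {s₀ s : Store} {χ₀ χ ψ : ℕ → ℕ → ℕ} {ℓ : ℕ → ℕ} {Λ Δ m : ℕ}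
    (hℓ : ∀ v, ℓ v ≤ p.L) (hΔ : ∀ v < p.n, upDeg p ψ ℓ 0 v ≤ Δ)
    (hup : ∀ v < p.n, p.q * upDeg p ψ ℓ (ℓ v) v ≤ (4 * p.q + 1) * p.α + p.q)
    (hΛ : Λ = p.q * Δ + (4 * p.q + 1) * p.α)
    (hI : ColorInv p s₀ χ₀ ψ ℓ Λ m s χ) (h19 : s.reg 19 ≠ 0) :
    wp p.W colorRound s fun s' t =>
      ∃ m' χ', ColorInv p s₀ χ₀ ψ ℓ Λ m' s' χ' ∧ 2 + t + m' ≤ m := by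
  unfold colorRound
  have h8 := hp.eight
  obtain ⟨hW1, hW2, hW3, hW4, hW5, hW6⟩ := hp.small
  have h2n := p.two_n_le
  have hP : 0 < 2 ^ p.k := by positivity
  have hpow := hp.fits.trees
  obtain ⟨a, b, h19', h9, h17, hpend, hrec, rfl⟩ | ⟨h0, _⟩ := hI.cases
  swap
  · exact absurd h0 h19
  have hχ := hpend.col
  have hR := hI.rep
  have hg := hR.glob
  have ha := hpend.lt
  have hb := hpend.lt'
  have hLa := hℓ a
  apply wp_seq
  apply wp_setReg (x := ℓ a) (eval_cell (eval_reg h9) (hR.lev a ha))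
  apply wp_seq
  set s₁ := s.writeReg 12 (ℓ a) with hs₁
  have hreg₁ : ∀ r, r ≠ 12 → s₁.reg r = s.reg r := fun r hr => by simp [hs₁, hr]
  have hg₁ : Globals p s₁ := hg.frame fun r hr => hreg₁ r (by omega)
  -- The sizes of the two sets bound the new color.
  have hψab : ψ a b ≠ 0 := (hpend.supp a b).2 (Or.inr (Or.inl ⟨rfl, rfl⟩))
  have hψba : ψ b a ≠ 0 := (hpend.supp b a).2 (Or.inr (Or.inr ⟨rfl, rfl⟩))
  have hcard₁ : (slotSet p χ (minKey ℓ) b (p.L + 1)).card + 1 ≤ upDeg p ψ ℓ 0 b := by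
    rw [hχ.card_slotSet_all _ ℓ]
    exact upDeg_succ_le ha (by rw [hχ.symm]; exact hpend.zero) hψba
      (fun v hv => (hpend.supp b v).2 (Or.inl hv)) (Nat.zero_le _)
  have hcard₂ : (slotSet p χ (minKey ℓ) a (ℓ a)).card + 1 ≤ upDeg p ψ ℓ (ℓ a) a := by
    rw [hχ.card_slotSet_up hLa]
    exact upDeg_succ_le hb hpend.zero hψab (fun v hv => (hpend.supp a v).2 (Or.inl hv)) hpend.le
  have hn₁ : upDeg p ψ ℓ 0 b ≤ p.n := upDeg_le _ _ _ _
  have hn₂ : upDeg p ψ ℓ (ℓ a) a ≤ p.n := upDeg_le _ _ _ _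
  refine wp_mono (findFree_spec (N := p.n * (p.L + 2)) (slot₁ := b * (p.L + 2) + (p.L + 1))
    (slot₂ := a * (p.L + 2) + ℓ a) (S₁ := slotSet p χ (minKey ℓ) b (p.L + 1))
    (S₂ := slotSet p χ (minKey ℓ) a (ℓ a)) hp.fits hg₁.r6
    (eval_slotE hp hg₁.r7 (eval_reg (by rw [hreg₁ 17 (by omega), h17]))
      (eval_add (eval_reg hg₁.r7) (eval_lit (by omega)) hW5) hb le_rfl)
    (p.slot_lt hb le_rfl)
    (fun x => eval_slotE hp (by simp [hg₁.r7]) (eval_reg (by simp [hreg₁ 9, h9]))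
      (eval_reg (by simp [hs₁])) ha (by omega)) (p.slot_lt ha (by omega)) (by omega)
    (slotSet_subset _ _ _ _) (slotSet_subset _ _ _ _)
    (hR.tree b hb _ le_rfl) (hR.tree a ha _ (by omega))) ?_
  rintro s₂ t₂ ⟨hreg₂, harr₂, ⟨c, hc₁, hc₂, hcle, h32⟩, ht₂⟩
  have hck : c < 2 ^ p.k := by omega
  have hcΛ : p.q * (c + 1) ≤ Λ := by
    have h1 := hΔ b hb
    have h2 := hup a ha
    have h3 : p.q * (c + 1) + p.q ≤ p.q * Δ + p.q * upDeg p ψ ℓ (ℓ a) a := by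
      rw [← mul_add, ← Nat.mul_succ]
      exact Nat.mul_le_mul_left _ (by omega)
    omega
  apply wp_seq
  apply wp_setReg (x := c) (eval_reg h32)
  set s₃ := s₂.writeReg 14 c with hs₃
  have hreg₃ : ∀ r < 20, r ≠ 12 → r ≠ 14 → s₃.reg r = s.reg r := by
    intro r hr h1 h2
    simp only [hs₃, Store.reg_writeReg, if_neg h2]
    rw [hreg₂ r hr, hreg₁ r h1]
  have h14₃ : s₃.reg 14 = c := by simp [hs₃]
  have h12₃ : s₃.reg 12 = ℓ a := by simp [hs₃, hreg₂ 12, hs₁]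
  have harr₃ : s₃.arr = s.arr := by simp [hs₃, harr₂, hs₁]
  have hR₃ : Rep p s₃ χ (minKey ℓ) ℓ :=
    hR.frame (fun r hr => hreg₃ r (by omega) (by omega) (by omega)) fun a _ => by rw [harr₃]
  have hg₃ := hR₃.glob
  have h9₃ : s₃.reg 9 = a := by rw [hreg₃ 9 (by omega) (by omega) (by omega), h9]
  have h17₃ : s₃.reg 17 = b := by rw [hreg₃ 17 (by omega) (by omega) (by omega), h17]
  have htest : (.cell 3 (slotE (.reg 9) (.reg 7 +ₑ .lit 1) *ₑ (.reg 6 +ₑ .reg 6) +ₑ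
      (.reg 6 +ₑ .reg 14)) : Expr).eval p.W s₃ =
      if c ∈ slotSet p χ (minKey ℓ) a (p.L + 1) then 1 else 0 := by
    obtain ⟨h1, h2, h3⟩ := hp.fits.base (p.slot_lt ha (le_refl (p.L + 1)))
    rw [two_mul] at h1
    refine eval_cell (x := (a * (p.L + 2) + (p.L + 1)) * (2 ^ p.k + 2 ^ p.k) + (2 ^ p.k + c))
      (eval_add (eval_mul (eval_slotE hp hg₃.r7 (eval_reg h9₃) (eval_add (eval_reg hg₃.r7)
        (eval_lit (by omega)) hW5) ha le_rfl) (eval_add (eval_reg hg₃.r6) (eval_reg hg₃.r6)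
        (by omega)) (by omega)) (eval_add (eval_reg hg₃.r6) (eval_reg h14₃) (by omega)) (by omega))
      ?_
    rw [← two_mul, ← cnt_leaf]
    exact hR₃.tree a ha (p.L + 1) le_rfl 0 (Nat.zero_le _) (2 ^ p.k + c) (by simp)
      (by rw [Nat.sub_zero, pow_succ]; omega)
  have hcb : ∀ w, χ b w ≠ c + 1 := fun w hw =>
    hc₁ (hχ.mem_slotSet.2 ⟨w, hw, Or.inl rfl⟩)
  have hκab : minKey ℓ a b = ℓ a := min_eq_left hpend.le
  have hκba : minKey ℓ b a = ℓ a := min_eq_right hpend.le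
  have hexc : ∀ s₄ : Store, s₄.reg 14 = c →
      (.reg 14 +ₑ .lit 1 : Expr).eval p.W s₄ = c + 1 := fun s₄ h =>
    eval_add (eval_reg h) (eval_lit (by omega)) (by omega)
  apply wp_cond
  · intro hc
    have hmem : c ∈ slotSet p χ (minKey ℓ) a (p.L + 1) := by
      by_contra hcon
      rw [htest, if_neg hcon] at hc
      exact hc rfl
    obtain ⟨w, hw, _⟩ := hχ.mem_slotSet.1 hmem
    have hwn : w < p.n := hχ.lt_right (v := a) (by omega)
    have hwa : χ w a = c + 1 := by rw [hχ.symm, hw]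
    have hwlt : ℓ w < ℓ a := by
      by_contra hcon
      exact hc₂ (hχ.mem_slotSet.2 ⟨w, hw, Or.inr (min_eq_left (by omega))⟩)
    have hwne : w ≠ a := by
      rintro rfl
      omega
    have hwb : w ≠ b := by
      rintro rfl
      have := hpend.zero
      omega
    obtain ⟨hm1, hm2⟩ := hp.index_lt ha le_rfl hck.le
    apply wp_seq
    apply wp_setReg (x := w) (eval_cell (eval_add (eval_mul (eval_reg h9₃) (eval_reg hg₃.r6) hm1)
      (eval_reg h14₃) hm2) (hR₃.own a w c hw))
    apply wp_seq
    apply wp_setReg (x := ℓ w)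
      (eval_cell (x := w) (eval_reg (by simp)) (by simpa using hR₃.lev w hwn))
    set s₄ := (s₃.writeReg 18 w).writeReg 13 (ℓ w) with hs₄
    have hreg₄ : ∀ r, r ≠ 18 → r ≠ 13 → s₄.reg r = s₃.reg r := fun r h1 h2 => by
      simp [hs₄, h1, h2]
    have hR₄ : Rep p s₄ χ (minKey ℓ) ℓ :=
      hR₃.frame (fun r hr => hreg₄ r (by omega) (by omega)) fun a _ => by simp [hs₄]
    have hχ₁ : IsCol p (setPair χ w a 0) := hχ.setPair_zero w a
    apply wp_seq
    refine wp_mono (edgeUpd_spec hp hR₄ (o := .sub) (ra := 18) (rb := 9) (rm := 13) (rc := 14)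
      (ex := .lit 0) (x := 0) (by omega) (by omega) (by omega) (by omega) (by simp [hs₄])
      (by rw [hreg₄ 9 (by omega) (by omega), h9₃]) (m := ℓ w) (by simp [hs₄])
      (by rw [hreg₄ 14 (by omega) (by omega), h14₃])
      (fun s' _ => eval_lit (by omega)) (by simp [Expr.cost]) hwn ha hwne (hℓ w)
      (min_eq_left hwlt.le) (min_eq_right hwlt.le) hck hχ hχ₁ (Or.inr ⟨rfl, hwa, rfl⟩)) ?_
    rintro s₅ t₅ ⟨hreg₅, harr₅, hR₅, ht₅⟩
    have hab₁ : setPair χ w a 0 a b = 0 := by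
      rw [setPair, if_neg (by omega)]
      exact hpend.zero
    have hχ₂ : IsCol p (setPair (setPair χ w a 0) a b (c + 1)) := by
      apply hχ₁.setPair_succ hpend.ne ha hb hck
      · intro z hz
        unfold setPair at hz
        split_ifs at hz with h1
        exact h1 (Or.inr ⟨rfl, hχ.proper a z w (by omega) (by omega)⟩)
      · intro z hz
        unfold setPair at hz
        split_ifs at hz with h1
        exact hcb z hz
    have h14₅ : s₅.reg 14 = c := by
      rw [hreg₅ 14 (by omega), hreg₄ 14 (by omega) (by omega), h14₃]
    have h9₅ : s₅.reg 9 = a := by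
      rw [hreg₅ 9 (by omega), hreg₄ 9 (by omega) (by omega), h9₃]
    apply wp_seq
    refine wp_mono (edgeUpd_spec hp hR₅ (o := .add) (ra := 9) (rb := 17) (rm := 12) (rc := 14)
      (ex := .reg 14 +ₑ .lit 1) (x := c + 1) (by omega) (by omega) (by omega) (by omega) h9₅
      (by rw [hreg₅ 17 (by omega), hreg₄ 17 (by omega) (by omega), h17₃]) (m := ℓ a)
      (by rw [hreg₅ 12 (by omega), hreg₄ 12 (by omega) (by omega), h12₃]) h14₅
      (fun s' hs' => hexc s' (by rw [hs' 14 (by omega), h14₅])) (by simp [Expr.cost]) ha hb hpend.ne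
      hLa hκab hκba hck hχ₁ hχ₂ (Or.inl ⟨rfl, hab₁, rfl⟩)) ?_
    rintro s₆ t₆ ⟨hreg₆, harr₆, hR₆, ht₆⟩
    apply wp_seq
    apply wp_setReg (x := a) (eval_reg (by rw [hreg₆ 9 (by omega), h9₅]))
    apply wp_setReg (x := w) (eval_reg (by simp [hreg₆ 18, hreg₅ 18, hs₄]))
    set χ₂ := setPair (setPair χ w a 0) a b (c + 1) with hχ₂def
    refine ⟨800 * (p.k + 1) * (ℓ w + 1), χ₂, ⟨hR₆.frame ?_ (by simp), ?_, Or.inl ⟨w, a, ?_, by simp,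
      by simp, ⟨hχ₂, ?_, hwne, hwn, ha, ?_, hwlt.le, ?_⟩, ?_, rfl⟩⟩, ?_⟩
    · intro r hr
      simp [show r ≠ 9 by omega, show r ≠ 17 by omega]
    · intro r hr
      simp only [Store.reg_writeReg, if_neg (show r ≠ 9 by omega), if_neg (show r ≠ 17 by omega)]
      rw [hreg₆ r (by omega), hreg₅ r (by omega), hreg₄ r (by omega) (by omega),
        hreg₃ r (by omega) (by omega) (by omega), hI.reg r hr]
    · simp [hreg₆ 19, hreg₅ 19, hreg₄ 19, hreg₃ 19, h19']
    · intro u v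
      rw [hχ₂def]
      unfold setPair
      split_ifs
      · exact hcΛ
      · simp
      · exact hpend.bound u v
    · rw [hχ₂def, setPair, if_neg (by omega), setPair_self]
    · intro u v
      rw [hpend.supp, hχ₂def]
      unfold setPair
      by_cases h1 : (u = a ∧ v = b) ∨ (u = b ∧ v = a)
      · simp [h1]
      · by_cases h2 : (u = w ∧ v = a) ∨ (u = a ∧ v = w)
        · simp only [h1, if_false, h2, if_true, or_false]
          constructor
          · intro _; exact Or.inr trivial
          · intro _
            rcases h2 with ⟨rfl, rfl⟩ | ⟨rfl, rfl⟩ <;> omega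
        · simp only [h1, if_false, h2]
    · have h1 := changes_triangle p.n χ₀ χ (setPair χ w a 0)
      have h2 := changes_triangle p.n χ₀ (setPair χ w a 0) χ₂
      have h3 := changes_setPair p.n χ w a 0
      have h4 := changes_setPair p.n (setPair χ w a 0) a b (c + 1)
      rw [← hχ₂def] at h4
      omega
    · have h1 : 800 * (p.k + 1) * (ℓ w + 1) + 800 * (p.k + 1) ≤ 800 * (p.k + 1) * (ℓ a + 1) := by
        rw [← Nat.mul_succ]
        exact Nat.mul_le_mul_left _ (by omega)
      simp only [slotE, Expr.cost] at ht₂ ⊢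
      omega
  · intro hc
    have hmem : c ∉ slotSet p χ (minKey ℓ) a (p.L + 1) := by
      intro hcon
      rw [htest, if_pos hcon] at hc
      omega
    have hca : ∀ w, χ a w ≠ c + 1 := fun w hw =>
      hmem (hχ.mem_slotSet.2 ⟨w, hw, Or.inl rfl⟩)
    have hχ₁ := hχ.setPair_succ hpend.ne ha hb hck hca hcb
    apply wp_seq
    refine wp_mono (edgeUpd_spec hp hR₃ (o := .add) (ra := 9) (rb := 17) (rm := 12) (rc := 14)
      (ex := .reg 14 +ₑ .lit 1) (x := c + 1) (by omega) (by omega) (by omega) (by omega) h9₃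
      h17₃ (m := ℓ a) h12₃ h14₃
      (fun s' hs' => hexc s' (by rw [hs' 14 (by omega), h14₃])) (by simp [Expr.cost]) ha hb hpend.ne
      hLa hκab hκba hck hχ hχ₁ (Or.inl ⟨rfl, hpend.zero, rfl⟩)) ?_
    rintro s₅ t₅ ⟨hreg₅, harr₅, hR₅, ht₅⟩
    apply wp_setReg (eval_lit (by omega))
    refine ⟨0, _, ⟨hR₅.frame ?_ (by simp), ?_, Or.inr ⟨by simp, ⟨hχ₁, ?_, ?_⟩, ?_⟩⟩, ?_⟩
    · intro r hr
      simp [show r ≠ 19 by omega]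
    · intro r hr
      simp only [Store.reg_writeReg, if_neg (show r ≠ 19 by omega)]
      rw [hreg₅ r (by omega), hreg₃ r (by omega) (by omega) (by omega), hI.reg r hr]
    · intro u v
      unfold setPair
      split_ifs
      · exact hcΛ
      · exact hpend.bound u v
    · intro u v
      rw [hpend.supp]
      unfold setPair
      by_cases h1 : (u = a ∧ v = b) ∨ (u = b ∧ v = a) <;> simp [h1]
    · have h1 := changes_triangle p.n χ₀ χ (setPair χ a b (c + 1))
      have h2 := changes_setPair p.n χ a b (c + 1)
      omega
    · have h1 : 800 * (p.k + 1) * 1 ≤ 800 * (p.k + 1) * (ℓ a + 1) :=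
        Nat.mul_le_mul_left _ (by omega)
      simp only [slotE, Expr.cost] at ht₂ ⊢
      omega

theorem colorLoop_spec (hp : p.Ok) {s : Store} {χ ψ : ℕ → ℕ → ℕ} {ℓ : ℕ → ℕ} {Λ Δ a b : ℕ}
    (hR : Rep p s χ (minKey ℓ) ℓ) (h9 : s.reg 9 = a) (h17 : s.reg 17 = b)
    (hpend : Pending p χ ψ ℓ Λ a b)
    (hℓ : ∀ v, ℓ v ≤ p.L) (hΔ : ∀ v < p.n, upDeg p ψ ℓ 0 v ≤ Δ)
    (hup : ∀ v < p.n, p.q * upDeg p ψ ℓ (ℓ v) v ≤ (4 * p.q + 1) * p.α + p.q)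
    (hΛ : Λ = p.q * Δ + (4 * p.q + 1) * p.α) :
    wp p.W colorLoop s fun s' t =>
      ∃ χ', Rep p s' χ' (minKey ℓ) ℓ ∧ (∀ r < 9, s'.reg r = s.reg r) ∧ Settled p χ' ψ Λ ∧
        changes p.n χ χ' ≤ 2 * p.L + 1 ∧ t ≤ 810 * (p.k + 1) * (p.L + 1) := by
  have h8 := hp.eight
  apply wp_seq
  apply wp_setReg (eval_lit (by omega))
  let I : ℕ → Store → Prop := fun m s' => ∃ χ', ColorInv p s χ ψ ℓ Λ m s' χ'
  refine wp_loop I (m := 800 * (p.k + 1) * (ℓ a + 1))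
    ⟨χ, hR.frame ?_ (by simp), ?_, Or.inl ⟨a, b, by simp, by simp [h9], by simp [h17], hpend, ?_,
      rfl⟩⟩ ?_ ?_
  · intro r hr
    simp [show r ≠ 19 by omega]
  · intro r hr
    simp [show r ≠ 19 by omega]
  · rw [changes_self]
    have := hℓ a
    omega
  · rintro m s' ⟨χ', hI⟩ htest
    refine wp_mono (color_step hp hℓ hΔ hup hΛ hI htest) ?_
    rintro s'' t ⟨m', χ'', hI', ht⟩
    exact ⟨m', ⟨χ'', hI'⟩, ht⟩
  · rintro m s' t ⟨χ', hI⟩ htest ht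
    rcases hI.cases with ⟨a', b', h19, _⟩ | ⟨_, hset, hrec⟩
    · rw [eval_reg h19] at htest
      omega
    · refine ⟨χ', hI.rep, hI.reg, hset, hrec, ?_⟩
      have h1 : 800 * (p.k + 1) * (ℓ a + 1) ≤ 800 * (p.k + 1) * (p.L + 1) :=
        Nat.mul_le_mul_left _ (by have := hℓ a; omega)
      have h2 : 810 * (p.k + 1) * (p.L + 1) =
          800 * (p.k + 1) * (p.L + 1) + 10 * ((p.k + 1) * (p.L + 1)) := by ring
      have h3 : 1 ≤ (p.k + 1) * (p.L + 1) := Nat.mul_pos (by omega) (by omega)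
      simp only [Expr.cost] at ht ⊢
      omega

open DynGraph

/-! ### The two kinds of updates -/

/-- The program that puts the endpoints of the updated edge on the stack and restores the level
conditions. -/
def inspect : Cmd :=
  .setCell 5 (.lit 0) (.reg 3) ;;
  .setCell 5 (.lit 1) (.reg 4) ;;
  8 ⟵ .lit 2 ;;
  stabilise

/-- The program that sorts the endpoints of the updated edge by their levels. -/
def orient : Cmd :=
  .cond (.cell 2 (.reg 3) <ₑ .cell 2 (.reg 4))
    (9 ⟵ .reg 3 ;; 17 ⟵ .reg 4) (9 ⟵ .reg 4 ;; 17 ⟵ .reg 3)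

/-- The algorithm. -/
def alg : DynAlg where
  onInsert := setup ;; orient ;; colorLoop ;; inspect
  onDelete := setup ;; orient ;; 14 ⟵ .cell 0 (.reg 9 *ₑ .reg 0 +ₑ .reg 17) -ₑ .lit 1 ;;
    12 ⟵ .cell 2 (.reg 9) ;; edgeUpd .sub 9 17 12 14 (.lit 0) ;; inspect

/-- The memory between two updates: all edges of `G` are colored, and all level conditions hold.
The number `M` is three times the potential.  The registers with the derived parameters are set by
`setup` at the next update, and need not be set before the first one; therefore `rep` refers to all
memories with the same arrays in which these registers are set. -/
structure Good (p : Par) (Δ : ℕ) (G : SimpleGraph (Fin p.n)) (χ : ℕ → ℕ → ℕ) (ℓ : ℕ → ℕ) (M : ℕ)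
    (s : Store) : Prop where
  r0 : s.reg 0 = p.n
  r1 : s.reg 1 = p.α
  r2 : s.reg 2 = p.q
  rep : ∀ s' : Store, s'.arr = s.arr → Globals p s' → Rep p s' χ (minKey ℓ) ℓ
  col : IsCol p χ
  bound : ∀ u v, p.q * χ u v ≤ p.q * Δ + (4 * p.q + 1) * p.α
  supp : Supports χ G
  le : ∀ v, ℓ v ≤ p.L
  ok : ∀ v < p.n, LevelOk p χ ℓ v
  eq : (M : ℤ) = 3 * pot p χ ℓ

/-- The amortized time of an update, of the order of `k L q`. -/
def Par.budget (p : Par) : ℕ := 100000 * ((p.k + 1) * ((p.L + 1) * p.q))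

theorem Par.Ok.budget_ge (hp : p.Ok) :
    600 * (p.k + 1) * (3 * (2 * p.L * (24 * p.q + 2)) + 2) + 900 * (p.k + 1) * (p.L + 1) + 700 ≤
      p.budget := by
  obtain ⟨q, hq⟩ := Nat.exists_eq_succ_of_ne_zero hp.q_pos.ne'
  unfold Par.budget
  rw [hq, Nat.succ_eq_add_one]
  have h1 : 100000 * ((p.k + 1) * ((p.L + 1) * (q + 1))) =
      600 * (p.k + 1) * (3 * (2 * p.L * (24 * (q + 1) + 2)) + 2) + 900 * (p.k + 1) * (p.L + 1) +
        (p.k + 1) * (13600 * (p.L * q) + 5500 * p.L + 100000 * q + 97900) := by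
    ring
  rw [h1]
  have h2 : 1 * 700 ≤ (p.k + 1) * (13600 * (p.L * q) + 5500 * p.L + 100000 * q + 97900) :=
    Nat.mul_le_mul (by omega) (by omega)
  omega

theorem Rep.of_arr {s s' : Store} {χ κ : ℕ → ℕ → ℕ} {ℓ : ℕ → ℕ} (h : Rep p s χ κ ℓ)
    (ha : s'.arr = s.arr) (hg : Globals p s') : Rep p s' χ κ ℓ where
  glob := hg
  col := by rw [ha]; exact h.col
  own := by rw [ha]; exact h.own
  lev := by rw [ha]; exact h.lev
  tree v hv j hj := by rw [ha]; exact h.tree v hv j hj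

theorem inspect_spec (hp : p.Ok) {s : Store} {χ χ' : ℕ → ℕ → ℕ} {ℓ : ℕ → ℕ} {u v M : ℕ}
    (hR : Rep p s χ' (minKey ℓ) ℓ) (hχ' : IsCol p χ') (hu : u < p.n) (hv : v < p.n)
    (h3 : s.reg 3 = u) (h4 : s.reg 4 = v) (hℓ : ∀ v, ℓ v ≤ p.L)
    (hok : ∀ w < p.n, LevelOk p χ ℓ w) (hM : (M : ℤ) = 3 * pot p χ ℓ)
    (hsame : ∀ w i, w ≠ u → w ≠ v → upDeg p χ' ℓ i w = upDeg p χ ℓ i w)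
    (hle : ∀ w i, upDeg p χ ℓ i w ≤ upDeg p χ' ℓ i w + 1)
    (hle' : ∀ w i, upDeg p χ' ℓ i w ≤ upDeg p χ ℓ i w + 1) :
    wp p.W inspect s fun s' t =>
      ∃ (ℓ' : ℕ → ℕ) (M' : ℕ), Rep p s' χ' (minKey ℓ') ℓ' ∧ (∀ v, ℓ' v ≤ p.L) ∧
        (∀ v < p.n, LevelOk p χ' ℓ' v) ∧ (M' : ℤ) = 3 * pot p χ' ℓ' ∧
        t + 600 * (p.k + 1) * M' ≤ 600 * (p.k + 1) * M +
          (600 * (p.k + 1) * (3 * (2 * p.L * (24 * p.q + 2)) + 2) + 20) := by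
  have h8 := hp.eight
  apply wp_seq
  apply wp_setCell (eval_lit (by omega)) (eval_reg h3)
  apply wp_seq
  apply wp_setCell (x := v) (eval_lit (by omega)) (eval_reg (by simp [h4]))
  apply wp_seq
  apply wp_setReg (eval_lit (by omega))
  set s₁ := ((s.writeCell 5 0 u).writeCell 5 1 v).writeReg 8 2 with hs₁
  have h8₁ : s₁.reg 8 = 2 := by simp [hs₁]
  have h50 : s₁.arr 5 0 = u := by simp [hs₁, Store.arr_writeCell]
  have h51 : s₁.arr 5 1 = v := by simp [hs₁, Store.arr_writeCell]
  have hpot := pot_nonneg (p := p) χ' hℓ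
  have hle_pot := pot_le_of_close hℓ hsame hle hle'
  have hmax := pot_le (p := p) χ' hℓ
  obtain ⟨M₁, hM₁⟩ : ∃ M₁ : ℕ, (M₁ : ℤ) = 2 + 3 * pot p χ' ℓ :=
    ⟨(2 + 3 * pot p χ' ℓ).toNat, Int.toNat_of_nonneg (by omega)⟩
  have hI : StabInv p χ' ℓ M₁ s₁ := by
    refine ⟨hR.frame ?_ ?_, hℓ, ?_, ?_, ?_, ?_⟩
    · intro r hr
      simp [hs₁, show r ≠ 8 by omega]
    · intro a ha
      simp only [hs₁, Store.arr_writeReg, Store.arr_writeCell_of_ne _ _ _ (show a ≠ 5 by omega)]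
    · intro w hw
      by_cases hwu : w = u
      · exact Or.inr ⟨0, by omega, by rw [h50, hwu]⟩
      by_cases hwv : w = v
      · exact Or.inr ⟨1, by omega, by rw [h51, hwv]⟩
      left
      unfold LevelOk
      rw [hsame w _ hwu hwv, hsame w _ hwu hwv]
      exact hok w hw
    · intro j hj
      rw [h8₁] at hj
      interval_cases j
      · rwa [h50]
      · rwa [h51]
    · rw [h8₁, hM₁]
      norm_num
    · unfold Par.cap
      omega
  refine wp_mono (stabilise_spec hp hχ' hI) ?_
  rintro s' t ⟨ℓ', M', h1, h2, h3, h4, h5⟩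
  refine ⟨ℓ', M', h1, h2, h3, h4, ?_⟩
  have h6 : M₁ ≤ M + (3 * (2 * p.L * (24 * p.q + 2)) + 2) := by omega
  have h7 := Nat.mul_le_mul_left (600 * (p.k + 1)) h6
  rw [Nat.mul_add (600 * (p.k + 1)) M] at h7
  simp only [Expr.cost]
  omega

theorem orient_spec {W : ℕ} {s : Store} {ℓ : ℕ → ℕ} {u v : ℕ} (h3 : s.reg 3 = u)
    (h4 : s.reg 4 = v) (hu : s.arr 2 u = ℓ u) (hv : s.arr 2 v = ℓ v) :
    wp W orient s fun s' t =>
      s'.arr = s.arr ∧ (∀ r < 9, s'.reg r = s.reg r) ∧ t ≤ 15 ∧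
      ∃ a b, s'.reg 9 = a ∧ s'.reg 17 = b ∧ ℓ a ≤ ℓ b ∧ ((a = u ∧ b = v) ∨ (a = v ∧ b = u)) := by
  have htest : (.cell 2 (.reg 3) <ₑ .cell 2 (.reg 4) : Expr).eval W s =
      if ℓ u < ℓ v then 1 else 0 :=
    eval_lt (eval_cell (eval_reg h3) hu) (eval_cell (eval_reg h4) hv)
  apply wp_cond
  all_goals
    intro hc
    rw [htest] at hc
    apply wp_seq
    apply wp_setReg rfl
    apply wp_setReg rfl
    refine ⟨by simp, fun r hr => by simp [show r ≠ 9 by omega, show r ≠ 17 by omega], ?_, ?_⟩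
    · simp only [Expr.cost]
      omega
  · refine ⟨u, v, by simp [Expr.eval, h3], by simp [Expr.eval, h4], ?_, Or.inl ⟨rfl, rfl⟩⟩
    by_contra hcon
    rw [if_neg (by omega)] at hc
    exact hc rfl
  · refine ⟨v, u, by simp [Expr.eval, h4], by simp [Expr.eval, h3], ?_, Or.inr ⟨rfl, rfl⟩⟩
    by_contra hcon
    rw [if_pos (by omega)] at hc
    omega

theorem setPair_ne_zero {χ : ℕ → ℕ → ℕ} {a b x : ℕ} (hx : x ≠ 0) (u v : ℕ) :
    setPair χ a b x u v ≠ 0 ↔ χ u v ≠ 0 ∨ ((u = a ∧ v = b) ∨ (u = b ∧ v = a)) := by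
  unfold setPair
  split_ifs with h
  · simp [h, hx]
  · simp [h]

theorem pair_cases {n a b : ℕ} {u v : Fin n}
    (h : (a = u ∧ b = v) ∨ (a = v ∧ b = u)) (x y : Fin n) :
    (((x : ℕ) = a ∧ (y : ℕ) = b) ∨ ((x : ℕ) = b ∧ (y : ℕ) = a)) ↔
      ((x = u ∧ y = v) ∨ (x = v ∧ y = u)) := by
  simp only [Fin.ext_iff]
  omega

open Classical in
/-- The coloring precedes the changes of levels.  So the level conditions hold for the graph without
the new edge, and with it, the numbers of neighbors exceed the upper threshold at most by one.  This
is made up for by the pending edge itself, which forbids no color. -/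
theorem insert_spec (hp : p.Ok) {Δ : ℕ} {G : SimpleGraph (Fin p.n)} {χ : ℕ → ℕ → ℕ} {ℓ : ℕ → ℕ}
    {M : ℕ} {s : Store} (hs : Good p Δ G χ ℓ M s) (hG : ArboricityLE G p.α) {u v : Fin p.n}
    (huv : u ≠ v) (hadj : ¬ G.Adj u v) (hΔ : (G ⊔ SimpleGraph.edge u v).maxDegree ≤ Δ) :
    wp p.W alg.onInsert (feed s (.insert u v)) fun s' t =>
      ∃ χ' ℓ' M', Good p Δ (G ⊔ SimpleGraph.edge u v) χ' ℓ' M' s' ∧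
        changes p.n χ χ' ≤ 2 * p.L + 1 ∧
        t + 600 * (p.k + 1) * M' ≤ 600 * (p.k + 1) * M + p.budget := by
  set s₀ := feed s (.insert u v) with hs₀
  have hreg₀ : ∀ r < 3, s₀.reg r = s.reg r := by
    intro r hr
    simp [hs₀, feed, show r ≠ 3 by omega, show r ≠ 4 by omega]
  apply wp_seq
  refine wp_mono (setup_spec hp (by rw [hreg₀ 0 (by omega), hs.r0])
    (by rw [hreg₀ 1 (by omega), hs.r1]) (by rw [hreg₀ 2 (by omega), hs.r2])) ?_
  rintro s₁ t₁ ⟨hg₁, harr₁, h3₁, h4₁, ht₁⟩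
  have hR₁ : Rep p s₁ χ (minKey ℓ) ℓ := hs.rep s₁ (by rw [harr₁]; rfl) hg₁
  replace h3₁ : s₁.reg 3 = u := by rw [h3₁]; simp [hs₀, feed]
  replace h4₁ : s₁.reg 4 = v := by rw [h4₁]; simp [hs₀, feed]
  apply wp_seq
  refine wp_mono (orient_spec h3₁ h4₁ (hR₁.lev u u.2) (hR₁.lev v v.2)) ?_
  rintro s₂ t₂ ⟨harr₂, hreg₂, ht₂, a, b, h9, h17, hab, hcases⟩
  have hR₂ : Rep p s₂ χ (minKey ℓ) ℓ :=
    hR₁.of_arr harr₂ (hg₁.frame fun r hr => hreg₂ r (by omega))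
  have huvn : (u : ℕ) ≠ v := fun h => huv (Fin.ext h)
  set ψ := setPair χ a b 1 with hψ
  have hne : a ≠ b := by omega
  have hzero : χ a b = 0 := by
    by_contra hcon
    rcases hcases with ⟨rfl, rfl⟩ | ⟨rfl, rfl⟩
    · exact hadj ((hs.supp u v).1 hcon)
    · exact hadj ((hs.supp v u).1 hcon).symm
  have hψsupp : ∀ x y, ψ x y ≠ 0 ↔ χ x y ≠ 0 ∨ ((x = a ∧ y = b) ∨ (x = b ∧ y = a)) :=
    setPair_ne_zero one_ne_zero
  have hpend : Pending p χ ψ ℓ (p.q * Δ + (4 * p.q + 1) * p.α) a b :=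
    ⟨hs.col, hs.bound, hne, by omega, by omega, hzero, hab, hψsupp⟩
  have hψG : Supports ψ (G ⊔ SimpleGraph.edge u v) := by
    intro x y
    rw [hψsupp, pair_cases hcases, hs.supp, SimpleGraph.sup_adj, SimpleGraph.edge_adj]
    constructor
    · rintro (h | h)
      · exact Or.inl h
      · refine Or.inr ⟨by tauto, ?_⟩
        rcases h with ⟨rfl, rfl⟩ | ⟨rfl, rfl⟩
        · exact huv
        · exact huv.symm
    · rintro (h | ⟨h, _⟩)
      · exact Or.inl h
      · exact Or.inr (by tauto)
  obtain ⟨hc1, hc2, hc3⟩ := upDeg_close (p := p) hne hψsupp ℓ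
  have hdeg : ∀ w < p.n, upDeg p ψ ℓ 0 w ≤ Δ := by
    intro w hw
    refine le_trans ?_ ((SimpleGraph.degree_le_maxDegree _ (⟨w, hw⟩ : Fin p.n)).trans hΔ)
    rw [← SimpleGraph.card_neighborFinset_eq_degree]
    rw [show upDeg p ψ ℓ 0 w = _ from upDeg_eq_card hψG ℓ 0 ⟨w, hw⟩]
    apply le_of_eq
    congr 1
    ext x
    simp [levelSet]
  have hup : ∀ w < p.n, p.q * upDeg p ψ ℓ (ℓ w) w ≤ (4 * p.q + 1) * p.α + p.q := by
    intro w hw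
    have h1 := (hs.ok w hw).1 (level_lt_top hp hs.supp hG hs.ok hw)
    have h2 := Nat.mul_le_mul_left p.q (hc3 w (ℓ w))
    rw [mul_add] at h2
    omega
  apply wp_seq
  refine wp_mono (colorLoop_spec hp hR₂ h9 h17 hpend hs.le hdeg hup rfl) ?_
  rintro s₃ t₃ ⟨χ', hR₃, hreg₃, hset, hrec, ht₃⟩
  have hψχ : ∀ i w, upDeg p χ' ℓ i w = upDeg p ψ ℓ i w := by
    intro i w
    apply upDeg_congr
    intro x
    rw [hset.supp]
  refine wp_mono (inspect_spec (u := u) (v := v) (χ := χ) hp hR₃ hset.col u.2 v.2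
    (by rw [hreg₃ 3 (by omega), hreg₂ 3 (by omega), h3₁])
    (by rw [hreg₃ 4 (by omega), hreg₂ 4 (by omega), h4₁]) hs.le hs.ok hs.eq ?_ ?_ ?_) ?_
  · intro w i h1 h2
    rw [hψχ]
    exact hc1 w i (by omega) (by omega)
  · intro w i
    rw [hψχ]
    exact (hc2 w i).trans (Nat.le_succ _)
  · intro w i
    rw [hψχ]
    exact hc3 w i
  · rintro s₄ t₄ ⟨ℓ', M', hR₄, hle, hok, heq, ht₄⟩
    refine ⟨χ', ℓ', M', ⟨hR₄.glob.r0, hR₄.glob.r1, hR₄.glob.r2,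
      fun s' h1 h2 => hR₄.of_arr h1 h2, hset.col, hset.bound, ?_, hle, hok, heq⟩, hrec, ?_⟩
    · intro x y
      rw [← hset.supp]
      exact hψG x y
    · have h1 := hp.budget_ge
      have h2 : 900 * (p.k + 1) * (p.L + 1) =
          810 * (p.k + 1) * (p.L + 1) + 90 * ((p.k + 1) * (p.L + 1)) := by ring
      have h3 : (p.k + 1) * 1 ≤ (p.k + 1) * (p.L + 1) := Nat.mul_le_mul_left _ (by omega)
      omega

theorem delete_spec (hp : p.Ok) {Δ : ℕ} {G : SimpleGraph (Fin p.n)} {χ : ℕ → ℕ → ℕ} {ℓ : ℕ → ℕ}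
    {M : ℕ} {s : Store} (hs : Good p Δ G χ ℓ M s) {u v : Fin p.n} (hadj : G.Adj u v) :
    wp p.W alg.onDelete (feed s (.delete u v)) fun s' t =>
      ∃ χ' ℓ' M', Good p Δ (G.deleteEdges {s(u, v)}) χ' ℓ' M' s' ∧
        changes p.n χ χ' ≤ 2 * p.L + 1 ∧
        t + 600 * (p.k + 1) * M' ≤ 600 * (p.k + 1) * M + p.budget := by
  have h8 := hp.eight
  have h2n := p.two_n_le
  set s₀ := feed s (.delete u v) with hs₀
  have hreg₀ : ∀ r < 3, s₀.reg r = s.reg r := by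
    intro r hr
    simp [hs₀, feed, show r ≠ 3 by omega, show r ≠ 4 by omega]
  apply wp_seq
  refine wp_mono (setup_spec hp (by rw [hreg₀ 0 (by omega), hs.r0])
    (by rw [hreg₀ 1 (by omega), hs.r1]) (by rw [hreg₀ 2 (by omega), hs.r2])) ?_
  rintro s₁ t₁ ⟨hg₁, harr₁, h3₁, h4₁, ht₁⟩
  have hR₁ : Rep p s₁ χ (minKey ℓ) ℓ := hs.rep s₁ (by rw [harr₁]; rfl) hg₁
  replace h3₁ : s₁.reg 3 = u := by rw [h3₁]; simp [hs₀, feed]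
  replace h4₁ : s₁.reg 4 = v := by rw [h4₁]; simp [hs₀, feed]
  apply wp_seq
  refine wp_mono (orient_spec h3₁ h4₁ (hR₁.lev u u.2) (hR₁.lev v v.2)) ?_
  rintro s₂ t₂ ⟨harr₂, hreg₂, ht₂, a, b, h9, h17, hab, hcases⟩
  have hR₂ : Rep p s₂ χ (minKey ℓ) ℓ :=
    hR₁.of_arr harr₂ (hg₁.frame fun r hr => hreg₂ r (by omega))
  have huvn : (u : ℕ) ≠ v := fun h => hadj.ne (Fin.ext h)
  have hne : a ≠ b := by omega
  have ha : a < p.n := by omega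
  have hb : b < p.n := by omega
  have hpos : χ a b ≠ 0 := by
    rcases hcases with ⟨rfl, rfl⟩ | ⟨rfl, rfl⟩
    · exact (hs.supp u v).2 hadj
    · exact (hs.supp v u).2 hadj.symm
  obtain ⟨c, hc⟩ := Nat.exists_eq_succ_of_ne_zero hpos
  rw [Nat.succ_eq_add_one] at hc
  have hck : c < 2 ^ p.k := by
    have := hs.col.le a b
    omega
  obtain ⟨hm1, hm2⟩ := hp.index_lt ha (show p.n ≤ 2 ^ p.k by omega) (show b ≤ 2 ^ p.k by omega)
  apply wp_seq
  apply wp_setReg (x := c) (by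
    rw [eval_sub (eval_cell (eval_add (eval_mul (eval_reg h9) (eval_reg hR₂.glob.r0) hm1)
      (eval_reg h17) hm2) (hR₂.col a ha b hb)) (eval_lit (by omega)), hc]
    rfl)
  apply wp_seq
  apply wp_setReg (x := ℓ a) (eval_cell (x := a) (eval_reg (by simp [h9]))
    (by simpa using hR₂.lev a ha))
  set s₃ := (s₂.writeReg 14 c).writeReg 12 (ℓ a) with hs₃
  have hreg₃ : ∀ r, r ≠ 12 → r ≠ 14 → s₃.reg r = s₂.reg r := by
    intro r h1 h2
    simp [hs₃, h1, h2]
  have hR₃ : Rep p s₃ χ (minKey ℓ) ℓ :=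
    hR₂.frame (fun r hr => hreg₃ r (by omega) (by omega)) (by simp [hs₃])
  set χ' := setPair χ a b 0 with hχ'
  have hcol : IsCol p χ' := hs.col.setPair_zero a b
  apply wp_seq
  refine wp_mono (edgeUpd_spec hp hR₃ (o := .sub) (ra := 9) (rb := 17) (rm := 12) (rc := 14)
      (ex := .lit 0) (x := 0) (by omega) (by omega) (by omega) (by omega)
      (by rw [hreg₃ 9 (by omega) (by omega), h9]) (by rw [hreg₃ 17 (by omega) (by omega), h17])
      (m := ℓ a) (by simp [hs₃]) (c := c) (by simp [hs₃])
      (fun s' _ => eval_lit (by omega)) (by simp [Expr.cost]) ha hb hne (hs.le a)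
      (min_eq_left hab) (min_eq_right hab) hck hs.col hcol (Or.inr ⟨rfl, hc, rfl⟩)) ?_
  rintro s₄ t₄ ⟨hreg₄, harr₄, hR₄, ht₄⟩
  have hsupp : ∀ x y, χ x y ≠ 0 ↔ χ' x y ≠ 0 ∨ ((x = a ∧ y = b) ∨ (x = b ∧ y = a)) := by
    intro x y
    rw [hχ']
    unfold setPair
    split_ifs with h
    · simp only [h, or_true, iff_true]
      rcases h with ⟨rfl, rfl⟩ | ⟨rfl, rfl⟩
      · exact hpos
      · rwa [hs.col.symm]
    · simp [h]
  obtain ⟨hc1, hc2, hc3⟩ := upDeg_close (p := p) hne hsupp ℓ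
  refine wp_mono (inspect_spec (u := u) (v := v) (χ := χ) hp hR₄ hcol u.2 v.2
    (by rw [hreg₄ 3 (by omega), hreg₃ 3 (by omega) (by omega), hreg₂ 3 (by omega), h3₁])
    (by rw [hreg₄ 4 (by omega), hreg₃ 4 (by omega) (by omega), hreg₂ 4 (by omega), h4₁])
    hs.le hs.ok hs.eq ?_ ?_ ?_) ?_
  · intro w i h1 h2
    exact (hc1 w i (by omega) (by omega)).symm
  · exact hc3
  · intro w i
    exact (hc2 w i).trans (Nat.le_succ _)
  · rintro s₅ t₅ ⟨ℓ', M', hR₅, hle, hok, heq, ht₅⟩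
    refine ⟨χ', ℓ', M', ⟨hR₅.glob.r0, hR₅.glob.r1, hR₅.glob.r2,
      fun s' h1 h2 => hR₅.of_arr h1 h2, hcol, ?_, ?_, hle, hok, heq⟩, ?_, ?_⟩
    · intro x y
      rw [hχ']
      unfold setPair
      split_ifs
      · simp
      · exact hs.bound x y
    · intro x y
      rw [SimpleGraph.deleteEdges_adj, Set.mem_singleton_iff, Sym2.eq_iff, ← pair_cases hcases,
        ← hs.supp x y, hχ']
      unfold setPair
      split_ifs with h
      · simp [h]
      · simp [h]
    · exact (changes_setPair p.n χ a b 0).trans (by omega)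
    · have h1 := hp.budget_ge
      have h2 : (p.k + 1) * 1 ≤ (p.k + 1) * (p.L + 1) := Nat.mul_le_mul_left _ (by omega)
      have h3 : 900 * (p.k + 1) * (p.L + 1) = 900 * ((p.k + 1) * (p.L + 1)) := by ring
      simp only [Expr.cost]
      omega

/-! ### Whole sequences of updates -/

theorem graphAt_succ {n : ℕ} (us : List (Update n)) (t : Fin us.length) :
    graphAt us (t + 1) = (us.get t).apply (graphAt us t) := by
  unfold graphAt
  rw [List.take_succ_eq_append_getElem t.2, List.foldl_append]
  rfl

theorem graphAt_zero {n : ℕ} (us : List (Update n)) : graphAt us 0 = ⊥ := rfl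

open Classical in
theorem maxDegree_graphAt_le {n : ℕ} (us : List (Update n)) {t : ℕ} (ht : t ≤ us.length) :
    (graphAt us t).maxDegree ≤ maxDegreeOver us := by
  unfold maxDegreeOver
  exact Finset.le_sup (f := fun t => (graphAt us t).maxDegree) (Finset.mem_range.2 (by omega))

/-- A sequence with an update has at least two vertices, an arboricity bound that is not zero and an
edge. -/
theorem nontrivial_of_legal {n α : ℕ} {us : List (Update n)} (hus : 0 < us.length)
    (hlegal : LegalSeq us) (hα : ∀ t ≤ us.length, ArboricityLE (graphAt us t) α) :
    2 ≤ n ∧ 1 ≤ α ∧ 1 ≤ maxDegreeOver us := by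
  classical
  have h0 := hlegal ⟨0, hus⟩
  have h1 := graphAt_succ us ⟨0, hus⟩
  simp only [graphAt_zero, zero_add] at h0 h1
  obtain ⟨u, v, huv, hadj⟩ : ∃ u v : Fin n, u ≠ v ∧ (graphAt us 1).Adj u v := by
    cases hu : us.get ⟨0, hus⟩ with
    | insert u v =>
      rw [hu] at h0 h1
      refine ⟨u, v, h0.1, ?_⟩
      rw [h1, Update.apply, SimpleGraph.sup_adj, SimpleGraph.edge_adj]
      exact Or.inr ⟨Or.inl ⟨rfl, rfl⟩, h0.1⟩
    | delete u v =>
      rw [hu] at h0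
      exact absurd h0 (by simp [Update.Legal])
  refine ⟨?_, ?_, ?_⟩
  · by_contra hcon
    exact huv (Fin.ext (by omega))
  · by_contra hcon
    have h2 := sum_inner_degree_le (hα 1 hus) Finset.univ
    rw [show α = 0 by omega, mul_zero, zero_mul, Nat.le_zero, Finset.sum_eq_zero_iff] at h2
    have h3 := h2 u (Finset.mem_univ u)
    rw [Finset.card_eq_zero, Finset.filter_eq_empty_iff] at h3
    exact h3 (Finset.mem_univ v) hadj
  · refine le_trans ?_ (maxDegree_graphAt_le us hus)
    refine le_trans ?_ (SimpleGraph.degree_le_maxDegree _ u)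
    exact (SimpleGraph.degree_pos_iff_exists_adj _ u).2 ⟨v, hadj⟩

/-- A sequence of states can be built step by step. -/
theorem exists_seq {σ : Type*} (P : ℕ → σ → Prop) (R : ℕ → σ → σ → ℕ → Prop) {s₀ : σ} {T : ℕ}
    (h0 : P 0 s₀) (step : ∀ t < T, ∀ s, P t s → ∃ s' τ, R t s s' τ ∧ P (t + 1) s') :
    ∃ (s : ℕ → σ) (τ : ℕ → ℕ), s 0 = s₀ ∧ (∀ t ≤ T, P t (s t)) ∧
      ∀ t < T, R t (s t) (s (t + 1)) (τ t) := by
  classical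
  choose! f g hR hP using step
  let s : ℕ → σ := fun t => Nat.rec s₀ (fun t x => f t x) t
  have hs : ∀ t ≤ T, P t (s t) := by
    intro t
    induction t with
    | zero => exact fun _ => h0
    | succ t ih => exact fun ht => hP t (by omega) _ (ih (by omega))
  exact ⟨s, fun t => g t (s t), rfl, hs, fun t ht => hR t ht _ (hs t ht.le)⟩

theorem good_init (p : Par) (Δ : ℕ) :
    Good p Δ ⊥ (fun _ _ => 0) (fun _ => 0) 0 (initStore p.n p.α p.q) where
  r0 := rfl
  r1 := rfl
  r2 := rfl
  rep s' ha hg := by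
    refine ⟨hg, ?_, ?_, ?_, ?_⟩
    · intro u _ v _
      rw [ha]
      rfl
    · intro u v c h
      omega
    · intro v _
      rw [ha]
      rfl
    · intro v _ j _ h _ x _ _
      have hempty : slotSet p (fun _ _ => 0) (minKey fun _ => 0) v j = ∅ := by
        simp [slotSet]
      rw [ha, hempty]
      simp [cnt, initStore]
  col := ⟨fun _ _ => rfl, fun _ => rfl, fun _ _ h => absurd rfl h, fun _ _ => Nat.zero_le _,
    fun _ _ _ h => absurd rfl h⟩
  bound _ _ := by simp
  supp _ _ := by simp
  le _ := Nat.zero_le _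
  ok v _ := by
    have h : ∀ i, upDeg p (fun _ _ => 0) (fun _ => 0) i v = 0 := fun i => by simp [upDeg, upNbrs]
    refine ⟨fun _ => ?_, fun h => absurd h (lt_irrefl 0)⟩
    rw [h]
    simp
  eq := by simp [pot, vpot, upDeg, upNbrs]

/-- A word length that is logarithmic in the parameters suffices. -/
theorem Par.ok_of_le {n α q W : ℕ} (hn : 2 ≤ n) (hα : 1 ≤ α) (hq : 2 ≤ q)
    (hW : (n + α + q) ^ 14 ≤ W) : Par.Ok ⟨n, α, q, W⟩ := by
  set p : Par := ⟨n, α, q, W⟩ with hp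
  set N := n + α + q with hN
  have hN5 : 5 ≤ N := by omega
  have hmono : ∀ {i j : ℕ}, i ≤ j → N ^ i ≤ N ^ j := fun h => Nat.pow_le_pow_right (by omega) h
  have hmul : ∀ {a b i j : ℕ}, a ≤ N ^ i → b ≤ N ^ j → a * b ≤ N ^ (i + j) := fun ha hb => by
    rw [pow_add]
    exact Nat.mul_le_mul ha hb
  have hadd : ∀ {a b i : ℕ}, a ≤ N ^ i → b ≤ N ^ i → a + b ≤ N ^ (i + 1) := fun ha hb => by
    rw [pow_succ]
    nlinarith
  have hpos : ∀ i, 1 ≤ N ^ i := fun i => Nat.one_le_pow _ _ (by omega)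
  have h25 : 25 ≤ N ^ 2 := by nlinarith
  have hn1 : n ≤ N ^ 1 := by rw [pow_one]; omega
  have hα1 : α ≤ N ^ 1 := by rw [pow_one]; omega
  have hq1 : q ≤ N ^ 1 := by rw [pow_one]; omega
  have h51 : 5 ≤ N ^ 1 := by rw [pow_one]; exact hN5
  have hkpow : 2 ^ p.k ≤ N ^ 2 := by
    have h1 : 2 ^ (Nat.clog 2 (2 * n)).pred < 2 * n :=
      Nat.pow_pred_clog_lt_self (by norm_num) (by omega)
    have h2 : 0 < Nat.clog 2 (2 * n) := Nat.clog_pos (by norm_num) (by omega)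
    have h3 : 2 ^ Nat.clog 2 (2 * n) = 2 * 2 ^ (Nat.clog 2 (2 * n)).pred := by
      rw [← pow_succ']
      congr 1
      exact (Nat.succ_pred_eq_of_pos h2).symm
    have h4 : p.k = Nat.clog 2 (2 * n) := rfl
    rw [h4, h3]
    nlinarith
  have hk : p.k ≤ N ^ 2 := Nat.lt_two_pow_self.le.trans hkpow
  have hL : p.L ≤ N ^ 5 := by
    have h1 : 8 * p.q ≤ N ^ 3 := (hmul (show 8 ≤ N ^ 2 by omega) hq1)
    exact hmul h1 hk
  have hL2 : p.L + 2 ≤ N ^ 6 := hadd hL ((show 2 ≤ N ^ 1 by omega).trans (hmono (by omega)))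
  have hslots : n * (p.L + 2) ≤ N ^ 7 := by
    have := hmul hn1 hL2
    simpa using this
  have h2P : 2 * 2 ^ p.k ≤ N ^ 3 := by
    have := hmul (show 2 ≤ N ^ 1 by omega) hkpow
    simpa using this
  have hlt : ∀ {a i : ℕ}, i < 14 → a ≤ N ^ i → a < W := by
    intro a i hi ha
    have h1 : N ^ i < N ^ 14 := Nat.pow_lt_pow_right (by omega) hi
    omega
  have hH : (4 * q + 1) * α ≤ N ^ 4 := by
    have h1 : 4 * q ≤ N ^ 2 := by
      have := hmul (show 4 ≤ N ^ 1 by omega) hq1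
      simpa using this
    exact hmul (hadd h1 (hpos 2)) hα1
  refine ⟨by change 0 < n; omega, hα, by change 0 < q; omega, ⟨?_, ?_⟩, ?_, ?_, ?_⟩
  · exact hlt (i := 2) (by omega) (by omega)
  · have h1 : n * (p.L + 2) * (2 * 2 ^ p.k) ≤ N ^ 10 := hmul hslots h2P
    exact hlt (i := 11) (by omega) (hadd h1 (h2P.trans (hmono (by omega))))
  · exact hlt (i := 7) (by omega) hslots
  · have h1 : p.L * (24 * ((4 * q + 1) * α)) ≤ N ^ 11 := by
      have := hmul hL (hmul (show 24 ≤ N ^ 2 by omega) hH)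
      simpa using this
    have h2 : p.L * n ≤ N ^ 11 := (hmul hL hn1).trans (hmono (by omega))
    have h3 : p.L * n + p.L * (24 * ((4 * q + 1) * α)) ≤ 2 * N ^ 11 := by omega
    have h4 : 3 * (n * (p.L * n + p.L * (24 * ((4 * q + 1) * α)))) + 10 < N ^ 14 := by
      have h5 : n * (p.L * n + p.L * (24 * ((4 * q + 1) * α))) ≤ N * (2 * N ^ 11) :=
        Nat.mul_le_mul (by omega) h3
      have h6 : N ^ 14 = N ^ 2 * N ^ 12 := by ring
      have h7 : N * (2 * N ^ 11) = 2 * N ^ 12 := by ring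
      have h8 : 25 * N ^ 12 ≤ N ^ 2 * N ^ 12 := Nat.mul_le_mul_right _ h25
      have h9 := hpos 12
      omega
    exact lt_of_lt_of_le h4 hW
  · have h1 : 4 * q * (2 * n) ≤ N ^ 4 := by
      have := hmul (hmul (show 4 ≤ N ^ 1 by omega) hq1) (hmul (show 2 ≤ N ^ 1 by omega) hn1)
      simpa using this
    have h2 : (8 * q + 1) * α ≤ N ^ 5 := by
      have h3 : 8 * q ≤ N ^ 3 := hmul (show 8 ≤ N ^ 2 by omega) hq1
      exact hmul (hadd h3 (hpos 3)) hα1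
    exact hlt (i := 6) (by omega) (hadd (h1.trans (hmono (by omega))) h2)

theorem Good.coloring_eq {Δ M : ℕ} {G : SimpleGraph (Fin p.n)} {χ : ℕ → ℕ → ℕ} {ℓ : ℕ → ℕ}
    {s : Store} (h : Good p Δ G χ ℓ M s) : coloring p.n s = fun u v : Fin p.n => χ u v := by
  -- Only the arrays matter, so the derived parameters may be written into the registers.
  let s' : Store := ⟨fun r => if r = 0 then p.n else if r = 1 then p.α else if r = 2 then p.q else
    if r = 5 then p.k else if r = 6 then 2 ^ p.k else p.L, s.arr⟩
  have hR := h.rep s' rfl ⟨rfl, rfl, rfl, rfl, rfl, rfl⟩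
  funext u v
  exact hR.col u u.2 v v.2

theorem Good.isEdgeColoring {Δ M : ℕ} {G : SimpleGraph (Fin p.n)} {χ : ℕ → ℕ → ℕ} {ℓ : ℕ → ℕ}
    {s : Store} (h : Good p Δ G χ ℓ M s) (hq : 0 < p.q) {ε : ℝ} (hε : 1 / (p.q : ℝ) ≤ ε) :
    IsEdgeColoring G ((Δ : ℝ) + (4 + ε) * p.α) (coloring p.n s) := by
  rw [h.coloring_eq]
  have hq' : (0 : ℝ) < p.q := by exact_mod_cast hq
  refine ⟨fun u v => h.col.symm u v, ?_, ?_, ?_⟩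
  · intro u v
    rw [← h.supp]
    simp
  · intro u v _
    have h1 : (p.q : ℝ) * χ u v ≤ p.q * Δ + (4 * p.q + 1) * p.α := by
      exact_mod_cast h.bound u v
    have h2 : (p.q : ℝ) * χ u v ≤ p.q * (Δ + (4 + 1 / p.q) * p.α) := by
      refine h1.trans (le_of_eq ?_)
      field_simp
    have h3 := le_of_mul_le_mul_left h2 hq'
    refine h3.trans ?_
    gcongr
  · intro u v v' h1 h2 h3 h4
    exact h3 (Fin.ext (h.col.proper u v v' ((h.supp u v).2 h1) h4))

open Classical in
theorem update_spec (hp : p.Ok) {Δ M : ℕ} {G : SimpleGraph (Fin p.n)} {s : Store}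
    (hs : ∃ χ ℓ, Good p Δ G χ ℓ M s) (hG : ArboricityLE G p.α) {a : Update p.n}
    (hlegal : a.Legal G) (hΔ : (a.apply G).maxDegree ≤ Δ) :
    ∃ (s' : Store) (τ M' : ℕ), Exec p.W (alg.handler a) (feed s a) τ s' ∧
      (∃ χ ℓ, Good p Δ (a.apply G) χ ℓ M' s') ∧
      recourse (coloring p.n s) (coloring p.n s') ≤ 2 * p.L + 1 ∧
      τ + 600 * (p.k + 1) * M' ≤ 600 * (p.k + 1) * M + p.budget := by
  obtain ⟨χ, ℓ, hs⟩ := hs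
  have key : wp p.W (alg.handler a) (feed s a) fun s' t =>
      ∃ χ' ℓ' M', Good p Δ (a.apply G) χ' ℓ' M' s' ∧ changes p.n χ χ' ≤ 2 * p.L + 1 ∧
        t + 600 * (p.k + 1) * M' ≤ 600 * (p.k + 1) * M + p.budget := by
    cases a with
    | insert u v => exact insert_spec hp hs hG hlegal.1 hlegal.2 (by convert hΔ; rfl)
    | delete u v => exact delete_spec hp hs hlegal
  obtain ⟨τ, s', hexec, χ', ℓ', M', hgood, hrec, htime⟩ := key
  refine ⟨s', τ, M', hexec, ⟨χ', ℓ', hgood⟩, ?_, htime⟩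
  rw [hs.coloring_eq, hgood.coloring_eq]
  exact hrec

/-- The running times telescope: three times the potential, scaled by `600 (k + 1)`, is zero at the
start and never negative. -/
theorem run_exists {us : List (Update p.n)} (hp : 0 < us.length → p.Ok) (hlegal : LegalSeq us)
    (hα : ∀ t ≤ us.length, ArboricityLE (graphAt us t) p.α) :
    ∃ (s : ℕ → Store) (τ : ℕ → ℕ), s 0 = initStore p.n p.α p.q ∧
      (∀ t : Fin us.length,
        Exec p.W (alg.handler (us.get t)) (feed (s t) (us.get t)) (τ t) (s (t + 1))) ∧
      (∀ t ≤ us.length, ∃ χ ℓ M, Good p (maxDegreeOver us) (graphAt us t) χ ℓ M (s t)) ∧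
      (∀ t < us.length, recourse (coloring p.n (s t)) (coloring p.n (s (t + 1))) ≤ 2 * p.L + 1) ∧
      ∑ t ∈ Finset.range us.length, τ t ≤ us.length * p.budget := by
  classical
  obtain ⟨x, τ, h0, hP, hR⟩ := exists_seq (σ := Store × ℕ) (T := us.length)
    (s₀ := (initStore p.n p.α p.q, 0))
    (fun t x => ∃ χ ℓ, Good p (maxDegreeOver us) (graphAt us t) χ ℓ x.2 x.1)
    (fun t x x' τ => (∀ ht : t < us.length,
        Exec p.W (alg.handler (us.get ⟨t, ht⟩)) (feed x.1 (us.get ⟨t, ht⟩)) τ x'.1) ∧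
      recourse (coloring p.n x.1) (coloring p.n x'.1) ≤ 2 * p.L + 1 ∧
      τ + 600 * (p.k + 1) * x'.2 ≤ 600 * (p.k + 1) * x.2 + p.budget)
    ⟨_, _, good_init p _⟩ (by
      rintro t ht ⟨s, M⟩ hgood
      have hsucc := graphAt_succ us ⟨t, ht⟩
      have hΔ := maxDegree_graphAt_le us (Nat.succ_le_of_lt ht)
      simp only [Nat.succ_eq_add_one] at hΔ
      simp only at hsucc
      rw [hsucc] at hΔ
      obtain ⟨s', τ, M', h1, h2, h3, h4⟩ := update_spec (hp (by omega)) hgood (hα t ht.le)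
        (hlegal ⟨t, ht⟩) hΔ
      refine ⟨(s', M'), τ, ⟨fun _ => h1, h3, h4⟩, ?_⟩
      rw [hsucc]
      exact h2)
  refine ⟨fun t => (x t).1, τ, by simp [h0], fun t => (hR t t.2).1 t.2, ?_,
    fun t ht => (hR t ht).2.1, ?_⟩
  · intro t ht
    obtain ⟨χ, ℓ, h⟩ := hP t ht
    exact ⟨χ, ℓ, _, h⟩
  · have hsum : ∀ t ≤ us.length,
        ∑ i ∈ Finset.range t, τ i + 600 * (p.k + 1) * (x t).2 ≤ t * p.budget := by
      intro t
      induction t with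
      | zero => intro _; simp [h0]
      | succ t ih =>
        intro ht
        have h1 := ih (by omega)
        have h2 := (hR t (by omega)).2.2
        rw [Finset.sum_range_succ, Nat.succ_mul t p.budget]
        omega
    have := hsum _ le_rfl
    omega

/-! ### The bounds in terms of logarithms -/

/-- A simple lower bound for `log 2`, to absorb additive constants into logarithms. -/
theorem half_lt_log_two : 1 / 2 < Real.log 2 := by
  have := Real.log_two_gt_d9
  linarith

theorem Par.k_le_log {p : Par} (hn : 2 ≤ p.n) : (p.k : ℝ) ≤ 6 * Real.log p.n := by
  have h1 : 2 ^ p.k.pred < 2 * p.n := Nat.pow_pred_clog_lt_self (by norm_num) (by omega)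
  have h2 : 0 < p.k := Nat.clog_pos (by norm_num) (by omega)
  obtain ⟨k, hk⟩ := Nat.exists_eq_succ_of_ne_zero h2.ne'
  rw [hk, Nat.pred_succ] at h1
  have hn' : (2 : ℝ) ≤ p.n := by exact_mod_cast hn
  have h3 : (2 : ℝ) ^ k ≤ 2 * p.n := by exact_mod_cast h1.le
  have h4 := Real.log_le_log (by positivity) h3
  rw [Real.log_pow, Real.log_mul (by norm_num) (by positivity)] at h4
  have h5 := Real.log_le_log (by norm_num) hn'
  have h6 := half_lt_log_two
  rw [hk]
  push_cast
  nlinarith [Nat.cast_nonneg (α := ℝ) k]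

/-- The recourse and the amortized time in terms of `n` and `ε`, by `k = O(log n)` and
`q = O(1 / ε)`. -/
theorem Par.bounds {p : Par} (hn : 2 ≤ p.n) {ε : ℝ} (hε : 0 < ε) (hε1 : ε < 1)
    (hq : p.q = ⌈1 / ε⌉₊) :
    ((2 * p.L + 1 : ℕ) : ℝ) ≤ 200 * (Real.log p.n / ε) ∧
    ((p.budget : ℕ) : ℝ) ≤ 160000000 * (Real.log p.n ^ 2 / ε ^ 2) := by
  set l := Real.log p.n with hl
  have hk : (p.k : ℝ) ≤ 6 * l := Par.k_le_log hn
  have hl2 : 1 / 2 < l := by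
    have h1 := Real.log_le_log (by norm_num) (show (2 : ℝ) ≤ p.n by exact_mod_cast hn)
    have h2 := half_lt_log_two
    linarith
  set e := 1 / ε with he
  have he1 : 1 < e := by
    rw [he, lt_div_iff₀ hε]
    linarith
  have hqe : (p.q : ℝ) ≤ 2 * e := by
    rw [hq]
    have := Nat.ceil_lt_add_one (show 0 ≤ e by linarith)
    linarith
  have hL : (p.L : ℝ) ≤ 96 * (l * e) := by
    unfold Par.L
    push_cast
    calc 8 * (p.q : ℝ) * p.k ≤ 8 * (2 * e) * (6 * l) := by gcongr
      _ = 96 * (l * e) := by ring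
  have hle : 1 / 2 < l * e := by nlinarith
  have e1 : l / ε = l * e := by rw [he]; ring
  have e2 : l ^ 2 / ε ^ 2 = l * (l * e) * e := by rw [he]; ring
  rw [e1, e2]
  constructor
  · push_cast
    linarith
  · unfold Par.budget
    push_cast
    have h1 : (p.k : ℝ) + 1 ≤ 8 * l := by linarith
    have h2 : (p.L : ℝ) + 1 ≤ 98 * (l * e) := by linarith
    calc 100000 * (((p.k : ℝ) + 1) * ((p.L + 1) * p.q))
        ≤ 100000 * ((8 * l) * ((98 * (l * e)) * (2 * e))) := by gcongr
      _ = 156800000 * (l * (l * e) * e) := by ring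
      _ ≤ 160000000 * (l * (l * e) * e) := by
        have : 0 < l * (l * e) * e := by positivity
        linarith

end DynEdgeColoring

open DynEdgeColoring in
theorem mainTheorem2 :
    ∃ (A : DynGraph.DynAlg) (c : ℕ) (C : ℝ),
      ∀ (ε : ℝ) (n α w : ℕ) (us : List (DynGraph.Update n)),
        0 < ε → ε < 1 →
        (n + α + ⌈1 / ε⌉₊) ^ c ≤ 2 ^ w →
        DynGraph.LegalSeq us →
        (∀ t ≤ us.length, DynGraph.ArboricityLE (DynGraph.graphAt us t) α) →
        ∃ (s : ℕ → WordRAM.Store) (τ : ℕ → ℕ),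
          A.Run w α ⌈1 / ε⌉₊ us s τ ∧
          (∀ t ≤ us.length,
            DynGraph.IsEdgeColoring (DynGraph.graphAt us t)
              ((DynGraph.maxDegreeOver us : ℝ) + (4 + ε) * α) (DynGraph.coloring n (s t))) ∧
          (∀ t < us.length,
            (DynGraph.recourse (DynGraph.coloring n (s t)) (DynGraph.coloring n (s (t + 1))) : ℝ)
              ≤ C * (Real.log n / ε)) ∧
          ((∑ t ∈ Finset.range us.length, τ t : ℕ) : ℝ) ≤
            us.length *
              (C * (Real.log n ^ 2 * Real.log (DynGraph.maxDegreeOver us + 1) / ε ^ 2)) := by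
  refine ⟨alg, 14, 320000000, ?_⟩
  intro ε n α w us hε hε1 hw hlegal hα
  set q := ⌈1 / ε⌉₊ with hq
  let p : Par := ⟨n, α, q, 2 ^ w⟩
  have hqle : 1 / ε ≤ q := Nat.le_ceil _
  have hq1 : 1 < q := by
    have h1 : 1 < 1 / ε := by
      rw [lt_div_iff₀ hε]
      linarith
    exact_mod_cast h1.trans_le hqle
  have hqε : 1 / (q : ℝ) ≤ ε := by
    rw [div_le_iff₀ hε] at hqle
    rw [div_le_iff₀ (by positivity)]
    linarith
  have hnt := fun h : 0 < us.length => nontrivial_of_legal h hlegal hα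
  obtain ⟨s, τ, h0, hexec, hgood, hrec, htime⟩ := run_exists (p := p) (us := us)
    (fun h => Par.ok_of_le (hnt h).1 (hnt h).2.1 hq1 hw) hlegal hα
  refine ⟨s, τ, ⟨h0, hexec⟩, ?_, ?_, ?_⟩
  · intro t ht
    obtain ⟨χ, ℓ, M, h⟩ := hgood t ht
    exact h.isEdgeColoring (by change 0 < q; omega) hqε
  · intro t ht
    obtain ⟨hn, -, -⟩ := hnt (by omega)
    obtain ⟨h1, -⟩ := Par.bounds (p := p) hn hε hε1 hq
    have h2 : ((DynGraph.recourse (DynGraph.coloring n (s t)) (DynGraph.coloring n (s (t + 1))) : ℕ)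
        : ℝ) ≤ ((2 * p.L + 1 : ℕ) : ℝ) := by exact_mod_cast hrec t ht
    refine h2.trans (h1.trans ?_)
    have h3 : 0 ≤ Real.log n / ε := div_nonneg (Real.log_natCast_nonneg n) hε.le
    change 200 * (Real.log n / ε) ≤ _
    linarith
  · rcases Nat.eq_zero_or_pos us.length with hT | hT
    · simp [hT]
    obtain ⟨hn, -, hΔ⟩ := hnt hT
    obtain ⟨-, h1⟩ := Par.bounds (p := p) hn hε hε1 hq
    have h2 : ((∑ t ∈ Finset.range us.length, τ t : ℕ) : ℝ) ≤ us.length * (p.budget : ℝ) := by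
      exact_mod_cast htime
    refine h2.trans (mul_le_mul_of_nonneg_left (h1.trans ?_) (Nat.cast_nonneg _))
    -- The maximum degree is at least one, so that its logarithmic factor is at least `log 2`.
    have h3 : 1 / 2 ≤ Real.log (DynGraph.maxDegreeOver us + 1) := by
      refine half_lt_log_two.le.trans (Real.log_le_log (by norm_num) ?_)
      have : (1 : ℝ) ≤ DynGraph.maxDegreeOver us := by exact_mod_cast hΔ
      linarith
    have h4 : 0 ≤ Real.log n ^ 2 / ε ^ 2 := by positivity
    change 160000000 * (Real.log n ^ 2 / ε ^ 2) ≤ _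
    rw [mul_div_right_comm]
    nlinarith
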